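/- Let $\mathcal C$ be a symmetric monoidal category that is additive and $\mathbb{Q}$-linear, has finite colimits, and whose tensor product is biadditive. Let $K_0(\mathcal C)$ be its Grothendieck ring (sum given by $\oplus$, product by $\otimes$). For an $S_n$-module $W$ in $\mathcal C$ (an object with an action of $S_n$) put $$\mathrm{ch}_n(W)=\frac1{n!}\sum_{\sigma\in S_n}\mathrm{Tr}_\sigma(W)\,p_\sigma\in\Lambda_n\otimes K_0(\mathcal C)\otimes\mathbb{Q},$$ where $p_\sigma$ is the product of the power sums $p_{|O|}$ over the orbits $O$ of $\sigma$ and $\mathrm{Tr}_\sigma(W)\in K_0(\mathcal C)\otimes\mathbb{Q}$ is the trace of $\sigma$ on $W$. Let $\mathrm{rk}$ be the homomorphism that sets $p_1=x$ and $p_n=0$ for $n>1$; it takes values in $(K_0(\mathcal C)\otimes\mathbb{Q})[[x]]$ on the completion $\Lambda\hat\otimes K_0(\mathcal C)\otimes\mathbb{Q}=(K_0(\mathcal C)\otimes\mathbb{Q})[[p_1,p_2,\dots]]$. Let $\mathcal V$ be a stable $\mathbb{S}$-module in $\mathcal C$, that is, a family of $S_n$-modules $\mathcal V((g,n))$ for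 $2(g-1)+n>0$. Let $\Gamma_{g,n}$ be the groupoid of stable graphs of genus $g$ with $n$ totally ordered legs and their isomorphisms, and put $$\mathbb{M}\mathcal V((g,n))=\operatorname*{colim}_{G\in\Gamma_{g,n}}\ \bigotimes_{v\in\mathrm{Vert}(G)}\mathcal V((g(v),n(v))),$$ on which $S_n$ acts by renumbering the legs. Define $$\mathbf a_g=\sum_{2(g-1)+n>0}\mathrm{ch}_n(\mathcal V((g,n))),\qquad \mathbf b_g=\sum_{2(g-1)+n>0}\mathrm{ch}_n(\mathbb{M}\mathcal V((g,n))),$$ and $a_g=\mathrm{rk}(\mathbf a_g)$, $b_g=\mathrm{rk}(\mathbf b_g)$, $\dot a_0=\mathrm{rk}(\partial\mathbf a_0/\partial p_2)$. Write $'$ for $d/dx$. Then the series $x-a_0'$ has zero constant term, so that it may be substituted into a power series, and $$b_1\circ(x-a_0')=a_1-\tfrac12\log(1-a_0'')+\dot a_0(\dot a_0+1).$$ -/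

import Mathlib

open CategoryTheory MonoidalCategory Limits
open scoped Nat TensorProduct

universe v u

noncomputable section

namespace ModularOperad

/-! ## The Grothendieck ring -/

section Grothendieck

variable (C : Type u) [Category.{v} C] [Preadditive C] [HasBinaryBiproducts C]
  [MonoidalCategory C] [SymmetricCategory C]

/-- The relations `[A ⊕ B] = [A] + [B]` in the free abelian group on the isomorphism classes of
objects of `C` (which is a ring under the tensor product). -/
def directSumRelations : Set (MonoidAlgebra ℤ (Skeleton C)) :=
  {r | ∃ A B : C, r = MonoidAlgebra.of ℤ (Skeleton C) (toSkeleton (A ⊞ B))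
    - MonoidAlgebra.of ℤ (Skeleton C) (toSkeleton A)
    - MonoidAlgebra.of ℤ (Skeleton C) (toSkeleton B)}

/-- The Grothendieck ring `K₀(C)` of an additive symmetric monoidal category `C`: generated by the
isomorphism classes of objects, with sum given by direct sum and product by tensor product. As the
tensor product is biadditive, the ideal spanned by the relations is also the additive subgroup that
they generate. -/
abbrev K0 : Type u :=
  MonoidAlgebra ℤ (Skeleton C) ⧸ Ideal.span (directSumRelations C)

/-- `K₀(C) ⊗ ℚ`. -/
abbrev K0Rat : Type u := ℚ ⊗[ℤ] K0 C

variable {C}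

/-- The class `[X]` of an object in `K₀(C) ⊗ ℚ`. -/
def cls (X : C) : K0Rat C :=
  (1 : ℚ) ⊗ₜ[ℤ] Ideal.Quotient.mk (Ideal.span (directSumRelations C))
    (MonoidAlgebra.of ℤ (Skeleton C) (toSkeleton X))

end Grothendieck

/-! ## `𝕊`-modules, characters and symmetric functions -/

section Characteristic

variable {C : Type u} [Category.{v} C] [Preadditive C] [Linear ℚ C] [HasBinaryBiproducts C]
  [MonoidalCategory C] [SymmetricCategory C] [HasFiniteColimits C]

/-- The part of the `S_n`-module `W` on which the eigenvalues of `σ` are the primitive `d`-th roots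
of unity. Since `σ` has finite order and `C` is `ℚ`-linear, the kernel of `Φ_d(σ)` is a direct
summand and is isomorphic to the cokernel. -/
def cyclotomicPart {n : ℕ} (W : Action C (Equiv.Perm (Fin n))) (σ : Equiv.Perm (Fin n)) (d : ℕ) :
    C :=
  cokernel (X := W.V) (Y := W.V)
    (Polynomial.aeval (R := ℚ) (A := End W.V) (W.ρ σ) (Polynomial.cyclotomic d ℚ))

/-- The trace `Tr_σ(W)`: the sum of the eigenvalues of `σ` on `W`, each one multiplied by the class
of its eigenobject. Characters of symmetric groups being rational, conjugate eigenvalues occur with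
the same multiplicity, so that a primitive `d`-th root of unity may be replaced by the average
`μ(d) / φ(d)` of all of them: on `V_λ ⊗ M` the trace is `χ_λ(σ) [M]`, as in the Peter-Weyl
decomposition. -/
def trace {n : ℕ} (W : Action C (Equiv.Perm (Fin n))) (σ : Equiv.Perm (Fin n)) : K0Rat C :=
  ∑ d ∈ (orderOf σ).divisors,
    ((ArithmeticFunction.moebius d : ℚ) / (φ d : ℚ)) • cls (cyclotomicPart W σ d)

/-- The ring `Λ ⊗̂ K₀(C) ⊗ ℚ` of symmetric functions with coefficients in `K₀(C) ⊗ ℚ`, completed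
with respect to the degree: power series in the power sums `p_1, p_2, …`. (There are only finitely
many monomials in the `p_i` of a given degree, where `p_i` has degree `i`.) -/
abbrev SymFun (C : Type u) [Category.{v} C] [Preadditive C] [HasBinaryBiproducts C]
    [MonoidalCategory C] [SymmetricCategory C] : Type u :=
  MvPowerSeries ℕ+ (K0Rat C)

/-- `p_σ`, the product of the power sums `p_{|O|}` over the orbits `O` of `σ`. -/
def powerSum (C : Type u) [Category.{v} C] [Preadditive C] [HasBinaryBiproducts C]
    [MonoidalCategory C] [SymmetricCategory C] {n : ℕ} (σ : Equiv.Perm (Fin n)) : SymFun C :=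
  (σ.partition.parts.map fun k => (MvPowerSeries.X k.toPNat' : SymFun C)).prod

/-- The characteristic `ch_n(W)` of an `S_n`-module. -/
def ch {n : ℕ} (W : Action C (Equiv.Perm (Fin n))) : SymFun C :=
  ((n ! : ℚ)⁻¹) • ∑ σ : Equiv.Perm (Fin n), MvPowerSeries.C (trace W σ) * powerSum C σ

/-- The degree of the monomial `∏ p_i ^ (m i)`. -/
def symDegree (m : ℕ+ →₀ ℕ) : ℕ := m.sum fun i e => (i : ℕ) * e

/-- A stable `𝕊`-module: `S_n`-modules `V((g, n))`. Only the values with `2(g-1) + n > 0` are ever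
used. -/
abbrev StableSModule (C : Type u) [Category.{v} C] : Type (max u v) :=
  (_ : ℕ) → (n : ℕ) → Action C (Equiv.Perm (Fin n))

/-- The generating function `∑_{2(g-1)+n>0} ch_n(V((g, n)))`. As `ch_n` is homogeneous of degree
`n`, the coefficient of a monomial of degree `n` in the sum is its coefficient in `ch_n`. -/
def genFun (V : StableSModule C) (g : ℕ) : SymFun C := fun m =>
  if 2 < 2 * g + symDegree m then MvPowerSeries.coeff m (ch (V g (symDegree m))) else 0

/-- The rank homomorphism `rk : Λ → ℚ[x]`, that is `h_n ↦ x^n / n!`, extended to the completions: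
`p_1 ↦ x` and `p_n ↦ 0` for `n > 1`. -/
def rk {A : Type*} [CommRing A] (f : MvPowerSeries ℕ+ A) : PowerSeries A :=
  PowerSeries.mk fun n => MvPowerSeries.coeff (Finsupp.single 1 n) f

end Characteristic

/-! ## Reordering the factors of a tensor product -/

section Reorder

variable {C : Type u} [Category.{v} C] [MonoidalCategory C]

theorem here_aux {A B D M : C} (s : A ⊗ B ⟶ D) (t : D ⟶ M) :
    A ◁ 𝟙 B ≫ s ≫ t = s ≫ t ≫ 𝟙 M := by
  simp

variable [SymmetricCategory C]

/-- The symmetry exchanging the first two factors. -/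
def swapLeft (A B L : C) : A ⊗ (B ⊗ L) ⟶ B ⊗ (A ⊗ L) :=
  (α_ A B L).inv ≫ (β_ A B).hom ▷ L ≫ (α_ B A L).hom

theorem swapLeft_swapLeft (A B L : C) : swapLeft A B L ≫ swapLeft B A L = 𝟙 _ := by
  simp only [swapLeft, Category.assoc, Iso.hom_inv_id_assoc]
  rw [← comp_whiskerRight_assoc, SymmetricCategory.symmetry]; simp

theorem swapLeft_natural {A A' B B' L L' : C} (f : A ⟶ A') (g : B ⟶ B') (h : L ⟶ L') :
    (f ⊗ₘ (g ⊗ₘ h)) ≫ swapLeft A' B' L' = swapLeft A B L ≫ (g ⊗ₘ (f ⊗ₘ h)) := by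
  simp only [swapLeft, Category.assoc]
  rw [associator_inv_naturality_assoc, ← associator_naturality, ← tensorHom_id, ← tensorHom_id,
    tensorHom_comp_tensorHom_assoc, tensorHom_comp_tensorHom_assoc, BraidedCategory.braiding_naturality]
  simp

theorem swapLeft_yangBaxter (A B D L : C) :
    B ◁ swapLeft A D L ≫ swapLeft B D (A ⊗ L) ≫ D ◁ swapLeft B A L =
      swapLeft B A (D ⊗ L) ≫ A ◁ swapLeft B D L ≫ swapLeft A D (B ⊗ L) := by
  have h := BraidedCategory.yang_baxter' B A D
  have h1 : B ◁ swapLeft A D L ≫ swapLeft B D (A ⊗ L) ≫ D ◁ swapLeft B A L =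
      𝟙 _ ⊗≫ (𝟙 ((B ⊗ A) ⊗ D) ⊗≫ (B ◁ (β_ A D).hom ⊗≫ (β_ B D).hom ▷ A ⊗≫ D ◁ (β_ B A).hom) ⊗≫ 𝟙 ((D ⊗ A) ⊗ B)) ▷ L
        ⊗≫ 𝟙 _ := by
    simp only [swapLeft]; monoidal
  have h2 : swapLeft B A (D ⊗ L) ≫ A ◁ swapLeft B D L ≫ swapLeft A D (B ⊗ L) =
      𝟙 _ ⊗≫ ((β_ B A).hom ▷ D ⊗≫ A ◁ (β_ B D).hom ⊗≫ (β_ A D).hom ▷ B) ▷ L ⊗≫ 𝟙 _ := by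
    simp only [swapLeft]; monoidal
  rw [h1, h2, h]

variable {ι κ τ : Type}

/-- The tensor product of the objects `X i` for `i` running through a list. -/
def tensorList (X : ι → C) : List ι → C
  | [] => 𝟙_ C
  | a :: l => X a ⊗ tensorList X l

/-- `Ins a l l'`: the list `l'` arises from `l` by inserting `a` at some place. -/
inductive Ins (a : ι) : List ι → List ι → Type
  | here (l : List ι) : Ins a l (a :: l)
  | there (b : ι) {l l' : List ι} (i : Ins a l l') : Ins a (b :: l) (b :: l')

/-- The symmetry that moves the factor `X a` to its place. -/
def Ins.hom (X : ι → C) {a : ι} : {l l' : List ι} → Ins a l l' →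
    (X a ⊗ tensorList X l ⟶ tensorList X l')
  | _, _, .here l => 𝟙 (X a ⊗ tensorList X l)
  | _, _, .there (l := l) b i =>
      swapLeft (X a) (X b) (tensorList X l) ≫ X b ◁ i.hom X

/-- `Reorder e l l'`: the list `l'` arises by permuting the list of the `e i`, `i ∈ l`. -/
inductive Reorder (e : ι → κ) : List ι → List κ → Type
  | nil : Reorder e [] []
  | cons (a : ι) {l : List ι} {l' l'' : List κ} (r : Reorder e l l') (i : Ins (e a) l' l'') :
      Reorder e (a :: l) l''

/-- The morphism `⨂_{i ∈ l} X i ⟶ ⨂_{j ∈ l'} Y j` that applies `f i` to each factor and then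
permutes the factors by means of the symmetry. -/
def Reorder.hom {X : ι → C} {Y : κ → C} {e : ι → κ} (f : ∀ i, X i ⟶ Y (e i)) :
    {l : List ι} → {l' : List κ} → Reorder e l l' → (tensorList X l ⟶ tensorList Y l')
  | _, _, .nil => 𝟙 (𝟙_ C)
  | _, _, .cons a r i => (f a ⊗ₘ r.hom f) ≫ i.hom Y

theorem Ins.perm {a : ι} {l l' : List ι} (i : Ins a l l') : l'.Perm (a :: l) := by
  induction i with
  | here l => exact List.Perm.refl _
  | there b i ih => exact (ih.cons b).trans (List.Perm.swap _ _ _)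

theorem Ins.subsingleton {a : ι} {l₁ l₂ l' : List ι} (i : Ins a l₁ l') (j : Ins a l₂ l')
    (h : l'.Nodup) : ∃ e : l₁ = l₂, e ▸ i = j := by
  induction i generalizing l₂ with
  | here l =>
    cases j with
    | here => exact ⟨rfl, rfl⟩
    | there b j =>
      exact absurd (j.perm.mem_iff.2 (List.mem_cons_self ..)) (List.nodup_cons.1 h).1
  | there b i ih =>
    cases j with
    | here => exact absurd (i.perm.mem_iff.2 (List.mem_cons_self ..)) (List.nodup_cons.1 h).1
    | there _ j =>
      obtain ⟨rfl, h2⟩ := ih j (List.nodup_cons.1 h).2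
      exact ⟨rfl, by cases h2; rfl⟩

theorem Reorder.subsingleton {e : ι → κ} {l : List ι} {l' : List κ} (p q : Reorder e l l')
    (h : l'.Nodup) : p = q := by
  induction p with
  | nil => cases q; rfl
  | cons a r i ih =>
    cases q with
    | cons _ r' i' =>
      obtain ⟨rfl, h2⟩ := Ins.subsingleton i i' h
      cases h2
      rw [ih r' (List.nodup_cons.1 (i.perm.nodup_iff.1 h)).2]

theorem Ins.nonempty (a : ι) (s t : List ι) : Nonempty (Ins a (s ++ t) (s ++ a :: t)) := by
  induction s with
  | nil => exact ⟨.here t⟩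
  | cons b s ih => exact ih.elim fun i => ⟨.there b i⟩

theorem Reorder.nonempty (e : ι → κ) (l : List ι) (l' : List κ) (h : l'.Perm (l.map e)) :
    Nonempty (Reorder e l l') := by
  induction l generalizing l' with
  | nil => obtain rfl := List.perm_nil.1 h; exact ⟨.nil⟩
  | cons a l ih =>
    obtain ⟨s, t, rfl⟩ := List.append_of_mem (h.mem_iff.2 (List.mem_cons_self ..))
    obtain ⟨r⟩ := ih (s ++ t) (List.perm_middle.symm.trans h).cons_inv
    exact (Ins.nonempty (e a) s t).elim fun i => ⟨.cons a r i⟩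

theorem exchange_aux {A B D L₁ L₂ L₃ M M' : C} (j : A ⊗ L₁ ⟶ L₂) (k : B ⊗ L₂ ⟶ L₃)
    (k' : B ⊗ L₁ ⟶ M) (j' : A ⊗ M ⟶ L₃) (t : D ⊗ L₃ ⟶ M')
    (h : B ◁ j ≫ k = swapLeft B A L₁ ≫ A ◁ k' ≫ j') :
    B ◁ (swapLeft A D L₁ ≫ D ◁ j) ≫ swapLeft B D L₂ ≫ D ◁ k ≫ t =
      swapLeft B A (D ⊗ L₁) ≫ A ◁ (swapLeft B D L₁ ≫ D ◁ k') ≫ swapLeft A D M ≫ D ◁ j' ≫ t := by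
  have n1 := swapLeft_natural (𝟙 B) (𝟙 D) j
  have n2 := swapLeft_natural (𝟙 A) (𝟙 D) k'
  simp only [id_tensorHom] at n1 n2
  rw [whiskerLeft_comp, Category.assoc, reassoc_of% n1, ← whiskerLeft_comp_assoc, h,
    whiskerLeft_comp, whiskerLeft_comp, Category.assoc, Category.assoc,
    reassoc_of% (swapLeft_yangBaxter A B D L₁), whiskerLeft_comp_assoc, reassoc_of% n2]

/-- Two insertions in a row may be exchanged. -/
theorem Ins.exchange (X : ι → C) {a b : ι} {l₁ l₂ l₃ : List ι} (j : Ins a l₁ l₂)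
    (k : Ins b l₂ l₃) : ∃ (m : List ι) (k' : Ins b l₁ m) (j' : Ins a m l₃),
      X b ◁ j.hom X ≫ k.hom X =
        swapLeft (X b) (X a) (tensorList X l₁) ≫ X a ◁ k'.hom X ≫ j'.hom X := by
  induction k generalizing l₁ with
  | here l =>
    refine ⟨_, .here _, .there b j, ?_⟩
    have h := swapLeft_swapLeft (X b) (X a) (tensorList X l₁)
    change X b ◁ j.hom X ≫ 𝟙 (X b ⊗ tensorList X l) = _ ≫ X a ◁ 𝟙 (X b ⊗ tensorList X l₁) ≫
      swapLeft (X a) (X b) (tensorList X l₁) ≫ X b ◁ j.hom X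
    rw [whiskerLeft_id, Category.id_comp, reassoc_of% h, Category.comp_id]
  | there c k ih =>
    cases j with
    | here l =>
      exact ⟨_, k, .here _, here_aux _ _⟩
    | there _ j =>
      obtain ⟨m, k', j', h⟩ := ih j
      refine ⟨_, .there c k', .there c j', ?_⟩
      have := exchange_aux (D := X c) _ _ _ _ (𝟙 _) h
      rw [Category.comp_id, Category.comp_id] at this
      exact this

theorem natural_aux {A A' B B' L₀ L L₀' L' M M' : C} (fa : A ⟶ A') (fb : B ⟶ B')
    (i : A ⊗ L₀ ⟶ L) (r : L ⟶ L') (q : L₀ ⟶ L₀') (j : A' ⊗ L₀' ⟶ L') (k : B' ⊗ L' ⟶ M)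
    (k' : B' ⊗ L₀' ⟶ M') (j' : A' ⊗ M' ⟶ M) (h : i ≫ r = (fa ⊗ₘ q) ≫ j)
    (h' : B' ◁ j ≫ k = swapLeft B' A' L₀' ≫ A' ◁ k' ≫ j') :
    (swapLeft A B L₀ ≫ B ◁ i) ≫ (fb ⊗ₘ r) ≫ k = (fa ⊗ₘ ((fb ⊗ₘ q) ≫ k')) ≫ j' := by
  have e1 : B ◁ i ≫ (fb ⊗ₘ r) = (fb ⊗ₘ (fa ⊗ₘ q)) ≫ B' ◁ j := by
    rw [← id_tensorHom, ← id_tensorHom, tensorHom_comp_tensorHom, tensorHom_comp_tensorHom, h]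
    simp
  have n := swapLeft_natural fb fa q
  have e2 : (fa ⊗ₘ ((fb ⊗ₘ q) ≫ k')) = (fa ⊗ₘ (fb ⊗ₘ q)) ≫ A' ◁ k' := by
    rw [← id_tensorHom, tensorHom_comp_tensorHom]; simp
  have e3 := swapLeft_swapLeft A B L₀
  rw [Category.assoc, reassoc_of% e1, h', reassoc_of% n, reassoc_of% e3, e2, Category.assoc]

theorem Ins.natural {X : ι → C} {Y : κ → C} {e : ι → κ} (f : ∀ i, X i ⟶ Y (e i)) {a : ι}
    {l₀ l : List ι} {l'' : List κ} (i : Ins a l₀ l) (q : Reorder e l l'') :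
    ∃ (m : List κ) (q₀ : Reorder e l₀ m) (j : Ins (e a) m l''),
      i.hom X ≫ q.hom f = (f a ⊗ₘ q₀.hom f) ≫ j.hom Y := by
  induction i generalizing l'' with
  | here l => cases q with
    | cons _ r j => exact ⟨_, r, j, Category.id_comp (X := X a ⊗ tensorList X l) _⟩
  | there b i ih => cases q with
    | cons _ r k =>
      obtain ⟨m, q₀, j, h⟩ := ih r
      obtain ⟨m', k', j', h'⟩ := Ins.exchange Y j k
      exact ⟨m', .cons b q₀ k', j', natural_aux _ (f b) _ _ _ _ _ _ _ h h'⟩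

theorem Reorder.comp {X : ι → C} {Y : κ → C} {Z : τ → C} {e : ι → κ} {e' : κ → τ}
    (f : ∀ i, X i ⟶ Y (e i)) (f' : ∀ j, Y j ⟶ Z (e' j)) {l : List ι} {l' : List κ} {l'' : List τ}
    (p : Reorder e l l') (q : Reorder e' l' l'') :
    ∃ r : Reorder (e' ∘ e) l l'',
      r.hom (fun i => f i ≫ f' (e i)) = p.hom f ≫ q.hom f' := by
  induction p generalizing l'' with
  | nil => cases q; exact ⟨.nil, (Category.id_comp (𝟙 (𝟙_ C))).symm⟩
  | cons a p i ih =>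
    obtain ⟨m, q₀, j, h⟩ := Ins.natural f' i q
    obtain ⟨r, hr⟩ := ih q₀
    refine ⟨.cons a r j, ?_⟩
    change ((f a ≫ f' (e a)) ⊗ₘ r.hom _) ≫ j.hom Z = ((f a ⊗ₘ p.hom f) ≫ i.hom Y) ≫ q.hom f'
    rw [hr, Category.assoc, h, ← tensorHom_comp_tensorHom, Category.assoc]

theorem Reorder.refl (X : ι → C) (l : List ι) :
    ∃ r : Reorder (fun i : ι => i) l l, r.hom (X := X) (Y := X) (fun i => 𝟙 (X i)) = 𝟙 _ := by
  induction l with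
  | nil => exact ⟨.nil, rfl⟩
  | cons a l ih =>
    obtain ⟨r, hr⟩ := ih
    refine ⟨.cons a r (.here l), ?_⟩
    change (𝟙 (X a) ⊗ₘ r.hom _) ≫ 𝟙 (X a ⊗ tensorList X l) = 𝟙 (X a ⊗ tensorList X l)
    rw [hr, Category.comp_id, id_tensorHom_id]

end Reorder

/-! ## Stable graphs -/

/-- A stable graph of genus `g` with `n` ordered legs. The vertices are numbered, and so are the
flags at each vertex; every stable graph is isomorphic to one of this form. -/
structure StableGraph (g n : ℕ) : Type where
  /-- the number of vertices -/
  numVert : ℕ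
  /-- the valence `n(v)`, that is the number of flags at `v` -/
  val : Fin numVert → ℕ
  /-- the genus `g(v)` of a vertex -/
  genus : Fin numVert → ℕ
  /-- the involution of the set of flags; its two-element orbits are the edges and its fixed points
  are the legs -/
  inv : (Σ v, Fin (val v)) → (Σ v, Fin (val v))
  /-- the total ordering of the legs -/
  leg : Fin n → (Σ v, Fin (val v))
  inv_inv : ∀ f, inv (inv f) = f
  leg_injective : Function.Injective leg
  inv_eq_self : ∀ f, inv f = f ↔ ∃ i, leg i = f
  stable : ∀ v, 2 < 2 * genus v + val v
  nonempty : 0 < numVert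
  connected : ∀ v w, Relation.ReflTransGen
    (fun v w => ∃ f : Σ v, Fin (val v), f.1 = v ∧ (inv f).1 = w) v w
  /-- `g = ∑ g(v) + dim H₁`, where `dim H₁ = #edges - #vertices + 1` -/
  genus_eq : ∑ v, genus v + Fintype.card {f // inv f ≠ f} / 2 + 1 = g + numVert

namespace StableGraph

variable {g n : ℕ}

/-- The flags of a stable graph. -/
abbrev Flag (G : StableGraph g n) : Type := Σ v, Fin (G.val v)

/-- An isomorphism of stable graphs: a bijection of the vertices and one of the flags (compatible
with the incidence of flags and vertices) that respect the genera, the involution, and the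
ordering of the legs. -/
@[ext]
structure Hom (G H : StableGraph g n) : Type where
  vert : Fin G.numVert ≃ Fin H.numVert
  flag : ∀ v, Fin (G.val v) ≃ Fin (H.val (vert v))
  genus_vert : ∀ v, G.genus v = H.genus (vert v)
  inv_flag : ∀ f : G.Flag,
    H.inv ⟨vert f.1, flag f.1 f.2⟩ = ⟨vert (G.inv f).1, flag (G.inv f).1 (G.inv f).2⟩
  leg_flag : ∀ i, H.leg i = ⟨vert (G.leg i).1, flag (G.leg i).1 (G.leg i).2⟩

/-- The groupoid `Γ_{g,n}` of stable graphs and their isomorphisms. -/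
instance : Category.{0} (StableGraph g n) where
  Hom := Hom
  id G := ⟨Equiv.refl _, fun _ => Equiv.refl _, fun _ => rfl, fun _ => rfl, fun _ => rfl⟩
  comp {G H K} p q :=
    { vert := p.vert.trans q.vert
      flag := fun v => (p.flag v).trans (q.flag (p.vert v))
      genus_vert := fun v => (p.genus_vert v).trans (q.genus_vert _)
      inv_flag := fun f => by
        have h1 := p.inv_flag f
        have h2 := q.inv_flag ⟨p.vert f.1, p.flag f.1 f.2⟩
        rw [h1] at h2
        exact h2
      leg_flag := fun i => by
        have h := q.leg_flag i
        rw [p.leg_flag i] at h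
        exact h }
  id_comp _ := rfl
  comp_id _ := rfl
  assoc _ _ _ := rfl

theorem sum_val (G : StableGraph g n) :
    ∑ v, G.val v = n + Fintype.card {f // G.inv f ≠ f} := by
  have h1 : Fintype.card G.Flag = ∑ v, G.val v := by simp [Fintype.card_sigma]
  have h2 : Fintype.card {f // G.inv f = f} = n := by
    let e : Fin n ≃ {f // G.inv f = f} := Equiv.ofBijective
      (fun i => ⟨G.leg i, (G.inv_eq_self _).2 ⟨i, rfl⟩⟩)
      ⟨fun i j h => G.leg_injective (congrArg Subtype.val h), fun ⟨f, hf⟩ =>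
        ((G.inv_eq_self f).1 hf).imp fun i h => Subtype.ext h⟩
    simpa using (Fintype.card_congr e).symm
  have h3 : Fintype.card {f // G.inv f = f} + Fintype.card {f // G.inv f ≠ f} =
      Fintype.card G.Flag := by
    rw [← Fintype.card_sum]
    exact Fintype.card_congr (Equiv.sumCompl _)
  omega

theorem bounds (G : StableGraph g n) : G.numVert < 8 * g + 4 * n + 20 ∧
    (∀ v, G.val v < 8 * g + 4 * n + 20) ∧ ∀ v, G.genus v < 8 * g + 4 * n + 20 := by
  have h1 := G.sum_val
  have h2 := G.genus_eq
  have h3 : 3 * G.numVert ≤ 2 * ∑ v, G.genus v + ∑ v, G.val v := by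
    rw [Finset.mul_sum, ← Finset.sum_add_distrib]
    calc 3 * G.numVert = ∑ _ : Fin G.numVert, 3 := by simp [mul_comm]
      _ ≤ _ := Finset.sum_le_sum fun v _ => G.stable v
  have h4 : ∀ v, G.val v ≤ ∑ v, G.val v := fun v =>
    Finset.single_le_sum (f := G.val) (fun _ _ => Nat.zero_le _) (Finset.mem_univ v)
  have h5 : ∀ v, G.genus v ≤ ∑ v, G.genus v := fun v =>
    Finset.single_le_sum (f := G.genus) (fun _ _ => Nat.zero_le _) (Finset.mem_univ v)
  refine ⟨by omega, fun v => ?_, fun v => ?_⟩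
  · have := h4 v; omega
  · have := h5 v; omega

instance finite : Finite (StableGraph g n) := by
  let N := 8 * g + 4 * n + 20
  let D := Σ k : Fin N, Σ val : Fin k → Fin N, (Fin k → Fin N) ×
    ((Σ v : Fin k, Fin (val v)) → (Σ v : Fin k, Fin (val v))) × (Fin n → Σ v : Fin k, Fin (val v))
  let P : D → StableGraph g n → Prop := fun d G =>
    ∃ h : G.numVert = d.1, ∃ h' : G.val = fun v => (d.2.1 (Fin.cast h v) : ℕ),
      ∃ h'' : G.genus = fun v => (d.2.2.1 (Fin.cast h v) : ℕ),
      HEq G.inv d.2.2.2.1 ∧ HEq G.leg d.2.2.2.2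
  have hex : ∀ G : StableGraph g n, ∃ d, P d G := fun G =>
    ⟨⟨⟨G.numVert, G.bounds.1⟩, fun v => ⟨G.val v, G.bounds.2.1 v⟩,
      fun v => ⟨G.genus v, G.bounds.2.2 v⟩, G.inv, G.leg⟩, rfl, rfl, rfl, HEq.rfl, HEq.rfl⟩
  choose F hF using hex
  refine Finite.of_injective F fun G H hGH => ?_
  have hG := hF G
  have hH := hF H
  rw [← hGH] at hH
  generalize F G = d at hG hH
  obtain ⟨⟨k, hk⟩, val, gen, inv, leg⟩ := d
  cases G
  cases H
  obtain ⟨h0, h1, h2, h3, h4⟩ := hG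
  obtain ⟨h0', h1', h2', h3', h4'⟩ := hH
  dsimp only at h0 h1 h2 h3 h4 h0' h1' h2' h3' h4'
  clear hGH
  subst h0
  subst h0'
  subst h1
  subst h1'
  subst h2
  subst h2'
  obtain rfl := eq_of_heq (h3.trans h3'.symm)
  obtain rfl := eq_of_heq (h4.trans h4'.symm)
  rfl

instance finite_hom (G H : StableGraph g n) : Finite (G ⟶ H) := by
  let F : (G ⟶ H) → Σ vert : Fin G.numVert ≃ Fin H.numVert,
      ∀ v, Fin (G.val v) ≃ Fin (H.val (vert v)) := fun p => ⟨Hom.vert p, Hom.flag p⟩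
  have hF : ∀ p q : Hom G H, F p = F q → p = q := by
    rintro ⟨_, _, _, _, _⟩ ⟨_, _, _, _, _⟩ h
    cases h
    rfl
  exact Finite.of_injective F fun p q h => hF p q h

instance finCategory : FinCategory (StableGraph g n) where
  fintypeObj := Fintype.ofFinite _
  fintypeHom _ _ := Fintype.ofFinite _

/-- Renumbering the legs: the leg `i` of `G` becomes the leg `s i`. -/
def relabel (s : Equiv.Perm (Fin n)) : StableGraph g n ⥤ StableGraph g n where
  obj G :=
    { G with
      leg := fun i => G.leg (s.symm i)
      leg_injective := G.leg_injective.comp s.symm.injective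
      inv_eq_self := fun f => (G.inv_eq_self f).trans
        ⟨fun ⟨i, h⟩ => ⟨s i, by simpa using h⟩, fun ⟨i, h⟩ => ⟨_, h⟩⟩ }
  map p := ⟨p.vert, p.flag, p.genus_vert, p.inv_flag, fun i => p.leg_flag (s.symm i)⟩

end StableGraph

/-! ## The stable `𝕊`-module `𝕄V` -/

section Free

variable {C : Type u} [Category.{v} C]

/-- The morphism `V((g, m)) ⟶ V((h, n))` induced by a bijection, which exists only if `m = n`: it
is the action of the corresponding permutation. -/
def StableSModule.map (V : StableSModule C) {g h m n : ℕ} (hg : g = h) (e : Fin m ≃ Fin n) :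
    (V g m).V ⟶ (V h n).V :=
  have hmn : m = n := by simpa using Fintype.card_congr e
  eqToHom (by rw [hg, hmn]) ≫ (V h n).ρ ((finCongr hmn).symm.trans e)

theorem StableSModule.map_refl (V : StableSModule C) {g m : ℕ} (hg : g = g) :
    V.map hg (Equiv.refl (Fin m)) = 𝟙 _ := by
  have h : (finCongr (rfl : m = m)).symm.trans (Equiv.refl (Fin m)) = 1 := by ext; rfl
  simp only [map, eqToHom_refl, Category.id_comp]
  rw [h]
  exact Action.ρ_one _

theorem StableSModule.map_comp (V : StableSModule C) {g h i m n k : ℕ} (hg : g = h) (hh : h = i)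
    (e : Fin m ≃ Fin n) (e' : Fin n ≃ Fin k) :
    V.map hg e ≫ V.map hh e' = V.map (hg.trans hh) (e.trans e') := by
  subst hg hh
  obtain rfl : m = n := by simpa using Fintype.card_congr e
  obtain rfl : m = k := by simpa using Fintype.card_congr e'
  simp only [map, eqToHom_refl, Category.id_comp]
  exact ((V g m).ρ.map_mul _ _).symm

variable [MonoidalCategory C] [SymmetricCategory C]

theorem StableGraph.Hom.nonempty_reorder {g n : ℕ} {G H : StableGraph g n}
    (p : StableGraph.Hom G H) :
    Nonempty (Reorder p.vert (List.finRange G.numVert) (List.finRange H.numVert)) := by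
  refine Reorder.nonempty _ _ _ ((List.perm_ext_iff_of_nodup (List.nodup_finRange _)
    ((List.nodup_finRange _).map p.vert.injective)).2 fun w => ?_)
  simp only [List.mem_finRange, List.mem_map, true_and, true_iff]
  exact p.vert.surjective w

/-- The functor `G ↦ ⨂_{v ∈ Vert(G)} V((g(v), n(v)))` on the groupoid of stable graphs. -/
def graphFunctor (V : StableSModule C) (g n : ℕ) : StableGraph g n ⥤ C where
  obj G := tensorList (fun v => (V (G.genus v) (G.val v)).V) (List.finRange G.numVert)
  map {G H} p := Reorder.hom
    (X := fun v => (V (G.genus v) (G.val v)).V) (Y := fun v => (V (H.genus v) (H.val v)).V)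
    (fun v => V.map (p.genus_vert v) (p.flag v)) p.nonempty_reorder.some
  map_id G := by
    obtain ⟨r, hr⟩ := Reorder.refl (fun v => (V (G.genus v) (G.val v)).V)
      (List.finRange G.numVert)
    rw [← hr]
    have hf : (fun v => V.map (StableGraph.Hom.genus_vert (𝟙 G) v)
        (StableGraph.Hom.flag (𝟙 G) v)) = fun v => 𝟙 (V (G.genus v) (G.val v)).V :=
      funext fun v => V.map_refl _
    rw [hf]
    exact congrArg _ (Reorder.subsingleton _ _ (List.nodup_finRange _))
  map_comp {G H K} p q := by
    obtain ⟨r, hr⟩ := Reorder.comp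
      (X := fun v => (V (G.genus v) (G.val v)).V) (Y := fun v => (V (H.genus v) (H.val v)).V)
      (Z := fun v => (V (K.genus v) (K.val v)).V)
      (fun v => V.map (StableGraph.Hom.genus_vert p v) (StableGraph.Hom.flag p v))
      (fun v => V.map (StableGraph.Hom.genus_vert q v) (StableGraph.Hom.flag q v))
      (StableGraph.Hom.nonempty_reorder p).some (StableGraph.Hom.nonempty_reorder q).some
    rw [← hr]
    have hf : (fun v => V.map (StableGraph.Hom.genus_vert p v) (StableGraph.Hom.flag p v) ≫
        V.map (StableGraph.Hom.genus_vert q (StableGraph.Hom.vert p v))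
          (StableGraph.Hom.flag q (StableGraph.Hom.vert p v))) =
        fun v => V.map (StableGraph.Hom.genus_vert (p ≫ q) v)
          (StableGraph.Hom.flag (p ≫ q) v) :=
      funext fun v => V.map_comp _ _ _ _
    rw [hf]
    exact congrArg _ (Reorder.subsingleton _ _ (List.nodup_finRange _))

variable [HasFiniteColimits C]

/-- `𝕄V((g, n))`, the colimit over the groupoid of stable graphs of
`⨂_{v ∈ Vert(G)} V((g(v), n(v)))`, with `S_n` acting by renumbering the legs. -/
def free (V : StableSModule C) : StableSModule C := fun g n =>
  { V := colimit (graphFunctor V g n)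
    ρ :=
      { toFun := fun s => colimit.desc (graphFunctor V g n)
          { pt := colimit (graphFunctor V g n)
            ι :=
              { app := fun G => colimit.ι (graphFunctor V g n) ((StableGraph.relabel s).obj G)
                naturality := fun G H p =>
                  (colimit.w (graphFunctor V g n) ((StableGraph.relabel s).map p)).trans
                    (Category.comp_id _).symm } }
        map_one' := colimit.hom_ext fun G =>
          (colimit.ι_desc _ _).trans (Category.comp_id _).symm
        map_mul' := fun s t => colimit.hom_ext fun G => by
          rw [End.mul_def, colimit.ι_desc]
          erw [colimit.ι_desc_assoc, colimit.ι_desc]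
          rfl } }

end Free

end ModularOperad

end

open CategoryTheory MonoidalCategory Limits
open scoped Nat TensorProduct

noncomputable section

namespace ModularOperad

theorem StableGraph.even_card_inv_ne {g n : ℕ} (G : StableGraph g n) :
    Even (Fintype.card {f // G.inv f ≠ f}) := by
  have hi : Function.Involutive G.inv := G.inv_inv
  have h := Equiv.Perm.card_compl_support_modEq (p := 2) (n := 1) (σ := hi.toPerm)
    (Equiv.ext fun f => G.inv_inv f)
  have h1 : Fintype.card {f // G.inv f ≠ f} = (hi.toPerm).support.card := by
    rw [Fintype.card_subtype]; congr 1
  have h2 := Finset.card_compl_add_card (hi.toPerm).support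
  rw [Nat.ModEq] at h
  rw [h1, Nat.even_iff]
  omega

theorem StableGraph.card_flag_eq {g n : ℕ} (G : StableGraph g n) (v : Fin G.numVert) :
    Nat.card {f : G.Flag // f.1 = v} = G.val v := by
  have e : {f : G.Flag // f.1 = v} ≃ Fin (G.val v) :=
    { toFun := fun f => f.2 ▸ f.1.2
      invFun := fun i => ⟨⟨v, i⟩, rfl⟩
      left_inv := by rintro ⟨⟨w, i⟩, rfl⟩; rfl
      right_inv := fun i => rfl }
  rw [Nat.card_congr e]; simp

/-- A connected stable graph of total genus one whose legs are labelled by `L`. The flags of an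
edge are exchanged by `inv`, the legs are its fixed points. -/
structure GenusOneGraph (L : Type) [Fintype L] : Type 1 where
  V : Type
  F : Type
  fintypeV : Fintype V
  fintypeF : Fintype F
  vtx : F → V
  genus : V → ℕ
  inv : F → F
  leg : L → F
  inv_inv : ∀ f, inv (inv f) = f
  leg_injective : Function.Injective leg
  inv_eq_self : ∀ f, inv f = f ↔ ∃ l, leg l = f
  stable : ∀ v, 2 < 2 * genus v + Nat.card {f // vtx f = v}
  nonempty : Nonempty V
  connected : ∀ S : Set V, S.Nonempty → (∀ f, vtx f ∈ S → vtx (inv f) ∈ S) → ∀ v, v ∈ S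
  -- Total genus one says that the genera and the number of edges add up to the number of vertices.
  -- There are `(#F - #L) / 2` edges; doubling removes the division and the subtraction.
  genus_eq : 2 * ∑ v, genus v + Fintype.card F = 2 * Fintype.card V + Fintype.card L

/-! ### Graphs of genus one and their isomorphisms. -/

namespace GenusOneGraph

attribute [instance] GenusOneGraph.fintypeV GenusOneGraph.fintypeF

variable {L : Type} [Fintype L]

/-- The valence of a vertex. -/
def valence (G : GenusOneGraph L) (v : G.V) : ℕ := Nat.card {f // G.vtx f = v}

theorem inv_leg (G : GenusOneGraph L) (l : L) : G.inv (G.leg l) = G.leg l :=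
  (G.inv_eq_self _).2 ⟨l, rfl⟩

theorem inv_injective (G : GenusOneGraph L) : Function.Injective G.inv :=
  Function.LeftInverse.injective G.inv_inv

/-- An isomorphism of graphs, compatible with the labelling of the legs. -/
@[ext]
structure Iso (G H : GenusOneGraph L) : Type where
  vert : G.V ≃ H.V
  flag : G.F ≃ H.F
  vtx_flag : ∀ f, H.vtx (flag f) = vert (G.vtx f)
  genus_vert : ∀ v, H.genus (vert v) = G.genus v
  inv_flag : ∀ f, H.inv (flag f) = flag (G.inv f)
  flag_leg : ∀ l, flag (G.leg l) = H.leg l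

namespace Iso

variable {G H K : GenusOneGraph L}

/-- The identity. -/
def refl (G : GenusOneGraph L) : Iso G G :=
  ⟨Equiv.refl _, Equiv.refl _, fun _ => rfl, fun _ => rfl, fun _ => rfl, fun _ => rfl⟩

/-- The inverse isomorphism. -/
def symm (p : Iso G H) : Iso H G where
  vert := p.vert.symm
  flag := p.flag.symm
  vtx_flag f := by rw [Equiv.eq_symm_apply, ← p.vtx_flag, Equiv.apply_symm_apply]
  genus_vert v := by rw [← p.genus_vert, Equiv.apply_symm_apply]
  inv_flag f := by rw [Equiv.eq_symm_apply, ← p.inv_flag, Equiv.apply_symm_apply]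
  flag_leg l := by rw [Equiv.symm_apply_eq, p.flag_leg]

/-- The composition of isomorphisms. -/
def trans (p : Iso G H) (q : Iso H K) : Iso G K where
  vert := p.vert.trans q.vert
  flag := p.flag.trans q.flag
  vtx_flag f := by simp [p.vtx_flag, q.vtx_flag]
  genus_vert v := by simp [p.genus_vert, q.genus_vert]
  inv_flag f := by simp [p.inv_flag, q.inv_flag]
  flag_leg l := by simp [p.flag_leg, q.flag_leg]

theorem ext_apply {p q : Iso G H} (hv : ∀ v, p.vert v = q.vert v)
    (hf : ∀ f, p.flag f = q.flag f) : p = q :=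
  Iso.ext (Equiv.ext hv) (Equiv.ext hf)

instance finite : Finite (Iso G H) :=
  Finite.of_injective (fun p : Iso G H => (p.vert, p.flag)) fun p q h => by
    rw [Prod.mk.injEq] at h
    exact Iso.ext h.1 h.2

instance fintype : Fintype (Iso G H) := Fintype.ofFinite _

/-- Conjugation by an isomorphism. -/
def conj (p : Iso G H) : Iso G G ≃ Iso H H where
  toFun q := (p.symm.trans q).trans p
  invFun q := (p.trans q).trans p.symm
  left_inv q := ext_apply (fun _ => by simp [trans, symm]) fun _ => by simp [trans, symm]
  right_inv q := ext_apply (fun _ => by simp [trans, symm]) fun _ => by simp [trans, symm]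

theorem valence_vert (p : Iso G H) (v : G.V) : H.valence (p.vert v) = G.valence v :=
  (Nat.card_congr (p.flag.subtypeEquiv fun f => by rw [p.vtx_flag, p.vert.apply_eq_iff_eq])).symm

end Iso

/-- Isomorphism is an equivalence relation. -/
instance setoid (L : Type) [Fintype L] : Setoid (GenusOneGraph L) where
  r G H := Nonempty (Iso G H)
  iseqv := ⟨fun G => ⟨.refl G⟩, fun ⟨p⟩ => ⟨p.symm⟩, fun ⟨p⟩ ⟨q⟩ => ⟨p.trans q⟩⟩

/-- Isomorphism classes of graphs. -/
abbrev Classes (L : Type) [Fintype L] : Type 1 := Quotient (setoid L)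

/-! ### The weight of a graph -/

section Weight

variable {R : Type*} [CommRing R] [Algebra ℚ R] (a t : ℕ → ℕ → R)

open Classical in
/-- The contribution of the vertex `v` to the trace of the automorphism `σ`: it is given by `a` if
`σ` fixes all flags at `v`, and by `t` otherwise. -/
def localWeight (G : GenusOneGraph L) (σ : Iso G G) (v : G.V) : R :=
  if ∀ f, G.vtx f = v → σ.flag f = f then a (G.genus v) (G.valence v)
  else t (G.genus v) (G.valence v)

/-- The sum over all automorphisms of the product of the local contributions. -/
def autWeight (G : GenusOneGraph L) : R :=
  ∑ σ : Iso G G, ∏ v, localWeight a t G σ v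

/-- The weight of a graph: the average of the traces of its automorphisms. -/
def weight (G : GenusOneGraph L) : R :=
  ((Nat.card (Iso G G) : ℚ)⁻¹) • autWeight a t G

variable {a t}

theorem localWeight_conj {G H : GenusOneGraph L} (p : Iso G H) (σ : Iso G G) (v : G.V) :
    localWeight a t H (p.conj σ) (p.vert v) = localWeight a t G σ v := by
  have h : (∀ f, H.vtx f = p.vert v → (p.conj σ).flag f = f) ↔
      ∀ f, G.vtx f = v → σ.flag f = f := by
    rw [← p.flag.forall_congr_right]
    refine forall_congr' fun f => ?_
    rw [p.vtx_flag, p.vert.apply_eq_iff_eq]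
    simp [Iso.conj, Iso.trans, Iso.symm]
  rw [localWeight, localWeight, p.genus_vert, p.valence_vert]
  classical exact if_congr h rfl rfl

theorem autWeight_congr {G H : GenusOneGraph L} (p : Iso G H) :
    autWeight a t G = autWeight a t H := by
  refine Fintype.sum_equiv p.conj _ _ fun σ => ?_
  exact Fintype.prod_equiv p.vert _ _ fun v => (localWeight_conj p σ v).symm

theorem weight_congr {G H : GenusOneGraph L} (p : Iso G H) : weight a t G = weight a t H := by
  rw [weight, weight, autWeight_congr p, Nat.card_congr p.conj]

variable (a t) in
/-- The weight of an isomorphism class. -/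
def classWeight (q : Classes L) : R :=
  Quotient.lift (weight a t) (fun _ _ (h : Nonempty (Iso _ _)) => h.elim weight_congr) q

end Weight

/-! ### Relabelling the legs -/

section Reindex

variable {L' : Type} [Fintype L']

/-- Relabelling of the legs. -/
def reindex (e : L' ≃ L) (G : GenusOneGraph L) : GenusOneGraph L' :=
  { G with
    leg := fun l => G.leg (e l)
    leg_injective := G.leg_injective.comp e.injective
    inv_eq_self := fun f => (G.inv_eq_self f).trans
      (e.exists_congr_right (q := fun l => G.leg l = f)).symm
    genus_eq := by rw [Fintype.card_congr e]; exact G.genus_eq }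

/-- Isomorphisms are the same before and after relabelling. -/
def reindexIso (e : L' ≃ L) (G H : GenusOneGraph L) :
    Iso G H ≃ Iso (G.reindex e) (H.reindex e) where
  toFun p := ⟨p.vert, p.flag, p.vtx_flag, p.genus_vert, p.inv_flag, fun l => p.flag_leg (e l)⟩
  invFun p := ⟨p.vert, p.flag, p.vtx_flag, p.genus_vert, p.inv_flag, fun l => by
    have h := p.flag_leg (e.symm l)
    change p.flag (G.leg (e (e.symm l))) = H.leg (e (e.symm l)) at h
    rwa [e.apply_symm_apply] at h⟩
  left_inv _ := rfl
  right_inv _ := rfl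

/-- Relabelling of the legs, on isomorphism classes. -/
def reindexClasses (e : L' ≃ L) : Classes L ≃ Classes L' where
  toFun := Quotient.map (reindex e) fun G H h => h.map (reindexIso e G H)
  invFun := Quotient.map (reindex e.symm) fun G H h => h.map (reindexIso e.symm G H)
  left_inv q := Quotient.inductionOn q fun G => Quotient.sound
    ⟨⟨Equiv.refl _, Equiv.refl _, fun _ => rfl, fun _ => rfl, fun _ => rfl,
      fun l => congrArg G.leg (e.apply_symm_apply l)⟩⟩
  right_inv q := Quotient.inductionOn q fun G => Quotient.sound
    ⟨⟨Equiv.refl _, Equiv.refl _, fun _ => rfl, fun _ => rfl, fun _ => rfl,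
      fun l => congrArg G.leg (e.symm_apply_apply l)⟩⟩

theorem weight_reindex {R : Type*} [CommRing R] [Algebra ℚ R] {a t : ℕ → ℕ → R} (e : L' ≃ L)
    (G : GenusOneGraph L) : weight a t (G.reindex e) = weight a t G := by
  rw [weight, weight, Nat.card_congr (reindexIso e G G), autWeight, autWeight]
  congr 1
  exact (Fintype.sum_equiv (reindexIso e G G) _ _ fun σ => rfl).symm

theorem classWeight_reindex {R : Type*} [CommRing R] [Algebra ℚ R] {a t : ℕ → ℕ → R} (e : L' ≃ L)
    (q : Classes L) : classWeight a t (reindexClasses e q) = classWeight a t q :=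
  Quotient.inductionOn q fun G => weight_reindex e G

end Reindex

/-! ### Comparison with `StableGraph` -/

section Stable

variable {n : ℕ}

/-- The graph underlying a stable graph of genus one. -/
def ofStable (G : StableGraph 1 n) : GenusOneGraph (Fin n) where
  V := Fin G.numVert
  F := G.Flag
  fintypeV := inferInstance
  fintypeF := inferInstance
  vtx := Sigma.fst
  genus := G.genus
  inv := G.inv
  leg := G.leg
  inv_inv := G.inv_inv
  leg_injective := G.leg_injective
  inv_eq_self := G.inv_eq_self
  stable v := by
    rw [StableGraph.card_flag_eq G v]; exact G.stable v
  nonempty := ⟨⟨0, G.nonempty⟩⟩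
  connected S hS hc v := by
    obtain ⟨w, hw⟩ := hS
    have h := G.connected w v
    induction h with
    | refl => exact hw
    | tail _ h ih =>
      obtain ⟨f, rfl, rfl⟩ := h
      exact hc f ih
  genus_eq := by
    have h1 := G.sum_val
    have h2 := G.genus_eq
    have h3 : Fintype.card G.Flag = ∑ v, G.val v := by simp [Fintype.card_sigma]
    -- Evenness makes the truncated division by two in `StableGraph.genus_eq` exact.
    obtain ⟨m, hm⟩ := StableGraph.even_card_inv_ne G
    simp only [Fintype.card_fin]
    omega

theorem valence_ofStable (G : StableGraph 1 n) (v : Fin G.numVert) :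
    (ofStable G).valence v = G.val v :=
  StableGraph.card_flag_eq G v

/-- The isomorphism of the underlying graphs induced by an isomorphism of stable graphs. -/
def ofHom {G H : StableGraph 1 n} (p : G ⟶ H) : Iso (ofStable G) (ofStable H) where
  vert := StableGraph.Hom.vert p
  flag := Equiv.sigmaCongr (StableGraph.Hom.vert p) (StableGraph.Hom.flag p)
  vtx_flag _ := rfl
  genus_vert v := (StableGraph.Hom.genus_vert p v).symm
  inv_flag f := StableGraph.Hom.inv_flag p f
  flag_leg l := (StableGraph.Hom.leg_flag p l).symm

theorem ofHom_injective {G H : StableGraph 1 n} :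
    Function.Injective (ofHom : (G ⟶ H) → Iso (ofStable G) (ofStable H)) := by
  rintro ⟨v, f, _, _, _⟩ ⟨v', f', _, _, _⟩ h
  obtain rfl : v = v' := congrArg Iso.vert h
  have : f = f' := by
    funext w
    ext i : 1
    have h2 : (⟨v w, f w i⟩ : H.Flag) = ⟨v w, f' w i⟩ :=
      congrArg (fun q : Iso (ofStable G) (ofStable H) => q.flag (⟨w, i⟩ : G.Flag)) h
    exact eq_of_heq (Sigma.mk.inj h2).2
  subst this
  rfl

/-- Compatibility with `vtx` forces the bijection of flags to map fibres to fibres, so it restricts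
to the bijections at corresponding vertices that a morphism of stable graphs records. -/
theorem ofHom_surjective {G H : StableGraph 1 n} :
    Function.Surjective (ofHom : (G ⟶ H) → Iso (ofStable G) (ofStable H)) := by
  intro p
  have h : ∀ v, ∃ e : Fin (G.val v) ≃ Fin (H.val (p.vert v)),
      ∀ i, p.flag ⟨v, i⟩ = ⟨p.vert v, e i⟩ := fun v => by
    have h1 : ∀ i, ∃ j : Fin (H.val (p.vert v)), p.flag ⟨v, i⟩ = ⟨p.vert v, j⟩ := fun i => by
      have := p.vtx_flag ⟨v, i⟩
      generalize p.flag ⟨v, i⟩ = f at this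
      obtain ⟨w, j⟩ := f
      obtain rfl : w = p.vert v := this
      exact ⟨j, rfl⟩
    choose e he using h1
    refine ⟨Equiv.ofBijective e ⟨fun i j hij => ?_, fun j => ?_⟩, he⟩
    · have := (he i).trans ((congrArg _ hij).trans (he j).symm)
      exact eq_of_heq (Sigma.mk.inj (p.flag.injective this)).2
    · obtain ⟨⟨w, i⟩, hi⟩ := p.flag.surjective ⟨p.vert v, j⟩
      obtain rfl : w = v := by
        have := p.vtx_flag ⟨w, i⟩
        rw [hi] at this
        exact (p.vert.injective this).symm
      exact ⟨i, eq_of_heq (Sigma.mk.inj ((he i).symm.trans hi)).2⟩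
  choose e he using h
  refine ⟨⟨p.vert, e, fun v => (p.genus_vert v).symm, fun f => ?_, fun l => ?_⟩, ?_⟩
  · exact (congrArg H.inv (he _ _).symm).trans ((p.inv_flag f).trans (he _ _))
  · exact (p.flag_leg l).symm.trans (he _ _)
  · exact Iso.ext_apply (fun _ => rfl) fun f => (he f.1 f.2).symm

/-- Isomorphisms of stable graphs are isomorphisms of the underlying graphs. -/
def homEquivIso (G H : StableGraph 1 n) : (G ⟶ H) ≃ Iso (ofStable G) (ofStable H) :=
  Equiv.ofBijective ofHom ⟨ofHom_injective, ofHom_surjective⟩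

/-- Numbering the vertices, and then the flags in each fibre of `vtx`, brings any graph into the
standard form of `StableGraph`. -/
theorem exists_ofStable (G : GenusOneGraph (Fin n)) :
    ∃ H : StableGraph 1 n, Nonempty (Iso G (ofStable H)) := by
  let k := Fintype.card G.V
  let ev : G.V ≃ Fin k := Fintype.equivFin _
  let val : Fin k → ℕ := fun v => G.valence (ev.symm v)
  let es : (Σ v, Fin (val v)) ≃ G.F :=
    (Equiv.sigmaCongr ev.symm fun v => (Finite.equivFin _).symm).trans
      (Equiv.sigmaFiberEquiv G.vtx)
  have hes : ∀ f, G.vtx (es f) = ev.symm f.1 := fun f =>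
    ((Finite.equivFin {x // G.vtx x = ev.symm f.1}).symm f.2).2
  have hes' : ∀ f, (es.symm f).1 = ev (G.vtx f) := fun f => by
    have := hes (es.symm f)
    rw [es.apply_symm_apply] at this
    rw [this, ev.apply_symm_apply]
  have hinv : ∀ f, es.symm (G.inv (es f)) = f ↔ ∃ i, es.symm (G.leg i) = f := fun f => by
    simp only [Equiv.symm_apply_eq]; exact G.inv_eq_self _
  have hcard : Fintype.card {f // es.symm (G.inv (es f)) ≠ f} + n = Fintype.card G.F := by
    have h2 : Fintype.card {f // es.symm (G.inv (es f)) = f} = n := by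
      let e : Fin n ≃ {f // es.symm (G.inv (es f)) = f} := Equiv.ofBijective
        (fun i => ⟨es.symm (G.leg i), (hinv _).2 ⟨i, rfl⟩⟩)
        ⟨fun i j h => G.leg_injective (es.symm.injective (congrArg Subtype.val h)), fun ⟨f, hf⟩ =>
          ((hinv f).1 hf).imp fun i h => Subtype.ext h⟩
      simpa using (Fintype.card_congr e).symm
    have h3 : Fintype.card {f // es.symm (G.inv (es f)) = f} +
        Fintype.card {f // es.symm (G.inv (es f)) ≠ f} = Fintype.card G.F := by
      rw [← Fintype.card_sum, ← Fintype.card_congr es]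
      exact Fintype.card_congr (Equiv.sumCompl _)
    omega
  have hg : ∑ v, G.genus (ev.symm v) = ∑ v, G.genus v := Equiv.sum_comp ev.symm _
  have := G.genus_eq
  let H : StableGraph 1 n :=
    { numVert := k
      val := val
      genus := fun v => G.genus (ev.symm v)
      inv := fun f => es.symm (G.inv (es f))
      leg := fun i => es.symm (G.leg i)
      inv_inv := fun f => by simp [G.inv_inv]
      leg_injective := es.symm.injective.comp G.leg_injective
      inv_eq_self := hinv
      stable := fun v => G.stable _
      nonempty := Fintype.card_pos_iff.2 G.nonempty
      connected := fun v w => by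
        have := G.connected {x | Relation.ReflTransGen
          (fun v w => ∃ f : Σ v, Fin (val v), f.1 = v ∧ (es.symm (G.inv (es f))).1 = w) v (ev x)}
          ⟨ev.symm v, by simp [Relation.ReflTransGen.refl]⟩ (fun f hf => hf.tail
            ⟨es.symm f, hes' f, by rw [es.apply_symm_apply, hes']⟩) (ev.symm w)
        simpa using this
      genus_eq := by
        rw [hg]
        simp only [Fintype.card_fin] at this
        omega }
  exact ⟨H, ⟨⟨ev, es.symm, hes', fun v => congrArg G.genus (ev.symm_apply_apply v),
    fun f => congrArg (fun x => es.symm (G.inv x)) (es.apply_symm_apply f),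
    fun l => rfl⟩⟩⟩

theorem ofStable_surjective :
    Function.Surjective fun G : StableGraph 1 n => (⟦ofStable G⟧ : Classes (Fin n)) := fun q =>
  Quotient.inductionOn q fun G =>
    (exists_ofStable G).imp fun _ h => Quotient.sound (Setoid.symm h)

end Stable

instance finite_classes : Finite (Classes L) :=
  have : Finite (Classes (Fin (Fintype.card L))) := Finite.of_surjective _ ofStable_surjective
  Finite.of_equiv _ (reindexClasses (Fintype.equivFin L))

instance fintypeClasses : Fintype (Classes L) := Fintype.ofFinite _

/-! ### Grafting and pruning of end vertices -/

section Graft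

variable {L K : Type} [Fintype L] [Fintype K] [DecidableEq L]

/-- The set `B` of legs is the set of all legs at a vertex of genus zero which has exactly one more
flag, belonging to an edge. -/
def IsEnd (G : GenusOneGraph (L ⊕ K)) (B : Finset L) : Prop :=
  ∃ v r, G.genus v = 0 ∧ G.inv r ≠ r ∧
    ∀ f, G.vtx f = v ↔ f = r ∨ ∃ l ∈ B, G.leg (Sum.inl l) = f

theorem IsEnd.of_iso {G H : GenusOneGraph (L ⊕ K)} (p : Iso G H) {B : Finset L}
    (h : IsEnd G B) : IsEnd H B := by
  obtain ⟨v, r, h1, h2, h3⟩ := h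
  refine ⟨p.vert v, p.flag r, by rw [p.genus_vert, h1], ?_, ?_⟩
  · rw [p.inv_flag, Ne, p.flag.apply_eq_iff_eq]; exact h2
  · rw [← p.flag.forall_congr_right]
    intro f
    rw [p.vtx_flag, p.vert.apply_eq_iff_eq, h3, p.flag.apply_eq_iff_eq]
    simp only [← p.flag_leg, p.flag.apply_eq_iff_eq]

theorem isEnd_congr {G H : GenusOneGraph (L ⊕ K)} (p : Iso G H) (B : Finset L) :
    IsEnd G B ↔ IsEnd H B :=
  ⟨.of_iso p, .of_iso p.symm⟩

/-- A stable vertex of genus zero has at least three flags, and all but `r` are legs in `B`. -/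
theorem IsEnd.two_le_card {G : GenusOneGraph (L ⊕ K)} {B : Finset L} (h : IsEnd G B) :
    2 ≤ B.card := by
  obtain ⟨v, r, h1, h2, h3⟩ := h
  have hs := G.stable v
  have hle : Nat.card {f // G.vtx f = v} ≤ Nat.card (Option B) := by
    refine Nat.card_le_card_of_surjective (fun o : Option B => o.elim
      (⟨r, (h3 r).2 (Or.inl rfl)⟩ : {f // G.vtx f = v}) fun b =>
        ⟨G.leg (Sum.inl b.1), (h3 _).2 (Or.inr ⟨b.1, b.2, rfl⟩)⟩) ?_
    rintro ⟨f, hf⟩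
    rcases (h3 f).1 hf with rfl | ⟨l, hl, rfl⟩
    · exact ⟨none, rfl⟩
    · exact ⟨some ⟨l, hl⟩, rfl⟩
  simp at hle
  omega

open Classical in
/-- The graph obtained by attaching a new vertex of genus zero, with the set of legs `B`, at the leg
`none`. -/
def graft (B : Finset L) (hB : 2 ≤ B.card) (G : GenusOneGraph ({l // l ∉ B} ⊕ Option K)) :
    GenusOneGraph (L ⊕ K) where
  V := Option G.V
  F := G.F ⊕ Option B
  fintypeV := inferInstance
  fintypeF := inferInstance
  vtx := Sum.elim (fun f => some (G.vtx f)) fun _ => none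
  genus v := v.elim 0 G.genus
  inv := Sum.elim
    (fun f => if f = G.leg (Sum.inr none) then Sum.inr none else Sum.inl (G.inv f))
    fun o => o.elim (Sum.inl (G.leg (Sum.inr none))) fun b => Sum.inr (some b)
  leg := Sum.elim
    (fun l => if h : l ∈ B then Sum.inr (some ⟨l, h⟩) else Sum.inl (G.leg (Sum.inl ⟨l, h⟩)))
    fun k => Sum.inl (G.leg (Sum.inr (some k)))
  inv_inv := by
    rintro (f | _ | b)
    · by_cases h : f = G.leg (Sum.inr none)
      · simp [h]
      · have h' : G.inv f ≠ G.leg (Sum.inr none) := fun h2 => h (by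
          rw [← G.inv_inv f, h2, G.inv_leg])
        simp [h, h', G.inv_inv]
    · simp
    · simp
  leg_injective := by
    rintro (l | l) (m | m) h
    · by_cases hl : l ∈ B <;> by_cases hm : m ∈ B <;>
        simp [hl, hm, G.leg_injective.eq_iff] at h <;> rw [h]
    · by_cases hl : l ∈ B <;> simp [hl, G.leg_injective.eq_iff] at h
    · by_cases hm : m ∈ B <;> simp [hm, G.leg_injective.eq_iff] at h
    · simp [G.leg_injective.eq_iff] at h; rw [h]
  inv_eq_self := by
    rintro (f | _ | b)
    · constructor
      · by_cases h : f = G.leg (Sum.inr none)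
        · simp [h]
        · intro h2
          simp only [Sum.elim_inl, h, if_false, Sum.inl.injEq] at h2
          obtain ⟨(l | _ | k), rfl⟩ := (G.inv_eq_self f).1 h2
          · exact ⟨Sum.inl l.1, by simp [l.2]⟩
          · exact absurd rfl h
          · exact ⟨Sum.inr k, rfl⟩
      · rintro ⟨(l | k), h⟩
        · by_cases hl : l ∈ B <;> simp only [Sum.elim_inl, hl, dif_pos, dif_neg, reduceCtorEq,
            not_false_iff, Sum.inl.injEq] at h
          rw [← h]
          simp [G.leg_injective.eq_iff, G.inv_leg]
        · simp only [Sum.elim_inr, Sum.inl.injEq] at h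
          rw [← h]
          simp [G.leg_injective.eq_iff, G.inv_leg]
    · simp only [Sum.elim_inr, Option.elim_none, reduceCtorEq, false_iff]
      rintro ⟨(l | k), h⟩
      · by_cases hl : l ∈ B <;> simp [hl] at h
      · simp at h
    · simp only [Sum.elim_inr, Option.elim_some, true_iff]
      exact ⟨Sum.inl b.1, by simp⟩
  stable := by
    rintro (_ | v)
    · have e : Option B ≃ {f : G.F ⊕ Option B //
          Sum.elim (fun f => some (G.vtx f)) (fun _ => none) f = none} :=
        { toFun := fun o => ⟨Sum.inr o, rfl⟩
          invFun := fun f => match f with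
            | ⟨Sum.inr o, _⟩ => o
          left_inv := fun _ => rfl
          right_inv := fun f => match f with
            | ⟨Sum.inr o, _⟩ => rfl }
      rw [← Nat.card_congr e]
      simp; omega
    · have e : {f // G.vtx f = v} ≃ {f : G.F ⊕ Option B //
          Sum.elim (fun f => some (G.vtx f)) (fun _ => none) f = some v} :=
        { toFun := fun f => ⟨Sum.inl f.1, congrArg some f.2⟩
          invFun := fun f => match f with
            | ⟨Sum.inl f, h⟩ => ⟨f, Option.some_injective _ h⟩
          left_inv := fun _ => rfl
          right_inv := fun f => match f with
            | ⟨Sum.inl f, h⟩ => rfl }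
      rw [← Nat.card_congr e]
      exact G.stable v
  nonempty := ⟨none⟩
  connected S hS hc := by
    have key : ∀ v, some v ∈ S → ∀ w, w ∈ S := by
      intro v hv
      have h1 := G.connected {w | some w ∈ S} ⟨v, hv⟩ fun f hf => by
        by_cases h : f = G.leg (Sum.inr none)
        · rw [h, G.inv_leg, ← h]; exact hf
        · have := hc (Sum.inl f) hf
          simpa [h] using this
      rintro (_ | w)
      · have := hc (Sum.inl (G.leg (Sum.inr none))) (h1 _)
        simpa using this
      · exact h1 w
    obtain ⟨_ | v, hv⟩ := hS
    · exact key _ (hc (Sum.inr none) hv)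
    · exact key v hv
  genus_eq := by
    have h1 := G.genus_eq
    have h2 : Fintype.card {l // l ∉ B} = Fintype.card L - B.card := by simp
    have h3 : B.card ≤ Fintype.card L := Finset.card_le_univ B
    simp only [Fintype.card_sum, Fintype.card_option, h2, Fintype.card_coe,
      Fintype.sum_option, Option.elim_none, Option.elim_some] at h1 ⊢
    omega

variable {B : Finset L} {hB : 2 ≤ B.card} {G H : GenusOneGraph ({l // l ∉ B} ⊕ Option K)}

theorem graft_leg_mem (b : B) : (graft B hB G).leg (Sum.inl b.1) = Sum.inr (some b) := by
  simp [graft]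

theorem graft_leg_not_mem (l : {l // l ∉ B}) :
    (graft B hB G).leg (Sum.inl l.1) = Sum.inl (G.leg (Sum.inl l)) := by
  simp [graft, l.2]

theorem graft_leg_inr (k : K) :
    (graft B hB G).leg (Sum.inr k) = Sum.inl (G.leg (Sum.inr (some k))) := rfl

theorem graft_inv_inl {f : G.F} (h : f ≠ G.leg (Sum.inr none)) :
    (graft B hB G).inv (Sum.inl f) = Sum.inl (G.inv f) := by
  simp [graft, h]

theorem graft_inv_leg :
    (graft B hB G).inv (Sum.inl (G.leg (Sum.inr none))) = Sum.inr none := by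
  simp [graft]

theorem graft_valence_none : (graft B hB G).valence none = B.card + 1 := by
  have e : Option B ≃ {f : G.F ⊕ Option B // (graft B hB G).vtx f = none} :=
    { toFun := fun o => ⟨Sum.inr o, rfl⟩
      invFun := fun f => match f with
        | ⟨Sum.inr o, _⟩ => o
      left_inv := fun _ => rfl
      right_inv := fun f => match f with
        | ⟨Sum.inr o, _⟩ => rfl }
  exact (Nat.card_congr e).symm.trans (by simp)

theorem graft_valence_some (v : G.V) : (graft B hB G).valence (some v) = G.valence v :=
  (Nat.card_congr
    { toFun := fun f => ⟨Sum.inl f.1, congrArg some f.2⟩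
      invFun := fun f => match f with
        | ⟨Sum.inl f, h⟩ => ⟨f, Option.some_injective _ h⟩
      left_inv := fun _ => rfl
      right_inv := fun f => match f with
        | ⟨Sum.inl _, _⟩ => rfl }).symm

/-- Grafting is functorial. -/
def graftIso (p : Iso G H) : Iso (graft B hB G) (graft B hB H) where
  vert := Equiv.optionCongr p.vert
  flag := Equiv.sumCongr p.flag (Equiv.refl _)
  vtx_flag := by
    rintro (f | o)
    · exact congrArg some (p.vtx_flag f)
    · rfl
  genus_vert := by
    rintro (_ | v)
    · rfl
    · exact p.genus_vert v
  inv_flag := by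
    rintro (f | _ | b)
    · by_cases h : f = G.leg (Sum.inr none)
      · subst h
        have h1 : (graft B hB H).inv (Sum.inl (p.flag (G.leg (Sum.inr none)))) = Sum.inr none := by
          rw [p.flag_leg, graft_inv_leg]
        exact h1.trans (congrArg (Equiv.sumCongr p.flag (Equiv.refl _)) graft_inv_leg).symm
      · have h' : p.flag f ≠ H.leg (Sum.inr none) := by
          rw [← p.flag_leg, Ne, p.flag.apply_eq_iff_eq]; exact h
        exact (graft_inv_inl h').trans ((congrArg Sum.inl (p.inv_flag f)).trans
          (congrArg (Equiv.sumCongr p.flag (Equiv.refl _)) (graft_inv_inl h).symm))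
    · exact congrArg Sum.inl (p.flag_leg _).symm
    · rfl
  flag_leg := by
    rintro (l | k)
    · by_cases hl : l ∈ B
      · rw [graft_leg_mem ⟨l, hl⟩, graft_leg_mem ⟨l, hl⟩]; rfl
      · rw [graft_leg_not_mem ⟨l, hl⟩, graft_leg_not_mem ⟨l, hl⟩, ← p.flag_leg]; rfl
    · exact congrArg Sum.inl (p.flag_leg _)

theorem graftIso_injective :
    Function.Injective (graftIso : Iso G H → Iso (graft B hB G) (graft B hB H)) := fun _ _ h =>
  Iso.ext_apply
    (fun v => Option.some_injective _ (congrArg (fun r : Iso _ _ => r.vert (some v)) h))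
    fun f => Sum.inl_injective (congrArg (fun r : Iso _ _ => r.flag (Sum.inl f)) h)

theorem graft_flag_some (p : Iso (graft B hB G) (graft B hB H)) (b : B) :
    p.flag (Sum.inr (some b)) = Sum.inr (some b) := by
  rw [← graft_leg_mem b, p.flag_leg, graft_leg_mem]

/-- A leg in `B` is preserved because of its label, and it pins down the new vertex. The bound on
the size of `B` provides such a leg. -/
theorem graft_vert_none (p : Iso (graft B hB G) (graft B hB H)) : p.vert none = none := by
  obtain ⟨b, hb⟩ : B.Nonempty := Finset.card_pos.1 (by omega)
  have := p.vtx_flag (Sum.inr (some ⟨b, hb⟩))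
  rw [graft_flag_some] at this
  exact this.symm

theorem graft_flag_none (p : Iso (graft B hB G) (graft B hB H)) :
    p.flag (Sum.inr none) = Sum.inr none := by
  have h := p.vtx_flag (Sum.inr none)
  replace h : (graft B hB H).vtx (p.flag (Sum.inr none)) = none := h.trans (graft_vert_none p)
  rcases h2 : p.flag (Sum.inr none) with f | _ | b
  · rw [h2] at h; cases h
  · rfl
  · rw [← graft_flag_some p b] at h2
    cases p.flag.injective h2

/-- The new vertex and its flags are preserved, so the isomorphism restricts to the old graphs. The
old leg `none` is no longer a leg of the graft; it is recognised as the only old flag whose partner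
is the flag `Sum.inr none`. -/
theorem graftIso_surjective :
    Function.Surjective (graftIso : Iso G H → Iso (graft B hB G) (graft B hB H)) := by
  intro p
  have hv : ∀ v, ∃ w, p.vert (some v) = some w := fun v => by
    rcases h : p.vert (some v) with _ | w
    · cases p.vert.injective (h.trans (graft_vert_none p).symm)
    · exact ⟨w, rfl⟩
  have hf : ∀ f, ∃ f', p.flag (Sum.inl f) = Sum.inl f' := fun f => by
    rcases h : p.flag (Sum.inl f) with f' | _ | b
    · exact ⟨f', rfl⟩
    · cases p.flag.injective (h.trans (graft_flag_none p).symm)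
    · cases p.flag.injective (h.trans (graft_flag_some p b).symm)
  choose ev hev using hv
  choose ef hef using hf
  have bv : Function.Bijective ev := by
    refine ⟨fun v w h => ?_, fun w => ?_⟩
    · exact Option.some_injective _ (p.vert.injective (by rw [hev, hev, h]))
    · obtain ⟨_ | v, h⟩ := p.vert.surjective (some w)
      · rw [graft_vert_none] at h; cases h
      · exact ⟨v, Option.some_injective _ ((hev v).symm.trans h)⟩
  have bf : Function.Bijective ef := by
    refine ⟨fun v w h => ?_, fun w => ?_⟩
    · exact Sum.inl_injective (p.flag.injective (by rw [hef, hef, h]))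
    · obtain ⟨v | _ | b, h⟩ := p.flag.surjective (Sum.inl w)
      · exact ⟨v, Sum.inl_injective ((hef v).symm.trans h)⟩
      · rw [graft_flag_none] at h; cases h
      · rw [graft_flag_some] at h; cases h
  have hleg : ∀ l, ef (G.leg l) = H.leg l := by
    rintro (l | _ | k)
    · have := p.flag_leg (Sum.inl l.1)
      rw [graft_leg_not_mem, graft_leg_not_mem] at this
      exact Sum.inl_injective ((hef _).symm.trans this)
    · have h1 := p.inv_flag (Sum.inl (G.leg (Sum.inr none)))
      rw [graft_inv_leg, graft_flag_none, hef] at h1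
      by_contra h
      rw [graft_inv_inl h] at h1
      cases h1
    · have := p.flag_leg (Sum.inr k)
      rw [graft_leg_inr, graft_leg_inr] at this
      exact Sum.inl_injective ((hef _).symm.trans this)
  refine ⟨⟨Equiv.ofBijective ev bv, Equiv.ofBijective ef bf, fun f => ?_, fun v => ?_, fun f => ?_,
    hleg⟩, Iso.ext_apply ?_ ?_⟩
  · have := p.vtx_flag (Sum.inl f)
    rw [hef] at this
    exact Option.some_injective _ (this.trans (hev _))
  · have := p.genus_vert (some v)
    rw [hev] at this
    exact this
  · by_cases h : f = G.leg (Sum.inr none)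
    · subst h
      change H.inv (ef _) = ef (G.inv _)
      rw [G.inv_leg, hleg, H.inv_leg]
    · have h1 := p.inv_flag (Sum.inl f)
      have h2 : ef f ≠ H.leg (Sum.inr none) := by
        rw [← hleg]; exact fun h3 => h (bf.1 h3)
      rw [graft_inv_inl h, hef, hef, graft_inv_inl h2] at h1
      exact Sum.inl_injective h1
  · rintro (_ | v)
    · exact (graft_vert_none p).symm
    · exact (hev v).symm
  · rintro (f | _ | b)
    · exact (hef f).symm
    · exact (graft_flag_none p).symm
    · exact (graft_flag_some p b).symm

/-- Isomorphisms are the same before and after grafting. -/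
def graftIsoEquiv : Iso G H ≃ Iso (graft B hB G) (graft B hB H) :=
  Equiv.ofBijective graftIso ⟨graftIso_injective, graftIso_surjective⟩

/-- Grafting does not change the automorphism group, and every automorphism fixes all flags at the
new vertex. The factor of that vertex is therefore the same in all terms of the average. -/
theorem weight_graft {R : Type*} [CommRing R] [Algebra ℚ R] {a t : ℕ → ℕ → R} :
    weight a t (graft B hB G) = a 0 (B.card + 1) * weight a t G := by
  rw [weight, weight, ← Nat.card_congr (graftIsoEquiv (G := G) (H := G) (hB := hB)),
    mul_smul_comm]
  congr 1
  rw [autWeight, autWeight, Finset.mul_sum]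
  refine (Fintype.sum_equiv graftIsoEquiv _ _ fun σ => ?_).symm
  refine (congrArg₂ (· * ·) ?_ ?_).trans (Fintype.prod_option
    (fun v : Option G.V => localWeight a t (graft B hB G) (graftIsoEquiv σ) v)).symm
  · refine Eq.trans ?_ (if_pos ?_).symm
    · rw [graft_valence_none]; rfl
    · rintro (f | o) h
      · cases h
      · rfl
  · refine Finset.prod_congr rfl fun v _ => ?_
    have h : (∀ f, (graft B hB G).vtx f = some v → (graftIsoEquiv σ).flag f = f) ↔
        ∀ f, G.vtx f = v → σ.flag f = f := by
      constructor
      · exact fun h f hf => Sum.inl_injective (h (Sum.inl f) (congrArg some hf))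
      · rintro h (f | o) hf
        · exact congrArg Sum.inl (h f (Option.some_injective _ hf))
        · cases hf
    classical
    refine Eq.trans ?_ (if_congr h.symm rfl rfl)
    rw [graft_valence_some]
    rfl

theorem isEnd_graft : IsEnd (graft B hB G) B := by
  refine ⟨none, Sum.inr none, rfl, by simp [graft], ?_⟩
  rintro (f | _ | b)
  · refine iff_of_false (by simp [graft]) ?_
    rintro (h | ⟨l, hl, h⟩)
    · cases h
    · rw [graft_leg_mem ⟨l, hl⟩] at h; cases h
  · exact iff_of_true rfl (Or.inl rfl)
  · exact iff_of_true rfl (Or.inr ⟨b.1, b.2, graft_leg_mem b⟩)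

/-- The end is deleted together with its flags, and the other half `G.inv r` of its edge becomes the
leg `none`. -/
theorem exists_graft_of_isEnd {G : GenusOneGraph (L ⊕ K)} (h : IsEnd G B) :
    ∃ G' : GenusOneGraph ({l // l ∉ B} ⊕ Option K), Nonempty (Iso (graft B hB G') G) := by
  classical
  obtain ⟨v, r, hg, hr, hv⟩ := h
  have hvr : G.vtx r = v := (hv r).2 (Or.inl rfl)
  have hvB : ∀ l ∈ B, G.vtx (G.leg (Sum.inl l)) = v := fun l hl => (hv _).2 (Or.inr ⟨l, hl, rfl⟩)
  have hleg_ne : ∀ l, G.leg l ≠ r := fun l h => hr (h ▸ G.inv_leg l)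
  have hvB' : ∀ l ∉ B, G.vtx (G.leg (Sum.inl l)) ≠ v := fun l hl h => by
    rcases (hv _).1 h with h | ⟨m, hm, h⟩
    · exact hleg_ne _ h
    · rw [G.leg_injective.eq_iff, Sum.inl.injEq] at h
      exact hl (h ▸ hm)
  have hvK : ∀ k, G.vtx (G.leg (Sum.inr k)) ≠ v := fun l h => by
    rcases (hv _).1 h with h | ⟨m, hm, h⟩
    · exact hleg_ne _ h
    · rw [G.leg_injective.eq_iff] at h
      cases h
  -- The edge at the end is not a loop: besides `r` there are only legs at `v`.
  have hinvr : G.vtx (G.inv r) ≠ v := fun h => by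
    rcases (hv _).1 h with h | ⟨m, hm, h⟩
    · exact hr h
    · have := G.inv_leg (Sum.inl m)
      rw [h, G.inv_inv] at this
      exact hr this.symm
  have hother : ∀ f, G.vtx f ≠ v → G.vtx (G.inv f) = v → f = G.inv r := fun f h1 h2 => by
    rcases (hv _).1 h2 with h | ⟨m, hm, h⟩
    · rw [← h, G.inv_inv]
    · have := G.inv_leg (Sum.inl m)
      rw [h, G.inv_inv] at this
      exact absurd h2 (this ▸ h1)
  have eF : Fintype.card {f // G.vtx f ≠ v} + (B.card + 1) = Fintype.card G.F := by
    have h1 : Fintype.card {f // G.vtx f = v} = B.card + 1 := by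
      rw [← Fintype.card_coe, ← Fintype.card_option]
      refine (Fintype.card_congr (Equiv.ofBijective (fun o : Option B => o.elim
        (⟨r, hvr⟩ : {f // G.vtx f = v}) fun b =>
          ⟨G.leg (Sum.inl b.1), hvB b.1 b.2⟩) ⟨?_, ?_⟩)).symm
      · rintro (_ | b) (_ | c) h
        · rfl
        · exact absurd (congrArg Subtype.val h).symm (hleg_ne _)
        · exact absurd (congrArg Subtype.val h) (hleg_ne _)
        · have := G.leg_injective (congrArg Subtype.val h)
          rw [Sum.inl.injEq] at this
          rw [Subtype.ext this]
      · rintro ⟨f, hf⟩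
        rcases (hv f).1 hf with rfl | ⟨l, hl, rfl⟩
        · exact ⟨none, rfl⟩
        · exact ⟨some ⟨l, hl⟩, rfl⟩
    rw [← h1, add_comm, ← Fintype.card_sum]
    exact Fintype.card_congr (Equiv.sumCompl _)
  let leg' : {l // l ∉ B} ⊕ Option K → {f // G.vtx f ≠ v} := Sum.elim
    (fun l => ⟨G.leg (Sum.inl l.1), hvB' _ l.2⟩)
    (fun o => o.elim ⟨G.inv r, hinvr⟩ fun k => ⟨G.leg (Sum.inr k), hvK k⟩)
  -- The flag that loses its partner becomes a fixed point, hence a leg.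
  let inv' : {f // G.vtx f ≠ v} → {f // G.vtx f ≠ v} := fun f =>
    if h : G.vtx (G.inv f.1) = v then f else ⟨G.inv f.1, h⟩
  have hinv_inv : ∀ f, inv' (inv' f) = f := fun f => by
    by_cases h : G.vtx (G.inv f.1) = v
    · simp [inv', h]
    · simp [inv', h, G.inv_inv, f.2]
  have hleg_inj : Function.Injective leg' := by
    rintro (l | _ | l) (m | _ | m) h <;> replace h := congrArg Subtype.val h <;>
      simp only [leg', Sum.elim_inl, Sum.elim_inr, Option.elim_none, Option.elim_some] at h
    · rw [G.leg_injective.eq_iff, Sum.inl.injEq] at h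
      rw [Subtype.ext h]
    · have := G.inv_leg (Sum.inl l.1)
      rw [h, G.inv_inv] at this
      exact absurd this.symm hr
    · cases G.leg_injective h
    · have := G.inv_leg (Sum.inl m.1)
      rw [← h, G.inv_inv] at this
      exact absurd this.symm hr
    · rfl
    · have := G.inv_leg (Sum.inr m)
      rw [← h, G.inv_inv] at this
      exact absurd this.symm hr
    · cases G.leg_injective h
    · have := G.inv_leg (Sum.inr l)
      rw [h, G.inv_inv] at this
      exact absurd this.symm hr
    · rw [G.leg_injective.eq_iff, Sum.inr.injEq] at h
      rw [h]
  have hinv_leg : ∀ f, inv' f = f ↔ ∃ l, leg' l = f := fun f => by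
    by_cases h : G.vtx (G.inv f.1) = v
    · refine iff_of_true (by simp [inv', h]) ⟨Sum.inr none, Subtype.ext ?_⟩
      exact (hother f.1 f.2 h).symm
    · have h1 : inv' f = f ↔ G.inv f.1 = f.1 := by simp [inv', h, Subtype.ext_iff]
      rw [h1, G.inv_eq_self]
      constructor
      · rintro ⟨(l | k), hl⟩
        · have hlB : l ∉ B := fun hb => f.2 (hl ▸ hvB l hb)
          exact ⟨Sum.inl ⟨l, hlB⟩, Subtype.ext hl⟩
        · exact ⟨Sum.inr (some k), Subtype.ext hl⟩
      · rintro ⟨(l | _ | k), hl⟩ <;> replace hl := congrArg Subtype.val hl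
        · exact ⟨Sum.inl l.1, hl⟩
        · refine absurd ?_ h
          rw [← hl]
          change G.vtx (G.inv (G.inv r)) = v
          rw [G.inv_inv, hvr]
        · exact ⟨Sum.inr k, hl⟩
  have hV : Fintype.card {w // w ≠ v} + 1 = Fintype.card G.V := by
    have : 0 < Fintype.card G.V := Fintype.card_pos_iff.2 G.nonempty
    rw [Fintype.card_subtype_compl, Fintype.card_subtype_eq]; omega
  have hgen : ∑ w : {w // w ≠ v}, G.genus w = ∑ w, G.genus w := by
    rw [← (Equiv.optionSubtypeNe v).sum_comp, Fintype.sum_option]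
    simp [hg]
  let G' : GenusOneGraph ({l // l ∉ B} ⊕ Option K) :=
    { V := {w // w ≠ v}
      F := {f // G.vtx f ≠ v}
      fintypeV := inferInstance
      fintypeF := inferInstance
      vtx := fun f => ⟨G.vtx f.1, f.2⟩
      genus := fun w => G.genus w.1
      inv := inv'
      leg := leg'
      inv_inv := hinv_inv
      leg_injective := hleg_inj
      inv_eq_self := hinv_leg
      stable := fun w => by
        have h1 := G.stable w.1
        have e : {f // G.vtx f = w.1} ≃ {f : {f // G.vtx f ≠ v} //
            (⟨G.vtx f.1, f.2⟩ : {w // w ≠ v}) = w} :=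
          { toFun := fun f => ⟨⟨f.1, fun h => w.2 (f.2.symm.trans h)⟩, Subtype.ext f.2⟩
            invFun := fun f => ⟨f.1.1, congrArg Subtype.val f.2⟩
            left_inv := fun _ => rfl
            right_inv := fun _ => rfl }
        rw [← Nat.card_congr e]
        exact h1
      nonempty := ⟨⟨_, hinvr⟩⟩
      connected := fun S hS hc w => by
        obtain ⟨w0, hw0⟩ := hS
        let u : {w // w ≠ v} := ⟨G.vtx (G.inv r), hinvr⟩
        -- A closed set of the pruned graph becomes closed in `G` once `v` is adjoined exactly when
        -- its only neighbour `u` belongs to the set.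
        have h := G.connected {x | (∃ y ∈ S, y.1 = x) ∨ (x = v ∧ u ∈ S)} ⟨w0.1, Or.inl ⟨w0, hw0, rfl⟩⟩
          (fun f hf => by
            rcases hf with ⟨y, hy, hf⟩ | ⟨hf, hu⟩
            · have hfv : G.vtx f ≠ v := fun h => y.2 (hf.trans h)
              have hyf : (⟨G.vtx f, hfv⟩ : {w // w ≠ v}) ∈ S := by
                rwa [← show y = ⟨G.vtx f, hfv⟩ from Subtype.ext hf]
              by_cases h : G.vtx (G.inv f) = v
              · refine Or.inr ⟨h, ?_⟩
                have h2 := hother f hfv h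
                subst h2
                exact hyf
              · have h1 := hc ⟨f, hfv⟩ hyf
                have h2 : inv' ⟨f, hfv⟩ = ⟨G.inv f, h⟩ := by simp [inv', h]
                rw [h2] at h1
                exact Or.inl ⟨_, h1, rfl⟩
            · rcases (hv f).1 hf with rfl | ⟨l, hl, rfl⟩
              · exact Or.inl ⟨u, hu, rfl⟩
              · rw [G.inv_leg]
                exact Or.inr ⟨hf, hu⟩) w.1
        rcases h with ⟨y, hy, h⟩ | ⟨h, _⟩
        · rwa [← show y = w from Subtype.ext h]
        · exact absurd h w.2
      genus_eq := by
        have h1 := G.genus_eq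
        have h2 : Fintype.card {l // l ∉ B} = Fintype.card L - B.card := by simp
        have h3 : B.card ≤ Fintype.card L := Finset.card_le_univ B
        rw [hgen]
        simp only [Fintype.card_sum, Fintype.card_option, h2] at h1 ⊢
        omega }
  have bF : Function.Bijective (Sum.elim Subtype.val fun o => o.elim r fun b =>
      G.leg (Sum.inl b.1) : {f // G.vtx f ≠ v} ⊕ Option B → G.F) := by
    rw [Fintype.bijective_iff_surjective_and_card]
    refine ⟨fun f => ?_, ?_⟩
    · by_cases h : G.vtx f = v
      · rcases (hv f).1 h with rfl | ⟨l, hl, rfl⟩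
        · exact ⟨Sum.inr none, rfl⟩
        · exact ⟨Sum.inr (some ⟨l, hl⟩), rfl⟩
      · exact ⟨Sum.inl ⟨f, h⟩, rfl⟩
    · rw [Fintype.card_sum, Fintype.card_option, Fintype.card_coe, eF]
  refine ⟨G', ⟨⟨Equiv.optionSubtypeNe v, Equiv.ofBijective _ bF, ?_, ?_, ?_, ?_⟩⟩⟩
  · rintro (f | _ | b)
    · exact (Equiv.optionSubtypeNe_some v ⟨G.vtx f.1, f.2⟩).symm
    · exact hvr.trans (Equiv.optionSubtypeNe_none v).symm
    · exact (hvB b.1 b.2).trans (Equiv.optionSubtypeNe_none v).symm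
  · rintro (_ | w)
    · exact (congrArg G.genus (Equiv.optionSubtypeNe_none v)).trans hg
    · exact congrArg G.genus (Equiv.optionSubtypeNe_some v w)
  · rintro (f | _ | b)
    · by_cases h : f = G'.leg (Sum.inr none)
      · subst h
        refine Eq.trans ?_ (congrArg (Equiv.ofBijective _ bF) graft_inv_leg).symm
        exact G.inv_inv r
      · refine Eq.trans ?_ (congrArg (Equiv.ofBijective _ bF) (graft_inv_inl h)).symm
        have h1 : ¬ G.vtx (G.inv f.1) = v := fun h2 => h (Subtype.ext (hother f.1 f.2 h2))
        change G.inv f.1 = (inv' f).1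
        simp [inv', h1]
    · rfl
    · exact G.inv_leg _
  · rintro (l | k)
    · by_cases hl : l ∈ B
      · exact congrArg (Equiv.ofBijective _ bF)
          (graft_leg_mem (G := G') (hB := hB) ⟨l, hl⟩)
      · exact congrArg (Equiv.ofBijective _ bF)
          (graft_leg_not_mem (G := G') (hB := hB) ⟨l, hl⟩)
    · rfl

end Graft

/-! ### Counting graphs with marked ends. -/

section EndSum

variable {L K : Type} [Fintype L] [Fintype K] [DecidableEq L]

/-- A graph of genus one has a flag which is not a leg, or a vertex of positive genus. -/
theorem exists_vtx_inv_ne {L : Type} [Fintype L] (G : GenusOneGraph L) {v : G.V}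
    (hv : G.genus v = 0) : ∃ f, G.vtx f = v ∧ G.inv f ≠ f := by
  by_contra! h
  -- If `v` carried only legs, it would be the whole graph and every flag would be a leg; the total
  -- genus would then be zero.
  have h1 := G.connected {v} ⟨v, rfl⟩ fun f hf => by rw [h f hf]; exact hf
  have h2 : ∑ w, G.genus w = 0 := Finset.sum_eq_zero fun w _ => by rw [h1 w, hv]
  have h3 : Fintype.card G.V = 1 := Fintype.card_eq_one_iff.2 ⟨v, h1⟩
  have h4 : Fintype.card G.F ≤ Fintype.card L :=
    Fintype.card_le_of_surjective G.leg fun f => (G.inv_eq_self f).1 (h f (h1 _))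
  have h5 : Fintype.card L ≤ Fintype.card G.F :=
    Fintype.card_le_of_injective G.leg G.leg_injective
  have h6 := G.genus_eq
  omega

/-- This is why the labels are split as `L ⊕ K`: legs in `K` mark the places of pruned ends and may
not lie on an end. The vertex carrying the leg `none` is therefore not an end before grafting, and
it does not become one afterwards, so grafting adds the end `B` and keeps the others. -/
theorem isEnd_graft_iff {B B' : Finset L} {hB : 2 ≤ B.card}
    {G : GenusOneGraph ({l // l ∉ B} ⊕ Option K)} :
    IsEnd (graft B hB G) B' ↔ B' = B ∨
      ∃ D : Finset {l // l ∉ B}, IsEnd G D ∧ D.map (Function.Embedding.subtype _) = B' := by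
  constructor
  · rintro ⟨_ | v, r, h1, h2, h3⟩
    · left
      have hr : ∀ l, (graft B hB G).leg l ≠ r := fun l h => h2 (h ▸ inv_leg _ l)
      ext l
      constructor
      · intro hl
        by_contra hlB
        have h := (h3 _).2 (Or.inr ⟨l, hl, rfl⟩)
        rw [graft_leg_not_mem ⟨l, hlB⟩] at h
        cases h
      · intro hl
        have h : (graft B hB G).vtx ((graft B hB G).leg (Sum.inl l)) = none := by
          rw [graft_leg_mem ⟨l, hl⟩]; rfl
        rcases (h3 _).1 h with h | ⟨m, hm, h⟩
        · exact absurd h (hr _)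
        · rw [leg_injective _ |>.eq_iff, Sum.inl.injEq] at h
          exact h ▸ hm
    · right
      obtain ⟨r, rfl⟩ : ∃ f, r = Sum.inl f := by
        rcases r with f | o
        · exact ⟨f, rfl⟩
        · cases (h3 _).2 (Or.inl rfl)
      have hB' : ∀ l ∈ B', l ∉ B := fun l hl hlB => by
        have h := (h3 _).2 (Or.inr ⟨l, hl, rfl⟩)
        rw [graft_leg_mem ⟨l, hlB⟩] at h
        cases h
      have h4 : ∀ f, G.vtx f = v ↔ f = r ∨ ∃ l ∈ B'.subtype (· ∉ B), G.leg (Sum.inl l) = f := by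
        intro f
        have h5 := h3 (Sum.inl f)
        constructor
        · intro h
          rcases h5.1 (congrArg some h) with h | ⟨l, hl, h⟩
          · exact Or.inl (Sum.inl_injective h)
          · rw [graft_leg_not_mem ⟨l, hB' l hl⟩] at h
            exact Or.inr ⟨⟨l, hB' l hl⟩, by simpa using hl, Sum.inl_injective h⟩
        · rintro (h | ⟨l, hl, h⟩)
          · exact Option.some_injective _ (h5.2 (Or.inl (congrArg Sum.inl h)))
          · refine Option.some_injective _ (h5.2 (Or.inr ⟨l.1, by simpa using hl, ?_⟩))
            rw [graft_leg_not_mem l, h]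
      -- If the new edge were the only one at `v`, the vertex would carry nothing but legs in `G`,
      -- which is impossible in genus one.
      have hr : r ≠ G.leg (Sum.inr none) := by
        rintro rfl
        obtain ⟨f, hf, hf'⟩ := G.exists_vtx_inv_ne (v := v) h1
        rcases (h4 f).1 hf with rfl | ⟨l, -, rfl⟩ <;> exact hf' (G.inv_leg _)
      refine ⟨B'.subtype (· ∉ B), ⟨v, r, h1, fun h => h2 ?_, h4⟩, ?_⟩
      · rw [graft_inv_inl hr, h]
      · exact Finset.subtype_map_of_mem hB'
  · rintro (rfl | ⟨D, ⟨v, r, h1, h2, h3⟩, rfl⟩)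
    · exact isEnd_graft
    · have hr : r ≠ G.leg (Sum.inr none) := fun h => h2 (h ▸ G.inv_leg _)
      refine ⟨some v, Sum.inl r, h1, ?_, ?_⟩
      · rw [graft_inv_inl hr]
        exact fun h => h2 (Sum.inl_injective h)
      · rintro (f | o)
        · have h4 : (graft B hB G).vtx (Sum.inl f) = some v ↔ G.vtx f = v :=
            Option.some_injective _ |>.eq_iff
          rw [h4, h3]
          refine or_congr Sum.inl_injective.eq_iff.symm ?_
          constructor
          · rintro ⟨l, hl, rfl⟩
            exact ⟨l.1, Finset.mem_map_of_mem _ hl, graft_leg_not_mem l⟩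
          · rintro ⟨l, hl, h⟩
            obtain ⟨m, hm, rfl⟩ := Finset.mem_map.1 hl
            exact ⟨m, hm, Sum.inl_injective ((graft_leg_not_mem m).symm.trans h)⟩
        · refine iff_of_false (fun h => by cases h) ?_
          rintro (h | ⟨l, hl, h⟩)
          · cases h
          · obtain ⟨m, hm, rfl⟩ := Finset.mem_map.1 hl
            cases (graft_leg_not_mem m).symm.trans h

/-- The predicate `IsEnd` on isomorphism classes. -/
def ClassIsEnd (q : Classes (L ⊕ K)) (B : Finset L) : Prop :=
  Quotient.lift (fun G => IsEnd G B) (fun _ _ (h : Nonempty (Iso _ _)) =>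
    h.elim fun p => propext (isEnd_congr p B)) q

open Classical in
/-- The sets of legs at the end vertices. -/
def classEnds (q : Classes (L ⊕ K)) : Finset (Finset L) := {B | ClassIsEnd q B}

theorem mem_classEnds {q : Classes (L ⊕ K)} {B : Finset L} :
    B ∈ classEnds q ↔ ClassIsEnd q B := by simp [classEnds]

/-- Grafting on isomorphism classes. -/
def graftClasses (B : Finset L) (hB : 2 ≤ B.card) :
    Classes ({l // l ∉ B} ⊕ Option K) → Classes (L ⊕ K) :=
  Quotient.map (graft B hB) fun _ _ h => h.map graftIso

theorem graftClasses_injective (B : Finset L) (hB : 2 ≤ B.card) :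
    Function.Injective (graftClasses (K := K) B hB) := fun q q' =>
  Quotient.inductionOn₂ q q' fun _ _ h => Quotient.sound
    ((Quotient.exact h : Nonempty (Iso _ _)).map graftIsoEquiv.symm)

theorem exists_graftClasses {B : Finset L} (hB : 2 ≤ B.card) {q : Classes (L ⊕ K)}
    (h : ClassIsEnd q B) : ∃ q', graftClasses B hB q' = q := by
  induction q using Quotient.inductionOn with
  | h G => exact (exists_graft_of_isEnd h).elim fun G' h' => ⟨⟦G'⟧, Quotient.sound h'⟩

theorem classIsEnd_graftClasses {B : Finset L} (hB : 2 ≤ B.card)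
    (q : Classes ({l // l ∉ B} ⊕ Option K)) : ClassIsEnd (graftClasses B hB q) B :=
  Quotient.inductionOn q fun _ => isEnd_graft

theorem ClassIsEnd.two_le_card {q : Classes (L ⊕ K)} {B : Finset L} (h : ClassIsEnd q B) :
    2 ≤ B.card := by
  induction q using Quotient.inductionOn with
  | h G => exact IsEnd.two_le_card h

theorem card_classEnds_graftClasses {B : Finset L} (hB : 2 ≤ B.card)
    (q : Classes ({l // l ∉ B} ⊕ Option K)) :
    (classEnds (graftClasses B hB q)).card = (classEnds q).card + 1 := by
  have h : classEnds (graftClasses B hB q) = insert B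
      ((classEnds q).map (Finset.mapEmbedding (Function.Embedding.subtype _)).toEmbedding) := by
    ext B'
    rw [mem_classEnds, Finset.mem_insert, Finset.mem_map]
    simp only [mem_classEnds]
    induction q using Quotient.inductionOn with
    | h G => exact isEnd_graft_iff
  rw [h, Finset.card_insert_of_notMem, Finset.card_map]
  -- The old ends consist of legs outside `B`, and `B` is not empty.
  intro hm
  obtain ⟨D, -, hD⟩ := Finset.mem_map.1 hm
  obtain ⟨b, hb⟩ : B.Nonempty := Finset.card_pos.1 (by omega)
  have hb' := hb
  rw [← hD] at hb'
  obtain ⟨d, -, hd⟩ := Finset.mem_map.1 hb'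
  exact d.2 (by rw [← hd] at hb; exact hb)

variable {R : Type*} [CommRing R] [Algebra ℚ R] (a t : ℕ → ℕ → R)

theorem classWeight_graftClasses {B : Finset L} (hB : 2 ≤ B.card)
    (q : Classes ({l // l ∉ B} ⊕ Option K)) :
    classWeight a t (graftClasses B hB q) = a 0 (B.card + 1) * classWeight a t q :=
  Quotient.inductionOn q fun _ => weight_graft

variable (L K) in
/-- The sum of the weights of all graphs with `j` marked end vertices, in order. -/
def endSum (j : ℕ) : R :=
  ∑ q : Classes (L ⊕ K), (((classEnds q).card.descFactorial j : ℕ) : R) * classWeight a t q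

/-- The sum is arranged by the leg set `B` of the first marked end. Grafting at `none` is a
bijection onto the classes having `B` as an end, and one end fewer remains for the other `j` marks.
-/
theorem endSum_succ (j : ℕ) : endSum L K a t (j + 1) = ∑ B : Finset L,
    if 2 ≤ B.card then a 0 (B.card + 1) * endSum {l // l ∉ B} (Option K) a t j else 0 := by
  classical
  have h1 : ∀ q : Classes (L ⊕ K),
      (((classEnds q).card.descFactorial (j + 1) : ℕ) : R) * classWeight a t q =
      ∑ B : Finset L, if ClassIsEnd q B then
        ((((classEnds q).card - 1).descFactorial j : ℕ) : R) * classWeight a t q else 0 := by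
    intro q
    -- With `e` ends, the falling factorial of order `j + 1` is `e` times that of `e - 1` of order
    -- `j`, and the factor `e` counts the choices of `B`.
    rw [← Finset.sum_filter, Finset.sum_const, ← classEnds, nsmul_eq_mul, ← mul_assoc,
      ← Nat.cast_mul]
    rcases (classEnds q).card with _ | m
    · simp
    · rw [Nat.succ_descFactorial_succ]; rfl
  rw [endSum, Finset.sum_congr rfl fun q _ => h1 q, Finset.sum_comm]
  refine Finset.sum_congr rfl fun B _ => ?_
  split_ifs with hB
  · rw [endSum, Finset.mul_sum, ← Finset.sum_filter]
    symm
    refine Finset.sum_bij (fun q _ => graftClasses B hB q) ?_ ?_ ?_ ?_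
    · exact fun q _ => Finset.mem_filter.2 ⟨Finset.mem_univ _, classIsEnd_graftClasses hB q⟩
    · exact fun q _ q' _ h => graftClasses_injective B hB h
    · intro q hq
      obtain ⟨q', h⟩ := exists_graftClasses hB (Finset.mem_filter.1 hq).2
      exact ⟨q', Finset.mem_univ _, h⟩
    · intro q _
      rw [card_classEnds_graftClasses, classWeight_graftClasses, Nat.add_sub_cancel]
      ring
  · exact Finset.sum_eq_zero fun q _ => if_neg fun h => hB h.two_le_card

end EndSum

end GenusOneGraph

/-! ### Exponential generating functions, Taylor's formula, the logarithm. -/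

section ExponentialGeneratingFunction

open PowerSeries

variable {R : Type*} [CommRing R] [Algebra ℚ R]

/-- The exponential generating function of a sequence. -/
def egf (c : ℕ → R) : PowerSeries R := PowerSeries.mk fun n => (n ! : ℚ)⁻¹ • c n

theorem coeff_egf (c : ℕ → R) (n : ℕ) : coeff n (egf c) = (n ! : ℚ)⁻¹ • c n :=
  coeff_mk _ _

theorem derivative_egf (c : ℕ → R) : derivative R (egf c) = egf fun n => c (n + 1) := by
  ext n
  rw [coeff_derivative, coeff_egf, coeff_egf, Nat.factorial_succ]
  have h : ((n : R) + 1) = algebraMap ℚ R (n + 1) := by simp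
  rw [h, mul_comm, ← Algebra.smul_def, smul_smul]
  congr 1
  push_cast
  field_simp

theorem egf_mul (c d : ℕ → R) : egf c * egf d =
    egf fun n => ∑ m ∈ Finset.range (n + 1), (n.choose m : R) * (c m * d (n - m)) := by
  ext n
  rw [coeff_mul, Finset.Nat.sum_antidiagonal_eq_sum_range_succ_mk, coeff_egf, Finset.smul_sum]
  refine Finset.sum_congr rfl fun m hm => ?_
  have hm : m ≤ n := by simpa [Nat.lt_succ_iff] using hm
  have h : (n.choose m : R) = algebraMap ℚ R (n.choose m) := by simp
  rw [coeff_egf, coeff_egf, smul_mul_smul_comm, h, ← Algebra.smul_def, smul_smul]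
  congr 1
  rw [Nat.cast_choose ℚ hm]
  have := Nat.factorial_ne_zero n
  field_simp

theorem constantCoeff_egf (c : ℕ → R) : constantCoeff (egf c) = c 0 := by
  rw [← coeff_zero_eq_constantCoeff_apply, coeff_egf]; simp

theorem derivative_prod {ι : Type} [DecidableEq ι] (s : Finset ι) (f : ι → PowerSeries R) :
    derivative R (∏ i ∈ s, f i) = ∑ i ∈ s, (∏ j ∈ s.erase i, f j) * derivative R (f i) := by
  induction s using Finset.induction_on with
  | empty => simp
  | insert a s ha ih =>
    rw [Finset.prod_insert ha, Derivation.leibniz, ih, Finset.sum_insert ha,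
      Finset.erase_insert ha, smul_eq_mul, smul_eq_mul, add_comm, Finset.mul_sum]
    congr 1
    refine Finset.sum_congr rfl fun i hi => ?_
    have hia : a ≠ i := fun h => ha (h ▸ hi)
    rw [Finset.erase_insert_of_ne hia, Finset.prod_insert (fun h => ha (Finset.mem_of_mem_erase h)),
      mul_assoc]

/-- The product counts the ways to distribute `n` labels over the factors. Differentiating it
singles out the factor that receives one additional label, which gives the induction on `n`. -/
theorem coeff_prod_egf {ι : Type} [Fintype ι] [DecidableEq ι] (n : ℕ) (c : ι → ℕ → R) :
    coeff n (∏ i, egf (c i)) =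
      (n ! : ℚ)⁻¹ • ∑ f : Fin n → ι, ∏ i, c i (Nat.card {l // f l = i}) := by
  induction n generalizing c with
  | zero => simp [coeff_zero_eq_constantCoeff_apply, constantCoeff_egf]
  | succ n ih =>
    have h1 : derivative R (∏ i, egf (c i)) =
        ∑ i, ∏ j, egf (Function.update c i (fun n => c i (n + 1)) j) := by
      rw [derivative_prod]
      refine Finset.sum_congr rfl fun i _ => ?_
      rw [← Finset.mul_prod_erase _ _ (Finset.mem_univ i), derivative_egf, Function.update_self,
        mul_comm]
      congr 1
      refine Finset.prod_congr rfl fun j hj => ?_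
      rw [Function.update_of_ne (Finset.ne_of_mem_erase hj)]
    have h2 := congrArg (coeff n) h1
    rw [coeff_derivative, map_sum, Finset.sum_congr rfl fun i _ => ih _, ← Finset.smul_sum] at h2
    have h3 : ((n : R) + 1) = algebraMap ℚ R (n + 1) := by simp
    rw [h3, mul_comm, ← Algebra.smul_def] at h2
    have h4 : ((n : ℚ) + 1) ≠ 0 := by positivity
    have h5 := congrArg (fun x => ((n : ℚ) + 1)⁻¹ • x) h2
    simp only [smul_smul, inv_mul_cancel₀ h4, one_smul] at h5
    rw [h5, Nat.factorial_succ, ← Fintype.sum_prod_type']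
    congr 1
    · push_cast
      rw [mul_inv]
    -- The differentiated factor `i` is the destination of the label `0`, and `f` distributes the
    -- remaining labels.
    refine Fintype.sum_equiv (Fin.consEquiv fun _ => ι) _ _ fun x => ?_
    obtain ⟨i, f⟩ := x
    refine Finset.prod_congr rfl fun j _ => ?_
    have key : Nat.card {l // (Fin.cons i f : Fin (n + 1) → ι) l = j} =
        (if i = j then 1 else 0) + Nat.card {l // f l = j} := by
      rw [Nat.card_eq_fintype_card, Nat.card_eq_fintype_card, Fintype.card_subtype,
        Fintype.card_subtype, Finset.card_filter, Finset.card_filter, Fin.sum_univ_succ]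
      simp
    change _ = c j (Nat.card {l // (Fin.cons i f : Fin (n + 1) → ι) l = j})
    rw [key]
    by_cases h : j = i
    · subst h; simp [add_comm]
    · rw [Function.update_of_ne h, if_neg (Ne.symm h), zero_add]

theorem coeff_prod_egf' {ι L : Type} [Fintype ι] [DecidableEq ι] [Fintype L] [DecidableEq L]
    (c : ι → ℕ → R) :
    coeff (Fintype.card L) (∏ i, egf (c i)) =
      ((Fintype.card L) ! : ℚ)⁻¹ • ∑ f : L → ι, ∏ i, c i (Nat.card {l // f l = i}) := by
  rw [coeff_prod_egf]
  congr 1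
  refine (Fintype.sum_equiv ((Fintype.equivFin L).arrowCongr (Equiv.refl ι)) _ _ fun f => ?_).symm
  refine Finset.prod_congr rfl fun i _ => ?_
  rw [Nat.card_congr ((Fintype.equivFin L).subtypeEquiv fun l => ?_)]
  simp

theorem X_pow_dvd_derivative {f : PowerSeries R} {m : ℕ} (h : X ^ m ∣ f) :
    X ^ (m - 1) ∣ derivative R f := by
  rw [X_pow_dvd_iff] at h ⊢
  intro i hi
  rw [coeff_derivative, h (i + 1) (by omega), zero_mul]

theorem X_pow_dvd_iterate_derivative {f : PowerSeries R} {m : ℕ} (h : X ^ m ∣ f) (j : ℕ) :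
    X ^ (m - j) ∣ (derivative R)^[j] f := by
  induction j with
  | zero => exact h
  | succ j ih => rw [Function.iterate_succ_apply']; exact X_pow_dvd_derivative ih

theorem iterate_derivative_X_pow (d j : ℕ) : (derivative R)^[j] (X ^ d : PowerSeries R) =
    (d.descFactorial j : PowerSeries R) * X ^ (d - j) := by
  induction j with
  | zero => simp
  | succ j ih =>
    have h : derivative R (X ^ (d - j) : PowerSeries R) =
        ((d - j : ℕ) : PowerSeries R) * X ^ (d - j - 1) := by
      rw [Derivation.leibniz_pow]; simp
    rw [Function.iterate_succ_apply', ih, Derivation.leibniz, Derivation.map_natCast, h,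
      Nat.descFactorial_succ, Nat.sub_sub, smul_zero, add_zero, smul_eq_mul]
    push_cast
    ring

theorem coeff_eq_zero_of_X_pow_dvd {f : PowerSeries R} {n m : ℕ} (h : X ^ m ∣ f) (hn : n < m) :
    coeff n f = 0 := X_pow_dvd_iff.1 h n hn

/-- Taylor's formula. -/
theorem coeff_subst_X_sub {y : PowerSeries R} (hy : constantCoeff y = 0) (b : PowerSeries R)
    {n N : ℕ} (hN : n < N) : coeff n (b.subst (X - y)) =
      ∑ j ∈ Finset.range N, ((-1) ^ j * (j ! : ℚ)⁻¹) • coeff n (y ^ j * (derivative R)^[j] b) := by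
  have hs : HasSubst (X - y) := HasSubst.of_constantCoeff_zero' (by simp [hy])
  have hXy : X ∣ y := X_dvd_iff.2 hy
  let D : PowerSeries R →ₗ[R] PowerSeries R := (derivative R).toLinearMap
  let T : PowerSeries R →ₗ[R] R := ∑ j ∈ Finset.range N, ((-1) ^ j * (j ! : ℚ)⁻¹) •
    ((coeff n).comp ((LinearMap.mulLeft R (y ^ j)).comp (D ^ j)))
  have hT : ∀ b, T b = ∑ j ∈ Finset.range N, ((-1) ^ j * (j ! : ℚ)⁻¹) •
      coeff n (y ^ j * (derivative R)^[j] b) := fun b => by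
    simp only [T, LinearMap.sum_apply, LinearMap.smul_apply, LinearMap.comp_apply,
      LinearMap.mulLeft_apply, Module.End.pow_apply]
    rfl
  let S : PowerSeries R →ₗ[R] R := (coeff n).comp (substAlgHom hs).toLinearMap
  have hS : ∀ b, S b = coeff n (b.subst (X - y)) := fun b => by
    simp [S, coe_substAlgHom]
  rw [← hS, ← hT]
  -- Both sides are linear in `b`. On a monomial Taylor's formula is the binomial theorem, as the
  -- `j`-th derivative of `X ^ d` has coefficient `j!` times a binomial coefficient.
  have hmon : ∀ d < n + 1, S (X ^ d) = T (X ^ d) := by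
    intro d hd
    rw [hS, hT, subst_pow hs, subst_X hs, sub_eq_neg_add, add_pow, map_sum]
    refine Finset.sum_subset_zero_on_sdiff (Finset.range_mono (by omega)) ?_ ?_
    · intro j hj
      have h : d < j := by simp at hj; omega
      rw [iterate_derivative_X_pow, Nat.descFactorial_of_lt h]
      simp
    · intro j hj
      rw [iterate_derivative_X_pow, Nat.descFactorial_eq_factorial_mul_choose, neg_pow]
      have h1 : (-1 : PowerSeries R) ^ j * y ^ j * X ^ (d - j) * (d.choose j : PowerSeries R) =
        ((-1 : ℚ) ^ j) • (y ^ j * ((d.choose j : PowerSeries R) * X ^ (d - j))) := by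
        rw [Algebra.smul_def]; simp; ring
      have h2 : y ^ j * (((j ! * d.choose j : ℕ) : PowerSeries R) * X ^ (d - j)) =
        (j ! : ℚ) • (y ^ j * ((d.choose j : PowerSeries R) * X ^ (d - j))) := by
        rw [Algebra.smul_def]; simp; ring
      have h3 : (j ! : ℚ) ≠ 0 := by exact_mod_cast Nat.factorial_ne_zero j
      have h4 : ∀ (c : ℚ) (f : PowerSeries R), coeff n (c • f) = c • coeff n f := fun c f => rfl
      rw [h1, h2, h4, h4, smul_smul, mul_assoc, inv_mul_cancel₀ h3, mul_one]
  -- The tail of `b` is invisible in degree `n` on both sides: the factor `y ^ j` makes up for the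
  -- `j` orders of vanishing lost by differentiating `j` times.
  have hrem : ∀ r, S (X ^ (n + 1) * r) = T (X ^ (n + 1) * r) := by
    intro r
    rw [hS, hT, subst_mul hs, subst_pow hs, subst_X hs]
    rw [coeff_eq_zero_of_X_pow_dvd (m := n + 1) ((pow_dvd_pow_of_dvd (dvd_sub_self_left.2 hXy) _).mul_right _)
      (Nat.lt_succ_self n)]
    symm
    refine Finset.sum_eq_zero fun j _ => ?_
    have h := mul_dvd_mul (pow_dvd_pow_of_dvd hXy j)
      (X_pow_dvd_iterate_derivative (dvd_mul_right (X ^ (n + 1)) r) j)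
    rw [← pow_add] at h
    rw [coeff_eq_zero_of_X_pow_dvd h (by omega), smul_zero]
  have hb := eq_X_pow_mul_shift_add_trunc (n + 1) b
  rw [hb, map_add, map_add, hrem]
  congr 1
  have htr : ((trunc (n + 1) b : Polynomial R) : PowerSeries R) =
      ∑ d ∈ Finset.range (n + 1), coeff d b • (X ^ d : PowerSeries R) := by
    ext m
    rw [Polynomial.coeff_coe, coeff_trunc, map_sum]
    simp [coeff_X_pow]
  rw [htr, map_sum, map_sum]
  refine Finset.sum_congr rfl fun d hd => ?_
  rw [map_smul, map_smul, hmon d (Finset.mem_range.1 hd)]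

/-- As `X` divides `y`, the powers of `y` beyond the `n`-th do not reach degree `n`, and the
logarithmic series becomes a finite sum. -/
theorem coeff_logOf_one_sub {y : PowerSeries R} (hy : constantCoeff y = 0) (n : ℕ) :
    coeff n (logOf (1 - y)) = -∑ k ∈ Finset.Icc 1 n, (k : ℚ)⁻¹ • coeff n (y ^ k) := by
  have hs : HasSubst (1 - y - 1) := HasSubst.of_constantCoeff_zero' (by simp [hy])
  have hXy : X ∣ y := X_dvd_iff.2 hy
  rw [logOf_eq, coeff_subst' hs, finsum_eq_sum_of_support_subset (s := Finset.Icc 1 n),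
    ← Finset.sum_neg_distrib]
  · refine Finset.sum_congr rfl fun k hk => ?_
    have hk : k ≠ 0 := by have := Finset.mem_Icc.1 hk; omega
    have h0 : (1 - y - 1) ^ k = ((-1 : ℚ) ^ k) • y ^ k := by
      rw [show 1 - y - 1 = -y by ring, neg_pow, Algebra.smul_def]; simp
    have h4 : ∀ (c : ℚ) (f : PowerSeries R), coeff n (c • f) = c • coeff n f := fun c f => rfl
    rw [coeff_log, if_neg hk, h0, h4, smul_eq_mul, ← Algebra.smul_def, smul_smul, ← neg_smul]
    congr 1
    rw [div_mul_eq_mul_div, ← pow_add, show k + 1 + k = 2 * k + 1 by ring, pow_succ, pow_mul]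
    simp [div_eq_mul_inv]
  · intro k hk
    rw [Function.mem_support] at hk
    rw [Finset.mem_coe, Finset.mem_Icc]
    constructor
    · by_contra h
      obtain rfl : k = 0 := by omega
      exact hk (by simp)
    · by_contra h
      refine hk ?_
      have h1 : X ^ k ∣ (1 - y - 1) ^ k := pow_dvd_pow_of_dvd (by simpa using hXy) k
      rw [coeff_eq_zero_of_X_pow_dvd h1 (by omega), smul_zero]

end ExponentialGeneratingFunction

namespace GenusOneGraph

/-! ### Inclusion-exclusion over ends as a substitution of power series. -/

section Exponential

open PowerSeries

variable {R : Type*} [CommRing R] [Algebra ℚ R] (a t : ℕ → ℕ → R)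

/-- The total weight of the graphs with `n` legs. -/
def totalWeight (n : ℕ) : R := ∑ q : Classes (Fin n), classWeight a t q

/-- The weight of an end vertex with `m` legs. -/
def endWeight (m : ℕ) : R := if 2 ≤ m then a 0 (m + 1) else 0

/-- The numbers `endSum` in terms of the cardinalities of the sets of legs. -/
def endSumCard : ℕ → ℕ → ℕ → R
  | 0, n, k => totalWeight a t (n + k)
  | j + 1, n, k => ∑ m ∈ Finset.range (n + 1),
      (n.choose m : R) * (endWeight a m * endSumCard j (n - m) (k + 1))

/-- Weights do not depend on the names of the legs, so the sum over `B` depends only on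
cardinalities and turns into a sum with binomial coefficients. -/
theorem endSum_eq_endSumCard (j : ℕ) : ∀ (L K : Type) [Fintype L] [Fintype K] [DecidableEq L],
    endSum L K a t j = endSumCard a t j (Fintype.card L) (Fintype.card K) := by
  induction j with
  | zero =>
    intro L K _ _ _
    simp only [endSum, endSumCard, totalWeight, Nat.descFactorial_zero, Nat.cast_one, one_mul]
    have e : Fin (Fintype.card L + Fintype.card K) ≃ L ⊕ K :=
      finSumFinEquiv.symm.trans
        (Equiv.sumCongr (Fintype.equivFin L).symm (Fintype.equivFin K).symm)
    exact Fintype.sum_equiv (reindexClasses e) _ _ fun q => (classWeight_reindex e q).symm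
  | succ j ih =>
    intro L K _ _ _
    rw [endSum_succ, endSumCard, ← Finset.powerset_univ]
    have h : ∀ B ∈ (Finset.univ : Finset L).powerset, (if 2 ≤ B.card then
        a 0 (B.card + 1) * endSum {l // l ∉ B} (Option K) a t j else 0) =
        endWeight a B.card * endSumCard a t j (Fintype.card L - B.card) (Fintype.card K + 1) := by
      intro B _
      rw [ih, endWeight, Fintype.card_option]
      have : Fintype.card {l // l ∉ B} = Fintype.card L - B.card := by simp
      rw [this]
      split_ifs
      · rfl
      · rw [zero_mul]
    rw [Finset.sum_congr rfl h, Finset.sum_powerset_apply_card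
      (fun m => endWeight a m * endSumCard a t j (Fintype.card L - m) (Fintype.card K + 1)),
      Finset.card_univ]
    simp only [nsmul_eq_mul]

/-- Every leg in `K` shifts the sequence, which is a derivative. Every pruned end is a binomial
convolution with `endWeight`, which is a factor, and it also leaves one more leg in `K`. -/
theorem egf_endSumCard (j k : ℕ) : egf (fun n => endSumCard a t j n k) =
    egf (endWeight a) ^ j * (derivative R)^[j + k] (egf (totalWeight a t)) := by
  induction j generalizing k with
  | zero =>
    rw [pow_zero, one_mul, zero_add]
    induction k with
    | zero => rfl
    | succ k ih =>
      rw [Function.iterate_succ_apply', ← ih, derivative_egf]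
      congr 1
      funext n
      simp only [endSumCard]
      congr 1
      omega
  | succ j ih =>
    rw [pow_succ', mul_assoc, show j + 1 + k = j + (k + 1) by ring, ← ih, egf_mul]
    rfl

/-- Dividing the falling factorial by `j!` gives a binomial coefficient, so this is the alternating
sum over a row of Pascal's triangle. -/
theorem sum_alternating_descFactorial {e N : ℕ} (h : e < N) :
    ∑ j ∈ Finset.range N, ((-1) ^ j * (j ! : ℚ)⁻¹) * (e.descFactorial j : ℚ) =
      if e = 0 then 1 else 0 := by
  have h1 := Int.alternating_sum_range_choose (n := e)
  have h2 : ∑ j ∈ Finset.range (e + 1), (-1 : ℚ) ^ j * (e.choose j : ℚ) =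
      if e = 0 then 1 else 0 := by exact_mod_cast congrArg (Int.cast : ℤ → ℚ) h1
  rw [← h2]
  symm
  refine Finset.sum_subset_zero_on_sdiff (Finset.range_mono (by omega)) ?_ ?_
  · intro j hj
    have h : e < j := by simp at hj; omega
    rw [Nat.descFactorial_of_lt h]; simp
  · intro j _
    rw [Nat.descFactorial_eq_factorial_mul_choose]
    have : (j ! : ℚ) ≠ 0 := by exact_mod_cast Nat.factorial_ne_zero j
    push_cast
    field_simp

/-- Inclusion-exclusion over the end vertices. -/
theorem coeff_subst_totalWeight (n : ℕ) :
    coeff n ((egf (totalWeight a t)).subst (X - egf (endWeight a))) =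
      (n ! : ℚ)⁻¹ • ∑ q : Classes (Fin n ⊕ Fin 0),
        if classEnds q = ∅ then classWeight a t q else 0 := by
  -- The truncation has to exceed both the degree `n`, for Taylor's formula, and the number of ends
  -- of any graph, for the alternating sum.
  let N := n + Fintype.card (Finset (Fin n)) + 1
  rw [coeff_subst_X_sub (N := N) (by rw [constantCoeff_egf]; simp [endWeight]) _ (by omega)]
  have h : ∀ j, coeff n (egf (endWeight a) ^ j * (derivative R)^[j] (egf (totalWeight a t))) =
      (n ! : ℚ)⁻¹ • endSum (Fin n) (Fin 0) a t j := fun j => by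
    have := egf_endSumCard a t j 0
    rw [add_zero] at this
    rw [← this, coeff_egf, endSum_eq_endSumCard]
    simp
  simp only [h, endSum]
  simp only [smul_smul, Finset.smul_sum]
  rw [Finset.sum_comm]
  refine Finset.sum_congr rfl fun q _ => ?_
  have h1 := sum_alternating_descFactorial (e := (classEnds q).card) (N := N)
    (by have := Finset.card_le_univ (classEnds q); omega)
  have h2 : ∀ j, (((-1) ^ j * (j ! : ℚ)⁻¹) * (n ! : ℚ)⁻¹) •
      (((classEnds q).card.descFactorial j : R) * classWeight a t q) =
      ((-1) ^ j * (j ! : ℚ)⁻¹ * ((classEnds q).card.descFactorial j : ℚ)) •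
        ((n ! : ℚ)⁻¹ • classWeight a t q) := fun j => by
    rw [show ((classEnds q).card.descFactorial j : R) =
      algebraMap ℚ R ((classEnds q).card.descFactorial j) by simp, ← Algebra.smul_def,
      smul_smul, smul_smul]
    congr 1
    ring
  rw [Finset.sum_congr rfl fun j _ => h2 j, ← Finset.sum_smul, h1]
  by_cases h3 : classEnds q = ∅
  · simp [h3]
  · simp [h3]

end Exponential

/-! ### Cycles -/

section Cycle

variable {L : Type} [Fintype L]

theorem card_cycle_fiber {k : ℕ} [NeZero k] (f : L → ZMod k) (v : ZMod k) :
    Nat.card {x : (ZMod k × Bool) ⊕ L // Sum.elim Prod.fst f x = v} =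
      Nat.card {l // f l = v} + 2 := by
  have e : {l // f l = v} ⊕ Bool ≃ {x : (ZMod k × Bool) ⊕ L // Sum.elim Prod.fst f x = v} :=
    { toFun := Sum.elim (fun l => ⟨Sum.inr l.1, l.2⟩) fun b => ⟨Sum.inl (v, b), rfl⟩
      invFun := fun x => match x with
        | ⟨Sum.inl x, _⟩ => Sum.inr x.2
        | ⟨Sum.inr l, h⟩ => Sum.inl ⟨l, h⟩
      left_inv := by rintro (l | b) <;> rfl
      right_inv := by
        rintro ⟨⟨i, b⟩ | l, h⟩
        · obtain rfl : i = v := h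
          rfl
        · rfl }
  rw [← Nat.card_congr e]
  simp

/-- The cyclic graph with `k` vertices of genus zero and with the leg `l` at the vertex `f l`. -/
def cycle (k : ℕ) [NeZero k] (f : L → ZMod k) (hf : Function.Surjective f) :
    GenusOneGraph L where
  V := ZMod k
  F := (ZMod k × Bool) ⊕ L
  fintypeV := ZMod.fintype k
  fintypeF := inferInstance
  vtx := Sum.elim Prod.fst f
  genus _ := 0
  -- The flag `(i, true)` is joined to `(i + 1, false)`. This covers the degenerate cycles: a loop
  -- for `k = 1` and a double edge for `k = 2`.
  inv := Sum.elim (fun x => Sum.inl (bif x.2 then (x.1 + 1, false) else (x.1 - 1, true))) Sum.inr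
  leg := Sum.inr
  inv_inv := by rintro (⟨i, _ | _⟩ | l) <;> simp
  leg_injective := Sum.inr_injective
  inv_eq_self := by rintro (⟨i, _ | _⟩ | l) <;> simp
  stable v := by
    rw [card_cycle_fiber]
    have : Nonempty {l // f l = v} := (hf v).elim fun l hl => ⟨⟨l, hl⟩⟩
    have : 0 < Nat.card {l // f l = v} := Nat.card_pos
    omega
  nonempty := ⟨0⟩
  connected S hS hc v := by
    obtain ⟨w, hw⟩ := hS
    have h : ∀ n : ℕ, w + n ∈ S := fun n => by
      induction n with
      | zero => simpa using hw
      | succ n ih =>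
        have := hc (Sum.inl (w + n, true)) ih
        simpa [add_assoc] using this
    obtain ⟨n, hn⟩ := ZMod.natCast_zmod_surjective (v - w)
    have := h n
    rwa [hn, add_sub_cancel] at this
  genus_eq := by simp [ZMod.card, mul_comm]

/-- All vertices have genus zero, and exactly two of the flags at each one belong to edges. -/
def IsCycle (G : GenusOneGraph L) : Prop :=
  (∀ v, G.genus v = 0) ∧ ∀ v, Nat.card {f // G.vtx f = v ∧ G.inv f ≠ f} = 2

theorem isCycle_cycle (k : ℕ) [NeZero k] (f : L → ZMod k) (hf : Function.Surjective f) :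
    IsCycle (cycle k f hf) := by
  refine ⟨fun _ => rfl, fun v => ?_⟩
  have e : Bool ≃ {x // (cycle k f hf).vtx x = v ∧ (cycle k f hf).inv x ≠ x} :=
    { toFun := fun b => ⟨Sum.inl (v, b), rfl, fun h => by
        have h' := congrArg Prod.snd (Sum.inl_injective h)
        cases b <;> cases h'⟩
      invFun := fun x => match x with
        | ⟨Sum.inl x, _⟩ => x.2
        | ⟨Sum.inr l, h⟩ => absurd rfl h.2
      left_inv := fun _ => rfl
      right_inv := by
        rintro ⟨⟨i, b⟩ | l, h⟩
        · obtain rfl : i = v := h.1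
          rfl
        · exact absurd rfl h.2 }
  rw [← Nat.card_congr e]
  simp

theorem Iso.isCycle {G H : GenusOneGraph L} (p : Iso G H) (h : IsCycle G) : IsCycle H := by
  refine ⟨fun v => ?_, fun v => ?_⟩
  · rw [← p.symm.genus_vert, h.1]
  · rw [← h.2 (p.symm.vert v)]
    refine Nat.card_congr (p.symm.flag.subtypeEquiv fun f => ?_)
    rw [p.symm.vtx_flag, p.symm.inv_flag, p.symm.vert.apply_eq_iff_eq,
      Ne, Ne, p.symm.flag.apply_eq_iff_eq]

theorem card_edgeFlag (G : GenusOneGraph L) :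
    Nat.card {f // G.inv f ≠ f} + Fintype.card L = Fintype.card G.F := by
  classical
  have h : Nat.card {f // G.inv f = f} = Fintype.card L := by
    rw [← Nat.card_eq_fintype_card]
    exact (Nat.card_congr (Equiv.ofBijective
      (fun l => (⟨G.leg l, G.inv_leg l⟩ : {f // G.inv f = f}))
      ⟨fun _ _ h => G.leg_injective (congrArg Subtype.val h), fun ⟨f, hf⟩ =>
        ((G.inv_eq_self f).1 hf).imp fun i h => Subtype.ext h⟩)).symm
  rw [← h, ← Nat.card_eq_fintype_card, add_comm, ← Nat.card_sum]
  exact Nat.card_congr (Equiv.sumCompl _)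

theorem sum_card_edgeFlag (G : GenusOneGraph L) :
    ∑ v, Nat.card {f // G.vtx f = v ∧ G.inv f ≠ f} = Nat.card {f // G.inv f ≠ f} := by
  rw [← Nat.card_congr (Equiv.sigmaFiberEquiv fun f : {f // G.inv f ≠ f} => G.vtx f.1),
    Nat.card_sigma]
  refine Finset.sum_congr rfl fun v _ => Nat.card_congr ?_
  exact (Equiv.subtypeEquivRight fun f => and_comm).trans
    (Equiv.subtypeSubtypeEquivSubtypeInter (fun f => G.inv f ≠ f) (fun f => G.vtx f = v)).symm

/-- There are exactly two edge flags at each vertex, so passing to the other one is an involution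
without fixed points. -/
theorem IsCycle.exists_swap {G : GenusOneGraph L} (h : IsCycle G) :
    ∃ sw : {f // G.inv f ≠ f} → {f // G.inv f ≠ f}, (∀ e, sw (sw e) = e) ∧ (∀ e, sw e ≠ e) ∧
      (∀ e, G.vtx (sw e).1 = G.vtx e.1) ∧
      ∀ e e', G.vtx e'.1 = G.vtx e.1 → e' = e ∨ e' = sw e := by
  have h1 : ∀ e : {f // G.inv f ≠ f}, ∃ e' : {f // G.inv f ≠ f}, e' ≠ e ∧
      G.vtx e'.1 = G.vtx e.1 ∧ ∀ e'' : {f // G.inv f ≠ f}, G.vtx e''.1 = G.vtx e.1 →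
        e'' = e ∨ e'' = e' := by
    intro e
    obtain ⟨⟨x, hx, hx'⟩, ⟨y, hy, hy'⟩, hxy, hu⟩ := Nat.card_eq_two_iff.1 (h.2 (G.vtx e.1))
    have hu' : ∀ e'' : {f // G.inv f ≠ f}, G.vtx e''.1 = G.vtx e.1 →
        e'' = ⟨x, hx'⟩ ∨ e'' = ⟨y, hy'⟩ := fun e'' h'' => by
      have := (Set.ext_iff.1 hu ⟨e''.1, h'', e''.2⟩).2 trivial
      simpa [Subtype.ext_iff] using this
    have hxy' : x ≠ y := fun h => hxy (Subtype.ext h)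
    rcases hu' e rfl with he | he
    · refine ⟨⟨y, hy'⟩, fun h => hxy' ?_, hy, fun e'' h'' => ?_⟩
      · exact congrArg Subtype.val (he.symm.trans h.symm)
      · exact (hu' e'' h'').imp_left fun h => h.trans he.symm
    · refine ⟨⟨x, hx'⟩, fun h => hxy' ?_, hx, fun e'' h'' => ?_⟩
      · exact congrArg Subtype.val (h.trans he)
      · exact (hu' e'' h'').symm.imp_left fun h => h.trans he.symm
  choose sw hne hv hu using h1
  refine ⟨sw, fun e => ?_, hne, hv, hu⟩
  rcases hu e (sw (sw e)) ((hv _).trans (hv _)) with h | h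
  · exact h
  · exact absurd h (hne _)

/-- Crossing an edge and then a vertex is the map `s = sw ∘ inv`. The two involutions generate a
dihedral action in which no reflection has a fixed point, so the orbit of `e` under `s` is one
direction of travel and meets every vertex exactly once. -/
theorem exists_cycle_flags {G : GenusOneGraph L} {sw : {f // G.inv f ≠ f} → {f // G.inv f ≠ f}}
    (h1 : ∀ e, sw (sw e) = e) (h2 : ∀ e, sw e ≠ e)
    (h3 : ∀ e, G.vtx (sw e).1 = G.vtx e.1)
    (h4 : ∀ e e', G.vtx e'.1 = G.vtx e.1 → e' = e ∨ e' = sw e) (e : {f // G.inv f ≠ f}) :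
    ∃ c : ZMod (Fintype.card G.V) → {f // G.inv f ≠ f}, c 0 = e ∧
      (∀ i, G.inv (c i).1 = (sw (c (i + 1))).1) ∧ Function.Bijective fun i => G.vtx (c i).1 := by
  classical
  let swP : Equiv.Perm {f // G.inv f ≠ f} := ⟨sw, sw, h1, h1⟩
  have hinv : ∀ e : {f // G.inv f ≠ f}, G.inv (G.inv e.1) ≠ G.inv e.1 := fun e h =>
    e.2 (G.inv_injective h)
  let inv' : {f // G.inv f ≠ f} → {f // G.inv f ≠ f} := fun e => ⟨G.inv e.1, hinv e⟩
  have hii : ∀ e, inv' (inv' e) = e := fun e => Subtype.ext (G.inv_inv _)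
  let invP : Equiv.Perm {f // G.inv f ≠ f} := ⟨inv', inv', hii, hii⟩
  have hs2 : swP * swP = 1 := Equiv.ext h1
  have hi2 : invP * invP = 1 := Equiv.ext hii
  let s := swP * invP
  have hsi : s⁻¹ = invP * swP := by
    rw [mul_inv_rev, inv_eq_of_mul_eq_one_left hs2, inv_eq_of_mul_eq_one_left hi2]
  have hconj : swP * s * swP⁻¹ = s⁻¹ := by
    rw [hsi, inv_eq_of_mul_eq_one_left hs2, ← mul_assoc, hs2, one_mul]
  have hz : ∀ m : ℤ, swP * s ^ m = s ^ (-m) * swP := fun m => by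
    have : (swP * s * swP⁻¹) ^ m = swP * s ^ m * swP⁻¹ := conj_zpow
    rw [hconj, inv_zpow'] at this
    exact mul_inv_eq_iff_eq_mul.1 this.symm
  have hz' : ∀ (m : ℤ) (e), swP ((s ^ m) e) = (s ^ (-m)) (swP e) := fun m e =>
    congrArg (fun p : Equiv.Perm _ => p e) (hz m)
  have hadd : ∀ (m n : ℤ) (e), (s ^ m) ((s ^ n) e) = (s ^ (m + n)) e := fun m n e => by
    rw [zpow_add]; rfl
  have hinvP : ∀ e, invP e = swP (s e) := fun e => (h1 _).symm
  -- Travelling never leads to the opposite direction: otherwise, halfway along, `sw` (for `m` even)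
  -- or `inv` (for `m` odd) would fix an edge flag.
  have key : ∀ (m : ℤ) (e), (s ^ m) e ≠ swP e := by
    intro m e h
    rcases Int.even_or_odd' m with ⟨j, rfl | rfl⟩
    · refine h2 ((s ^ j) e) ?_
      have : swP ((s ^ j) e) = (s ^ j) e := by
        rw [hz', ← h, hadd]; congr 2; ring
      exact this
    · have h5 : invP ((s ^ j) e) = (s ^ j) e := by
        have h6 : s ((s ^ j) e) = (s ^ (1 + j)) e := by rw [← hadd, zpow_one]
        rw [hinvP, h6, hz', ← h, hadd]; congr 2; ring
      exact ((s ^ j) e).2 (congrArg Subtype.val h5)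
  have hvs : ∀ e, G.vtx (s e).1 = G.vtx (G.inv e.1) := fun e => h3 _
  -- The visited vertices are closed under crossing edges: one of the two edge flags at such a
  -- vertex leads forward by `s`, the other backward by its inverse.
  have hsurj : ∀ v, ∃ m : ℤ, G.vtx ((s ^ m) e).1 = v := by
    refine G.connected {v | ∃ m : ℤ, G.vtx ((s ^ m) e).1 = v} ⟨_, 0, rfl⟩ ?_
    rintro f ⟨m, hm⟩
    by_cases hf : G.inv f = f
    · exact ⟨m, by rw [hf, hm]⟩
    · rcases h4 _ ⟨f, hf⟩ hm.symm with h | h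
      · refine ⟨1 + m, ?_⟩
        rw [← hadd, zpow_one, hvs, ← h]
      · refine ⟨-1 + m, ?_⟩
        rw [← hadd, zpow_neg_one, hsi]
        change G.vtx (G.inv (sw ((s ^ m) e)).1) = _
        rw [← h]
  have hinj : ∀ m n : ℤ, G.vtx ((s ^ m) e).1 = G.vtx ((s ^ n) e).1 → (s ^ m) e = (s ^ n) e := by
    intro m n h
    rcases h4 _ _ h with h | h
    · exact h
    · refine absurd ?_ (key (m - n) ((s ^ n) e))
      rw [hadd, sub_add_cancel]; exact h
  -- The orbit is indexed by `ZMod p`; since it is in bijection with the vertices, `p` turns out to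
  -- be their number.
  let p := Function.minimalPeriod (s • ·) e
  have hex : ∃ c : ZMod p → {f // G.inv f ≠ f}, c 0 = e ∧
      (∀ i, G.inv (c i).1 = (sw (c (i + 1))).1) ∧
      Function.Bijective fun i => G.vtx (c i).1 := by
    let E := MulAction.orbitZPowersEquiv s e
    have hc : ∀ m : ℤ, (E.symm m).1 = (s ^ m) e := fun m => by
      rw [MulAction.orbitZPowersEquiv_symm_apply']; rfl
    refine ⟨fun i => (E.symm i).1, ?_, fun i => ?_, fun i j h => ?_, fun v => ?_⟩
    · have := hc 0
      simpa using this
    · obtain ⟨m, rfl⟩ := ZMod.intCast_surjective i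
      have h5 := hc (1 + m)
      rw [← hadd, zpow_one, add_comm, Int.cast_add, Int.cast_one] at h5
      change G.inv (E.symm m).1.1 = (sw (E.symm (m + 1)).1).1
      rw [h5, hc]
      exact congrArg Subtype.val (hinvP _)
    · obtain ⟨m, rfl⟩ := ZMod.intCast_surjective i
      obtain ⟨n, rfl⟩ := ZMod.intCast_surjective j
      dsimp only at h
      rw [hc, hc] at h
      refine E.symm.injective (Subtype.ext ?_)
      rw [hc, hc]
      exact hinj m n h
    · obtain ⟨m, rfl⟩ := hsurj v
      exact ⟨m, congrArg (fun x => G.vtx x.1) (hc m)⟩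
  have hp : p = Fintype.card G.V := by
    obtain ⟨c, -, -, hb⟩ := hex
    have := Nat.card_congr (Equiv.ofBijective _ hb)
    rwa [Nat.card_zmod, Nat.card_eq_fintype_card] at this
  rwa [hp] at hex

end Cycle

/-! ### Isomorphisms from the standard cycles. -/

section CycleIso

variable {L : Type} [Fintype L]

instance neZero_card (G : GenusOneGraph L) : NeZero (Fintype.card G.V) :=
  ⟨(Fintype.card_pos_iff.2 G.nonempty).ne'⟩

theorem IsCycle.exists_iso {G : GenusOneGraph L} (h : IsCycle G) (e : {f // G.inv f ≠ f}) :
    ∃ (f : L → ZMod (Fintype.card G.V)) (hf : Function.Surjective f)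
      (p : Iso (cycle (Fintype.card G.V) f hf) G), p.flag (Sum.inl (0, true)) = e.1 := by
  classical
  obtain ⟨sw, h1, h2, h3, h4⟩ := h.exists_swap
  obtain ⟨c, hc0, hc1, hb⟩ := exists_cycle_flags h1 h2 h3 h4 e
  let vt := Equiv.ofBijective _ hb
  let f : L → ZMod (Fintype.card G.V) := fun l => vt.symm (G.vtx (G.leg l))
  have hf : Function.Surjective f := by
    -- A vertex without legs would have genus zero and valence two, against stability.
    intro i
    by_contra! hi
    have h5 : ∀ x, G.vtx x = vt i → G.inv x ≠ x := fun x hx hx' => by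
      obtain ⟨l, rfl⟩ := (G.inv_eq_self x).1 hx'
      exact hi l (vt.symm_apply_eq.2 hx)
    have h6 : Nat.card {x // G.vtx x = vt i} = 2 := by
      rw [← h.2 (vt i)]
      exact Nat.card_congr (Equiv.subtypeEquivRight fun x => ⟨fun hx => ⟨hx, h5 x hx⟩, And.left⟩)
    have h7 := G.stable (vt i)
    rw [h6, h.1] at h7
    omega
  let F : (ZMod (Fintype.card G.V) × Bool) ⊕ L → G.F :=
    Sum.elim (fun x => bif x.2 then (c x.1).1 else (sw (c x.1)).1) G.leg
  have hF : Function.Bijective F := by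
    rw [Fintype.bijective_iff_surjective_and_card]
    refine ⟨fun x => ?_, ?_⟩
    · by_cases hx : G.inv x = x
      · obtain ⟨l, rfl⟩ := (G.inv_eq_self x).1 hx
        exact ⟨Sum.inr l, rfl⟩
      · obtain ⟨i, hi⟩ := hb.2 (G.vtx x)
        rcases h4 (c i) ⟨x, hx⟩ hi.symm with h | h
        · exact ⟨Sum.inl (i, true), (congrArg Subtype.val h).symm⟩
        · exact ⟨Sum.inl (i, false), (congrArg Subtype.val h).symm⟩
    · have h5 := G.genus_eq
      rw [Finset.sum_eq_zero fun v _ => h.1 v] at h5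
      simp only [Fintype.card_sum, Fintype.card_prod, ZMod.card, Fintype.card_bool]
      omega
  refine ⟨f, hf, ⟨vt, Equiv.ofBijective F hF, ?_, fun v => h.1 _, ?_, fun l => rfl⟩,
    congrArg Subtype.val hc0⟩
  · rintro (⟨i, _ | _⟩ | l)
    · exact h3 _
    · rfl
    · exact (vt.apply_symm_apply (G.vtx (G.leg l))).symm
  · rintro (⟨i, _ | _⟩ | l)
    · change G.inv (sw (c i)).1 = (c (i - 1)).1
      have h5 := hc1 (i - 1)
      rw [sub_add_cancel] at h5
      rw [← h5, G.inv_inv]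
    · exact hc1 i
    · exact G.inv_leg l

theorem Iso.cycle_flag_false {G : GenusOneGraph L} {k : ℕ} [NeZero k] {f : L → ZMod k}
    {hf : Function.Surjective f} (p : Iso (cycle k f hf) G) (i : ZMod k) :
    p.flag (Sum.inl (i + 1, false)) = G.inv (p.flag (Sum.inl (i, true))) :=
  (p.inv_flag (Sum.inl (i, true))).symm

theorem Iso.inv_flag_cycle_ne {G : GenusOneGraph L} {k : ℕ} [NeZero k] {f : L → ZMod k}
    {hf : Function.Surjective f} (p : Iso (cycle k f hf) G) (x : ZMod k × Bool) :
    G.inv (p.flag (Sum.inl x)) ≠ p.flag (Sum.inl x) := by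
  intro h
  have h1 := p.flag.injective ((p.inv_flag (Sum.inl x)).symm.trans h)
  have h' := congrArg Prod.snd (Sum.inl_injective h1)
  rcases x with ⟨i, _ | _⟩ <;> cases h'

/-- Crossing edges and crossing vertices commute with isomorphisms and lead from one edge flag to
all others. The leg maps `f` and `f'` may differ, since legs play no part in this. -/
theorem IsCycle.flag_eq_of_flag_zero_eq {G : GenusOneGraph L} (h : IsCycle G) {k : ℕ} [NeZero k]
    {f f' : L → ZMod k} {hf : Function.Surjective f} {hf' : Function.Surjective f'}
    (p : Iso (cycle k f hf) G) (p' : Iso (cycle k f' hf') G) {j : ZMod k}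
    (h0 : p.flag (Sum.inl (j, true)) = p'.flag (Sum.inl (j, true))) (x : ZMod k × Bool) :
    p.flag (Sum.inl x) = p'.flag (Sum.inl x) := by
  obtain ⟨sw, h1, h2, h3, h4⟩ := h.exists_swap
  have hsw : ∀ (g : L → ZMod k) (hg : Function.Surjective g) (q : Iso (cycle k g hg) G)
      (i : ZMod k), (⟨_, q.inv_flag_cycle_ne (i, false)⟩ : {f // G.inv f ≠ f}) =
        sw ⟨_, q.inv_flag_cycle_ne (i, true)⟩ := fun g hg q i => by
    refine (h4 ⟨_, q.inv_flag_cycle_ne (i, true)⟩ _ ?_).resolve_left fun h => ?_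
    · exact (q.vtx_flag (Sum.inl (i, false))).trans (q.vtx_flag (Sum.inl (i, true))).symm
    · cases congrArg Prod.snd (Sum.inl_injective (q.flag.injective (congrArg Subtype.val h)))
  have step : ∀ i, p.flag (Sum.inl (i, true)) = p'.flag (Sum.inl (i, true)) →
      p.flag (Sum.inl (i, false)) = p'.flag (Sum.inl (i, false)) := fun i hi => by
    have h5 := hsw f hf p i
    have h6 := hsw f' hf' p' i
    have h7 : (⟨_, p.inv_flag_cycle_ne (i, true)⟩ : {f // G.inv f ≠ f}) =
      ⟨_, p'.inv_flag_cycle_ne (i, true)⟩ := Subtype.ext hi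
    exact congrArg Subtype.val (h5.trans ((congrArg sw h7).trans h6.symm))
  have step' : ∀ i, p.flag (Sum.inl (i, true)) = p'.flag (Sum.inl (i, true)) →
      p.flag (Sum.inl (i + 1, true)) = p'.flag (Sum.inl (i + 1, true)) := fun i hi => by
    have h5 := congrArg sw (hsw f hf p (i + 1))
    have h6 := congrArg sw (hsw f' hf' p' (i + 1))
    rw [h1] at h5 h6
    have h7 : (⟨_, p.inv_flag_cycle_ne (i + 1, false)⟩ : {f // G.inv f ≠ f}) =
      ⟨_, p'.inv_flag_cycle_ne (i + 1, false)⟩ := Subtype.ext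
        ((p.cycle_flag_false i).trans ((congrArg G.inv hi).trans (p'.cycle_flag_false i).symm))
    exact congrArg Subtype.val (h5.symm.trans ((congrArg sw h7).trans h6))
  have hall : ∀ i, p.flag (Sum.inl (i, true)) = p'.flag (Sum.inl (i, true)) := by
    have hn : ∀ n : ℕ, p.flag (Sum.inl (j + n, true)) = p'.flag (Sum.inl (j + n, true)) := by
      intro n
      induction n with
      | zero => simpa using h0
      | succ n ih =>
        have := step' _ ih
        simpa [add_assoc] using this
    intro i
    obtain ⟨n, hn'⟩ := ZMod.natCast_zmod_surjective (i - j)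
    have := hn n
    rwa [hn', add_sub_cancel] at this
  rcases x with ⟨i, _ | _⟩
  · exact step i (hall i)
  · exact hall i

theorem IsCycle.vert_eq_of_flag_zero_eq {G : GenusOneGraph L} (h : IsCycle G) {k : ℕ} [NeZero k]
    {f f' : L → ZMod k} {hf : Function.Surjective f} {hf' : Function.Surjective f'}
    (p : Iso (cycle k f hf) G) (p' : Iso (cycle k f' hf') G) {j : ZMod k}
    (h0 : p.flag (Sum.inl (j, true)) = p'.flag (Sum.inl (j, true))) (i : ZMod k) :
    p.vert i = p'.vert i := by
  have h1 := p.vtx_flag (Sum.inl (i, true))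
  have h2 := p'.vtx_flag (Sum.inl (i, true))
  rw [h.flag_eq_of_flag_zero_eq p p' h0] at h1
  exact h1.symm.trans h2

theorem IsCycle.iso_eq_of_flag_zero_eq {G : GenusOneGraph L} (h : IsCycle G) {k : ℕ} [NeZero k]
    {f : L → ZMod k} {hf : Function.Surjective f} (p p' : Iso (cycle k f hf) G) {j : ZMod k}
    (h0 : p.flag (Sum.inl (j, true)) = p'.flag (Sum.inl (j, true))) : p = p' := by
  refine Iso.ext_apply (h.vert_eq_of_flag_zero_eq p p' h0) ?_
  rintro (x | l)
  · exact h.flag_eq_of_flag_zero_eq p p' h0 x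
  · exact (p.flag_leg l).trans (p'.flag_leg l).symm

/-- Recording the image of `(0, true)` is a bijection from the pairs `(f, p)` to the edge flags of
`G`: that image determines `p` on edge flags and vertices, and the positions of the legs then
determine `f`. By `genus_eq` there are `2k` edge flags. -/
theorem IsCycle.sum_card_iso [DecidableEq L] {G : GenusOneGraph L} (h : IsCycle G) :
    ∑ f : {f : L → ZMod (Fintype.card G.V) // Function.Surjective f},
      Nat.card (Iso (cycle _ f.1 f.2) G) = 2 * Fintype.card G.V := by
  have h1 : Nat.card {f // G.inv f ≠ f} = 2 * Fintype.card G.V := by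
    have h2 := G.card_edgeFlag
    have h3 := G.genus_eq
    rw [Finset.sum_eq_zero fun v _ => h.1 v] at h3
    omega
  rw [← h1, ← Nat.card_sigma]
  refine Nat.card_congr (Equiv.ofBijective
    (fun x => ⟨x.2.flag (Sum.inl (0, true)), x.2.inv_flag_cycle_ne _⟩) ⟨?_, ?_⟩)
  · rintro ⟨⟨f, hf⟩, p⟩ ⟨⟨f', hf'⟩, p'⟩ hp
    have hp' : p.flag (Sum.inl (0, true)) = p'.flag (Sum.inl (0, true)) := congrArg Subtype.val hp
    obtain rfl : f = f' := by
      funext l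
      have h3 : p.vert (f l) = p'.vert (f' l) := by
        have h4 := p.vtx_flag (Sum.inr l)
        have h5 := p'.vtx_flag (Sum.inr l)
        rw [show p.flag (Sum.inr l) = G.leg l from p.flag_leg l] at h4
        rw [show p'.flag (Sum.inr l) = G.leg l from p'.flag_leg l] at h5
        exact h4.symm.trans h5
      rw [← h.vert_eq_of_flag_zero_eq p p' hp'] at h3
      exact p.vert.injective h3
    rw [h.iso_eq_of_flag_zero_eq p p' hp']
  · intro e
    obtain ⟨f, hf, p, hp⟩ := h.exists_iso e
    exact ⟨⟨⟨f, hf⟩, p⟩, Subtype.ext hp⟩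

/-! ### Automorphisms of a cycle. -/

section Aut

variable {k : ℕ} [NeZero k] {f : L → ZMod k} {hf : Function.Surjective f}

/-- Every vertex carries a leg, and legs are fixed. -/
theorem cycle_aut_vert (p : Iso (cycle k f hf) (cycle k f hf)) (v : ZMod k) : p.vert v = v := by
  obtain ⟨l, rfl⟩ := hf v
  have h := p.vtx_flag (Sum.inr l)
  rw [show p.flag (Sum.inr l) = Sum.inr l from p.flag_leg l] at h
  exact h.symm

theorem cycle_aut_flag (p : Iso (cycle k f hf) (cycle k f hf)) (x : ZMod k × Bool) :
    ∃ b, p.flag (Sum.inl x) = Sum.inl (x.1, b) := by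
  have h := p.vtx_flag (Sum.inl x)
  rw [show p.vert ((cycle k f hf).vtx (Sum.inl x)) = x.1 from cycle_aut_vert p _] at h
  rcases h1 : p.flag (Sum.inl x) with ⟨i, b⟩ | l
  · rw [h1] at h
    obtain rfl : i = x.1 := h
    exact ⟨b, rfl⟩
  · cases p.flag.injective (h1.trans (p.flag_leg l).symm)

theorem cycle_aut_eq_refl (p : Iso (cycle k f hf) (cycle k f hf)) {i : ZMod k}
    (h : p.flag (Sum.inl (i, true)) = Sum.inl (i, true)) : p = Iso.refl _ :=
  (isCycle_cycle k f hf).iso_eq_of_flag_zero_eq p (Iso.refl _) h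

/-- The automorphism reversing a cycle with one or two vertices. -/
def flip (h : k ∣ 2) : Iso (cycle k f hf) (cycle k f hf) where
  vert := Equiv.refl _
  flag := Equiv.sumCongr (Equiv.prodCongr (Equiv.refl _) Equiv.boolNot) (Equiv.refl _)
  vtx_flag := by rintro (⟨i, b⟩ | l) <;> rfl
  genus_vert _ := rfl
  inv_flag := by
    have h2 : (1 : ZMod k) = -1 := by
      rw [eq_neg_iff_add_eq_zero, one_add_one_eq_two]
      exact_mod_cast (ZMod.natCast_eq_zero_iff 2 k).2 h
    have h3 : ∀ i : ZMod k, i + 1 = i - 1 := fun i => by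
      rw [sub_eq_add_neg, ← h2]
    rintro (⟨i, _ | _⟩ | l)
    · exact congrArg (fun j => Sum.inl (j, false)) (h3 i)
    · exact congrArg (fun j => Sum.inl (j, true)) (h3 i).symm
    · rfl
  flag_leg _ := rfl

/-- An automorphism fixing one flag `(i, true)` is the identity, so a nontrivial one exchanges the
two edge flags at every vertex. It maps the edge from `0` to `1` to the edge from `0` to `-1`, and
as vertices are fixed this forces `2 = 0` in `ZMod k`. -/
theorem cycle_aut_eq_flip (p : Iso (cycle k f hf) (cycle k f hf)) (hp : p ≠ Iso.refl _) :
    ∃ h : k ∣ 2, p = flip h := by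
  have h1 : ∀ i, p.flag (Sum.inl (i, true)) = Sum.inl (i, false) := fun i => by
    obtain ⟨_ | _, hb⟩ := cycle_aut_flag p (i, true)
    · exact hb
    · exact absurd (cycle_aut_eq_refl p hb) hp
  have h2 : k ∣ 2 := by
    have h3 := p.cycle_flag_false 0
    rw [h1] at h3
    obtain ⟨b, hb⟩ := cycle_aut_flag p (0 + 1, false)
    have h4 : (0 + 1 : ZMod k) = 0 - 1 :=
      congrArg Prod.fst (Sum.inl_injective (hb.symm.trans h3))
    rw [← ZMod.natCast_eq_zero_iff]
    rw [zero_add, zero_sub, eq_neg_iff_add_eq_zero, one_add_one_eq_two] at h4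
    exact_mod_cast h4
  exact ⟨h2, (isCycle_cycle k f hf).iso_eq_of_flag_zero_eq p (flip h2) (h1 0)⟩

/-- The identity contributes `a` at every vertex. The reversal, if it exists, moves flags at every
vertex and contributes `t` throughout. -/
theorem autWeight_cycle {R : Type*} [CommRing R] [Algebra ℚ R] (a t : ℕ → ℕ → R) :
    autWeight a t (cycle k f hf) = ∏ v, a 0 (Nat.card {l // f l = v} + 2) +
      if k ∣ 2 then ∏ v, t 0 (Nat.card {l // f l = v} + 2) else 0 := by
  classical
  have hval : ∀ v, (cycle k f hf).valence v = Nat.card {l // f l = v} + 2 := fun v =>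
    card_cycle_fiber f v
  have h1 : ∏ v, localWeight a t (cycle k f hf) (Iso.refl _) v =
      ∏ v : ZMod k, a 0 (Nat.card {l // f l = v} + 2) :=
    Finset.prod_congr rfl fun v _ => by
      refine (if_pos fun _ _ => rfl).trans ?_
      rw [hval]; rfl
  rw [autWeight]
  split_ifs with h
  · have h2 : (Finset.univ : Finset (Iso (cycle k f hf) (cycle k f hf))) =
        {Iso.refl _, flip h} := by
      ext p
      by_cases hp : p = Iso.refl _
      · simp [hp]
      · obtain ⟨h', rfl⟩ := cycle_aut_eq_flip p hp
        simp
    have h3 : flip h ≠ Iso.refl (cycle k f hf) := fun h4 => by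
      have h5 := congrArg (fun q : Iso _ _ => q.flag (Sum.inl (0, true))) h4
      cases congrArg Prod.snd (Sum.inl_injective h5)
    rw [h2, Finset.sum_pair h3.symm, h1]
    congr 1
    refine Finset.prod_congr rfl fun v _ => (if_neg fun h4 => ?_).trans ?_
    · have h5 := h4 (Sum.inl (v, true)) rfl
      cases congrArg Prod.snd (Sum.inl_injective h5)
    · rw [hval]; rfl
  · have h2 : (Finset.univ : Finset (Iso (cycle k f hf) (cycle k f hf))) = {Iso.refl _} := by
      ext p
      by_cases hp : p = Iso.refl _
      · simp [hp]
      · obtain ⟨h', rfl⟩ := cycle_aut_eq_flip p hp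
        exact absurd h' h
    rw [h2, Finset.sum_singleton, h1, add_zero]

end Aut

end CycleIso

/-! ### Graphs without ends and their generating function. -/

section Endless

variable {L : Type} [Fintype L] {R : Type*} [CommRing R] [Algebra ℚ R] (a t : ℕ → ℕ → R)

theorem nonempty_iso_out (G : GenusOneGraph L) : Nonempty (Iso (⟦G⟧ : Classes L).out G) :=
  Quotient.mk_out G

theorem mk_eq_iff {G : GenusOneGraph L} {q : Classes L} :
    ⟦G⟧ = q ↔ Nonempty (Iso G q.out) := by
  constructor
  · rintro rfl
    exact (nonempty_iso_out G).map Iso.symm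
  · intro h
    exact (Quotient.sound h).trans (Quotient.out_eq q)

theorem classWeight_eq_weight_out (q : Classes L) : classWeight a t q = weight a t q.out := by
  conv_lhs => rw [← Quotient.out_eq q]
  rfl

open Classical in
-- Orbit counting: the number of maps `f` whose cycle lies in a given class, times the order of the
-- automorphism group, is `2k` by `IsCycle.sum_card_iso`. This cancels the group order in the
-- weight.
theorem sum_classWeight_cycle (k : ℕ) [NeZero k] :
    ∑ q : Classes L, (if IsCycle q.out ∧ Fintype.card q.out.V = k then classWeight a t q else 0) =
      ((2 * k : ℕ) : ℚ)⁻¹ • ∑ f : {f : L → ZMod k // Function.Surjective f},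
        autWeight a t (cycle k f.1 f.2) := by
  have hk : ((2 * k : ℕ) : ℚ) ≠ 0 := by
    have := NeZero.ne k
    exact_mod_cast (by omega : 2 * k ≠ 0)
  have h1 : ∀ f : {f : L → ZMod k // Function.Surjective f}, autWeight a t (cycle k f.1 f.2) =
      ∑ q : Classes L, if ⟦cycle k f.1 f.2⟧ = q then autWeight a t q.out else 0 := fun f => by
    rw [Finset.sum_ite_eq, if_pos (Finset.mem_univ _)]
    exact autWeight_congr (nonempty_iso_out (cycle k f.1 f.2)).some.symm
  rw [Finset.sum_congr rfl fun f _ => h1 f, Finset.sum_comm, Finset.smul_sum]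
  refine Finset.sum_congr rfl fun q _ => ?_
  split_ifs with h
  · obtain ⟨hc, rfl⟩ := h
    have h2 : ∀ f : {f : L → ZMod (Fintype.card q.out.V) // Function.Surjective f},
        Nat.card (Iso (cycle _ f.1 f.2) q.out) =
          if ⟦cycle _ f.1 f.2⟧ = q then Nat.card (Iso q.out q.out) else 0 := fun f => by
      split_ifs with h
      · obtain ⟨p⟩ := mk_eq_iff.1 h
        refine Nat.card_congr ⟨fun r => p.symm.trans r, fun r => p.trans r, fun r => ?_, fun r => ?_⟩ <;>
          exact Iso.ext_apply (fun _ => by simp [Iso.trans, Iso.symm])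
            fun _ => by simp [Iso.trans, Iso.symm]
      · have : IsEmpty (Iso (cycle _ f.1 f.2) q.out) := ⟨fun p => h (mk_eq_iff.2 ⟨p⟩)⟩
        exact Nat.card_of_isEmpty
    have h3 := hc.sum_card_iso
    rw [Finset.sum_congr rfl fun f _ => h2 f, ← Finset.sum_filter, Finset.sum_const,
      smul_eq_mul] at h3
    rw [← Finset.sum_filter, Finset.sum_const, classWeight_eq_weight_out, weight, ← h3,
      ← Nat.cast_smul_eq_nsmul ℚ, smul_smul]
    congr 1
    have h4 : (Nat.card (Iso q.out q.out) : ℚ) ≠ 0 := by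
      have : Nonempty (Iso q.out q.out) := ⟨Iso.refl _⟩
      exact_mod_cast Nat.card_pos.ne'
    rw [← h3] at hk
    push_cast at hk ⊢
    have h5 := left_ne_zero_of_mul hk
    field_simp
  · rw [Finset.sum_eq_zero, smul_zero]
    intro f _
    rw [if_neg]
    intro hq
    obtain ⟨p⟩ := mk_eq_iff.1 hq
    refine h ⟨p.isCycle (isCycle_cycle k f.1 f.2), ?_⟩
    exact (Fintype.card_congr p.vert).symm.trans (ZMod.card k)

open PowerSeries in
open Classical in
-- The maps from `L` to `ZMod k` are the distributions of the legs over the `k` factors; the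
-- condition `1 ≤ m` in each factor expresses surjectivity.
theorem sum_classWeight_cycle_eq_coeff {k : ℕ} (hk : k ≠ 0) :
    ((Fintype.card L) ! : ℚ)⁻¹ • ∑ q : Classes L,
      (if IsCycle q.out ∧ Fintype.card q.out.V = k then classWeight a t q else 0) =
    ((2 * k : ℕ) : ℚ)⁻¹ • (coeff (Fintype.card L)
      (egf (fun m => if 1 ≤ m then a 0 (m + 2) else 0) ^ k) +
      if k ∣ 2 then coeff (Fintype.card L)
        (egf (fun m => if 1 ≤ m then t 0 (m + 2) else 0) ^ k) else 0) := by
  have : NeZero k := ⟨hk⟩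
  have key : ∀ c : ℕ → R, coeff (Fintype.card L)
      (egf (fun m => if 1 ≤ m then c (m + 2) else 0) ^ k) = ((Fintype.card L) ! : ℚ)⁻¹ •
        ∑ f : {f : L → ZMod k // Function.Surjective f},
          ∏ v, c (Nat.card {l // f.1 l = v} + 2) := by
    intro c
    have h1 := coeff_prod_egf' (L := L) (ι := ZMod k)
      fun _ m => if 1 ≤ m then c (m + 2) else 0
    rw [Finset.prod_const, Finset.card_univ, ZMod.card] at h1
    rw [h1]
    congr 1
    have h2 : ∀ f : L → ZMod k, (∏ v, if 1 ≤ Nat.card {l // f l = v} then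
        c (Nat.card {l // f l = v} + 2) else 0) = if Function.Surjective f then
          ∏ v, c (Nat.card {l // f l = v} + 2) else 0 := by
      intro f
      split_ifs with hf
      · refine Finset.prod_congr rfl fun v _ => if_pos ?_
        have : Nonempty {l // f l = v} := (hf v).elim fun l hl => ⟨⟨l, hl⟩⟩
        exact Nat.card_pos
      · have hf' : ∃ v, ∀ l, f l ≠ v := by simpa [Function.Surjective] using hf
        obtain ⟨v, hv⟩ := hf'
        refine Finset.prod_eq_zero (Finset.mem_univ v) (if_neg ?_)
        have : IsEmpty {l // f l = v} := ⟨fun l => hv l.1 l.2⟩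
        simp
    rw [Finset.sum_congr rfl fun f _ => h2 f, ← Finset.sum_filter,
      Finset.sum_subtype (p := Function.Surjective) _ (by simp)]
  rw [sum_classWeight_cycle, smul_comm, key (a 0), Finset.sum_congr rfl fun f _ =>
    autWeight_cycle a t, Finset.sum_add_distrib, smul_add]
  congr 2
  split_ifs with h
  · exact (key (t 0)).symm
  · simp

/-- There is only one vertex, of genus one. -/
def IsSingle (G : GenusOneGraph L) : Prop := ∃ v, G.genus v = 1 ∧ ∀ w, w = v

/-- With one vertex and total genus one, `genus_eq` leaves no room for flags other than legs. -/
theorem IsSingle.leg_bijective {G : GenusOneGraph L} (h : IsSingle G) :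
    Function.Bijective G.leg := by
  obtain ⟨v, h1, h2⟩ := h
  rw [Fintype.bijective_iff_injective_and_card]
  refine ⟨G.leg_injective, ?_⟩
  have h3 := G.genus_eq
  have : Unique G.V := ⟨⟨v⟩, h2⟩
  rw [Fintype.sum_unique, Fintype.card_unique (α := G.V), h2 default, h1] at h3
  omega

theorem IsSingle.nonempty_iso {G H : GenusOneGraph L} (hG : IsSingle G) (hH : IsSingle H) :
    Nonempty (Iso G H) := by
  have bG := hG.leg_bijective
  have bH := hH.leg_bijective
  obtain ⟨v, h1, h2⟩ := hG
  obtain ⟨w, h3, h4⟩ := hH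
  have : Unique G.V := ⟨⟨v⟩, h2⟩
  have : Unique H.V := ⟨⟨w⟩, h4⟩
  refine ⟨⟨Equiv.ofUnique _ _, (Equiv.ofBijective _ bG).symm.trans (Equiv.ofBijective _ bH),
    fun f => Subsingleton.elim _ _, fun x => ?_, fun f => ?_, fun l => ?_⟩⟩
  · rw [h4 (Equiv.ofUnique _ _ x), h2 x, h1, h3]
  · obtain ⟨l, rfl⟩ := bG.2 f
    rw [G.inv_leg, Equiv.trans_apply, Equiv.ofBijective_apply, H.inv_leg]
  · rw [Equiv.trans_apply, Equiv.ofBijective_symm_apply_apply]; rfl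

theorem Iso.isSingle {G H : GenusOneGraph L} (p : Iso G H) (h : IsSingle G) : IsSingle H := by
  obtain ⟨v, h1, h2⟩ := h
  refine ⟨p.vert v, (p.genus_vert v).trans h1, fun w => ?_⟩
  rw [← p.vert.apply_symm_apply w, h2 (p.vert.symm w)]

theorem IsSingle.card_flag {G : GenusOneGraph L} (h : IsSingle G) (v : G.V) :
    G.valence v = Fintype.card L := by
  have h1 := h.leg_bijective
  obtain ⟨w, -, h2⟩ := h
  rw [valence, ← Nat.card_eq_fintype_card, Nat.card_congr (Equiv.ofBijective _ h1)]
  exact Nat.card_congr (Equiv.subtypeUnivEquiv fun f => (h2 _).trans (h2 _).symm)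

theorem IsSingle.weight_eq {G : GenusOneGraph L} (h : IsSingle G) :
    weight a t G = a 1 (Fintype.card L) := by
  have h1 : ∀ (σ : Iso G G) (v : G.V), localWeight a t G σ v = a 1 (Fintype.card L) := by
    intro σ v
    have h2 : G.genus v = 1 := by
      obtain ⟨w, h3, h4⟩ := h
      rw [h4 v, h3]
    rw [localWeight, if_pos, h.card_flag, h2]
    intro f _
    obtain ⟨l, rfl⟩ := h.leg_bijective.2 f
    exact σ.flag_leg l
  have h3 : Fintype.card G.V = 1 := by
    obtain ⟨w, -, h4⟩ := h
    exact Fintype.card_eq_one_iff.2 ⟨w, h4⟩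
  have h4 : (Nat.card (Iso G G) : ℚ) ≠ 0 := by
    have : Nonempty (Iso G G) := ⟨Iso.refl _⟩
    exact_mod_cast Nat.card_pos.ne'
  rw [weight, autWeight, Finset.sum_congr rfl fun σ _ => Finset.prod_congr rfl fun v _ => h1 σ v]
  simp only [Finset.prod_const, Finset.sum_const, Finset.card_univ, h3, pow_one]
  rw [← Nat.cast_smul_eq_nsmul ℚ, smul_smul, ← Nat.card_eq_fintype_card, inv_mul_cancel₀ h4,
    one_smul]

/-- The graph with one vertex of genus one and no edges. -/
def single (L : Type) [Fintype L] [Nonempty L] : GenusOneGraph L where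
  V := Unit
  F := L
  fintypeV := inferInstance
  fintypeF := inferInstance
  vtx _ := ()
  genus _ := 1
  inv := id
  leg := id
  inv_inv _ := rfl
  leg_injective := Function.injective_id
  inv_eq_self f := by simp
  stable v := by
    have : 0 < Nat.card L := Nat.card_pos
    rw [Nat.card_congr (Equiv.subtypeUnivEquiv fun f => rfl)]
    omega
  nonempty := ⟨()⟩
  connected S hS _ _ := hS.elim fun _ h => h
  genus_eq := by simp

open Classical in
theorem sum_classWeight_single :
    ∑ q : Classes L, (if IsSingle q.out then classWeight a t q else 0) =
      if 1 ≤ Fintype.card L then a 1 (Fintype.card L) else 0 := by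
  split_ifs with h
  · have : Nonempty L := Fintype.card_pos_iff.1 h
    have hs : IsSingle (single L) := ⟨(), rfl, fun _ => rfl⟩
    rw [Finset.sum_eq_single (⟦single L⟧ : Classes L)]
    · have h1 : IsSingle (⟦single L⟧ : Classes L).out :=
        (nonempty_iso_out (single L)).some.symm.isSingle hs
      rw [if_pos h1, classWeight_eq_weight_out, h1.weight_eq]
    · intro q _ hq
      refine if_neg fun hq' => hq ?_
      rw [← Quotient.out_eq q]
      exact Quotient.sound (hq'.nonempty_iso hs)
    · exact fun h => absurd (Finset.mem_univ _) h
  · refine Finset.sum_eq_zero fun q _ => if_neg fun hq => h ?_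
    obtain ⟨v, h1, h2⟩ := hq
    have h3 := q.out.stable v
    have h4 := IsSingle.card_flag ⟨v, h1, h2⟩ v
    rw [valence] at h4
    omega

/-- Let `e(v)` be the number of edge flags at `v`. By `genus_eq` the sum of `e(v) + 2 g(v)` is twice
the number of vertices. Without ends, `e(v) ≥ 2` if `g(v) = 0`. If some vertex of positive genus has
no edges, it is the whole graph. Otherwise `e(v) + g(v) ≥ 2` everywhere, so the total genus of the
vertices vanishes and all `e(v)` equal two. -/
theorem isEmpty_isEnd_iff {G : GenusOneGraph (L ⊕ Fin 0)} :
    (∀ B, ¬ IsEnd G B) ↔ IsSingle G ∨ IsCycle G := by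
  classical
  constructor
  · intro hE
    have he0 : ∀ v, G.genus v = 0 → 2 ≤ Nat.card {f // G.vtx f = v ∧ G.inv f ≠ f} := by
      intro v hv
      obtain ⟨r, hr, hr'⟩ := G.exists_vtx_inv_ne hv
      have : Nonempty {f // G.vtx f = v ∧ G.inv f ≠ f} := ⟨⟨r, hr, hr'⟩⟩
      have h1 : 0 < Nat.card {f // G.vtx f = v ∧ G.inv f ≠ f} := Nat.card_pos
      by_contra h2
      have h3 : Nat.card {f // G.vtx f = v ∧ G.inv f ≠ f} = 1 := by omega
      have h4 := (Nat.card_eq_one_iff_unique.1 h3).1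
      -- Since there are no legs labelled by `K = Fin 0`, a vertex of genus zero with a single edge
      -- flag is an end.
      refine hE {l | G.vtx (G.leg (Sum.inl l)) = v} ⟨v, r, hv, hr', fun f => ⟨fun hf => ?_, ?_⟩⟩
      · by_cases h5 : G.inv f = f
        · obtain ⟨l | k, rfl⟩ := (G.inv_eq_self f).1 h5
          · exact Or.inr ⟨l, by simpa using hf, rfl⟩
          · exact k.elim0
        · exact Or.inl (congrArg Subtype.val (h4.elim ⟨f, hf, h5⟩ ⟨r, hr, hr'⟩))
      · rintro (rfl | ⟨l, hl, rfl⟩)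
        · exact hr
        · simpa using hl
    have h1 := G.sum_card_edgeFlag
    have h2 := G.card_edgeFlag
    have h3 := G.genus_eq
    by_cases h4 : ∃ w, 0 < G.genus w ∧ Nat.card {f // G.vtx f = w ∧ G.inv f ≠ f} = 0
    · left
      obtain ⟨w, hw, hw'⟩ := h4
      have h5 := G.connected {w} ⟨w, rfl⟩ fun f hf => by
        by_cases h6 : G.inv f = f
        · rw [h6]; exact hf
        · have : Nonempty {f // G.vtx f = w ∧ G.inv f ≠ f} := ⟨⟨f, hf, h6⟩⟩
          have : 0 < Nat.card {f // G.vtx f = w ∧ G.inv f ≠ f} := Nat.card_pos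
          omega
      have : Unique G.V := ⟨⟨w⟩, h5⟩
      have h6 : (default : G.V) = w := h5 _
      rw [Fintype.sum_unique, h6] at h1 h3
      rw [Fintype.card_unique (α := G.V)] at h3
      exact ⟨w, by omega, h5⟩
    · right
      push Not at h4
      have h5 : ∀ v, 2 ≤ Nat.card {f // G.vtx f = v ∧ G.inv f ≠ f} + G.genus v := fun v => by
        rcases Nat.eq_zero_or_pos (G.genus v) with h | h
        · have := he0 v h; omega
        · have := h4 v h; omega
      have h6 : ∑ _ : G.V, 2 ≤ ∑ v, (Nat.card {f // G.vtx f = v ∧ G.inv f ≠ f} + G.genus v) :=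
        Finset.sum_le_sum fun v _ => h5 v
      rw [Finset.sum_add_distrib, h1] at h6
      simp only [Finset.sum_const, Finset.card_univ, smul_eq_mul] at h6
      have h7 : ∑ v, G.genus v = 0 := by omega
      have h8 : ∀ v, G.genus v = 0 := fun v =>
        (Finset.sum_eq_zero_iff.1 h7) v (Finset.mem_univ v)
      refine ⟨h8, ?_⟩
      have h9 : ∑ _ : G.V, 2 = ∑ v, Nat.card {f // G.vtx f = v ∧ G.inv f ≠ f} := by
        rw [h1]
        simp only [Finset.sum_const, Finset.card_univ, smul_eq_mul]
        omega
      exact fun v => ((Finset.sum_eq_sum_iff_of_le fun v _ => he0 v (h8 v)).1 h9 v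
        (Finset.mem_univ v)).symm
  · rintro (⟨w, h1, h2⟩ | h) B ⟨v, r, h3, h4, h5⟩
    · rw [h2 v, h1] at h3
      exact one_ne_zero h3
    · have h6 := h.2 v
      have : Subsingleton {f // G.vtx f = v ∧ G.inv f ≠ f} := by
        have : ∀ x : {f // G.vtx f = v ∧ G.inv f ≠ f}, x.1 = r := by
          rintro ⟨f, hf, hf'⟩
          rcases (h5 f).1 hf with h | ⟨l, -, rfl⟩
          · exact h
          · exact absurd (G.inv_leg _) hf'
        exact ⟨fun x y => Subtype.ext ((this x).trans (this y).symm)⟩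
      have := Finite.card_le_one_iff_subsingleton.2 this
      omega

theorem IsCycle.card_le {G : GenusOneGraph L} (h : IsCycle G) :
    Fintype.card G.V ≤ Fintype.card L := by
  obtain ⟨v⟩ := G.nonempty
  obtain ⟨e, -, he⟩ := G.exists_vtx_inv_ne (h.1 v)
  obtain ⟨f, hf, -⟩ := h.exists_iso ⟨e, he⟩
  have := Fintype.card_le_of_surjective f hf
  rwa [ZMod.card] at this

open PowerSeries in
/-- The generating function of the graphs of genus one. -/
theorem subst_totalWeight :
    (egf (totalWeight a t)).subst (X - egf (endWeight a)) =
      egf (fun n => if 1 ≤ n then a 1 n else 0) -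
        (1 / 2 : ℚ) • logOf (1 - derivative R (egf (endWeight a))) +
        ((1 / 2 : ℚ) • egf fun m => if 1 ≤ m then t 0 (m + 2) else 0) *
          (((1 / 2 : ℚ) • egf fun m => if 1 ≤ m then t 0 (m + 2) else 0) + 1) := by
  classical
  ext n
  have hsm : ∀ (c : ℚ) (f : PowerSeries R), coeff n (c • f) = c • coeff n f := fun c f => rfl
  rw [coeff_subst_totalWeight]
  set y := derivative R (egf (endWeight a)) with hy
  set z := egf (fun m => if 1 ≤ m then t 0 (m + 2) else 0) with hz
  have hy' : y = egf fun m => if 1 ≤ m then a 0 (m + 2) else 0 := by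
    rw [hy, derivative_egf]
    congr 1
    funext m
    simp only [endWeight]
    congr 1
    simp
  have hy0 : constantCoeff y = 0 := by rw [hy', constantCoeff_egf]; simp
  have hE : ∀ q : Classes (Fin n ⊕ Fin 0), classEnds q = ∅ ↔
      IsSingle q.out ∨ IsCycle q.out := by
    intro q
    rw [← isEmpty_isEnd_iff, Finset.eq_empty_iff_forall_notMem]
    refine forall_congr' fun B => ?_
    rw [mem_classEnds]
    conv_lhs => rw [← Quotient.out_eq q]
    rfl
  -- A cycle has at most `n` vertices. The range goes up to `n + 2` so that it contains `1` and `2`,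
  -- the lengths of the reversible cycles, for every `n`.
  have hsplit : ∀ q : Classes (Fin n ⊕ Fin 0), (if classEnds q = ∅ then classWeight a t q else 0) =
      (if IsSingle q.out then classWeight a t q else 0) + ∑ k ∈ Finset.Icc 1 (n + 2),
        if IsCycle q.out ∧ Fintype.card q.out.V = k then classWeight a t q else 0 := by
    intro q
    by_cases h1 : IsSingle q.out
    · have h2 : ¬ IsCycle q.out := fun h => by
        obtain ⟨v, h3, -⟩ := h1
        rw [h.1] at h3
        exact zero_ne_one h3
      rw [if_pos ((hE q).2 (Or.inl h1)), if_pos h1, Finset.sum_eq_zero, add_zero]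
      exact fun k _ => if_neg fun h => h2 h.1
    · by_cases h2 : IsCycle q.out
      · rw [if_pos ((hE q).2 (Or.inr h2)), if_neg h1, zero_add]
        have h3 := h2.card_le
        have h4 : Fintype.card q.out.V ≠ 0 := NeZero.ne _
        simp only [Fintype.card_sum, Fintype.card_fin] at h3
        simp only [h2, true_and]
        rw [Finset.sum_ite_eq, if_pos (Finset.mem_Icc.2 ⟨by omega, by omega⟩)]
      · rw [if_neg fun h => ((hE q).1 h).elim h1 h2, if_neg h1, Finset.sum_eq_zero, add_zero]
        exact fun k _ => if_neg fun h => h2 h.1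
  have hcard : Fintype.card (Fin n ⊕ Fin 0) = n := by simp
  rw [Finset.sum_congr rfl fun q _ => hsplit q, Finset.sum_add_distrib, sum_classWeight_single,
    Finset.sum_comm, smul_add, Finset.smul_sum, hcard]
  have hk : ∀ k ∈ Finset.Icc 1 (n + 2), (n ! : ℚ)⁻¹ • ∑ q : Classes (Fin n ⊕ Fin 0),
      (if IsCycle q.out ∧ Fintype.card q.out.V = k then classWeight a t q else 0) =
      ((2 * k : ℕ) : ℚ)⁻¹ • coeff n (y ^ k) +
        if k ∣ 2 then ((2 * k : ℕ) : ℚ)⁻¹ • coeff n (z ^ k) else 0 := by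
    intro k hk
    have h := sum_classWeight_cycle_eq_coeff (L := Fin n ⊕ Fin 0) a t (k := k)
      (by have := Finset.mem_Icc.1 hk; omega)
    rw [hcard, ← hy', ← hz] at h
    rw [h, smul_add]
    split_ifs
    · rfl
    · rw [smul_zero]
  rw [Finset.sum_congr rfl hk, Finset.sum_add_distrib]
  have hlog : coeff n ((1 / 2 : ℚ) • logOf (1 - y)) =
      -∑ k ∈ Finset.Icc 1 (n + 2), ((2 * k : ℕ) : ℚ)⁻¹ • coeff n (y ^ k) := by
    rw [hsm, coeff_logOf_one_sub hy0, smul_neg, Finset.smul_sum]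
    congr 1
    have hXy : X ∣ y := X_dvd_iff.2 hy0
    -- The terms with `k > n` vanish, because `X` divides `y`.
    refine Finset.sum_subset_zero_on_sdiff (Finset.Icc_subset_Icc_right (by omega)) ?_ ?_
    · intro k hk
      rw [coeff_eq_zero_of_X_pow_dvd (m := k) (pow_dvd_pow_of_dvd hXy k), smul_zero]
      simp at hk; omega
    · intro k _
      rw [smul_smul]
      congr 1
      push_cast
      rw [mul_inv]; norm_num
  -- The reversible cycles give `z / 2 + z ^ 2 / 4`, which is `d + d ^ 2` for `d = z / 2`.
  have htwo : ∑ k ∈ Finset.Icc 1 (n + 2),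
      (if k ∣ 2 then ((2 * k : ℕ) : ℚ)⁻¹ • coeff n (z ^ k) else 0) =
      coeff n (((1 / 2 : ℚ) • z) * (((1 / 2 : ℚ) • z) + 1)) := by
    have h1 : (Finset.Icc 1 (n + 2)).filter (· ∣ 2) = {1, 2} := by
      ext k
      simp only [Finset.mem_filter, Finset.mem_Icc, Finset.mem_insert, Finset.mem_singleton]
      constructor
      · rintro ⟨-, h⟩
        exact (Nat.dvd_prime Nat.prime_two).1 h
      · rintro (rfl | rfl)
        · exact ⟨⟨le_rfl, by omega⟩, by norm_num⟩
        · exact ⟨⟨by norm_num, by omega⟩, dvd_rfl⟩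
    rw [← Finset.sum_filter, h1, Finset.sum_pair (by norm_num), mul_add, mul_one,
      mul_one, smul_mul_smul_comm, map_add, hsm, hsm, pow_one, pow_two, add_comm]
    norm_num
  rw [htwo, map_add, map_sub, hlog, coeff_egf]
  ring

end Endless

/-! ### Automorphisms of arbitrary graphs of genus one. -/

section Aut

variable {L : Type} [Fintype L]

/-- Each automorphism fixes the vertices and acts on the flags at a vertex trivially or as a
transposition, and there is at most one nontrivial automorphism. -/
def HasSimpleAut (G : GenusOneGraph L) : Prop :=
  (∀ (σ : Iso G G) (v : G.V), σ.vert v = v ∧ ((∀ f, G.vtx f = v → σ.flag f = f) ∨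
    ∃ x y, x ≠ y ∧ G.vtx x = v ∧ G.vtx y = v ∧ σ.flag x = y ∧ σ.flag y = x ∧
      ∀ f, G.vtx f = v → f ≠ x → f ≠ y → σ.flag f = f)) ∧
  ∀ σ τ : Iso G G, σ ≠ Iso.refl G → τ ≠ Iso.refl G → σ = τ

theorem Iso.hasSimpleAut {G H : GenusOneGraph L} (p : Iso G H) (h : HasSimpleAut G) :
    HasSimpleAut H := by
  have hr : p.conj (Iso.refl G) = Iso.refl H :=
    Iso.ext_apply (fun _ => p.vert.apply_symm_apply _) fun _ => p.flag.apply_symm_apply _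
  have hfl : ∀ (σ : Iso G G) f, (p.conj σ).flag (p.flag f) = p.flag (σ.flag f) := fun σ f =>
    congrArg (fun x => p.flag (σ.flag x)) (p.flag.symm_apply_apply f)
  have hve : ∀ (σ : Iso G G) f, (p.conj σ).vert (p.vert f) = p.vert (σ.vert f) := fun σ f =>
    congrArg (fun x => p.vert (σ.vert x)) (p.vert.symm_apply_apply f)
  refine ⟨fun σ v => ?_, fun σ τ hσ hτ => ?_⟩
  · obtain ⟨σ, rfl⟩ := p.conj.surjective σ
    obtain ⟨v, rfl⟩ := p.vert.surjective v
    obtain ⟨h1, h2⟩ := h.1 σ v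
    refine ⟨by rw [hve, h1], ?_⟩
    rcases h2 with h2 | ⟨x, y, hxy, hx, hy, h3, h4, h5⟩
    · left
      rw [← p.flag.forall_congr_right]
      intro f hf
      rw [p.vtx_flag, p.vert.apply_eq_iff_eq] at hf
      rw [hfl, h2 f hf]
    · right
      refine ⟨p.flag x, p.flag y, p.flag.injective.ne hxy, by rw [p.vtx_flag, hx],
        by rw [p.vtx_flag, hy], by rw [hfl, h3], by rw [hfl, h4], ?_⟩
      rw [← p.flag.forall_congr_right]
      intro f hf hfx hfy
      rw [p.vtx_flag, p.vert.apply_eq_iff_eq] at hf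
      rw [hfl, h5 f hf (fun h => hfx (h ▸ rfl)) fun h => hfy (h ▸ rfl)]
  · obtain ⟨σ, rfl⟩ := p.conj.surjective σ
    obtain ⟨τ, rfl⟩ := p.conj.surjective τ
    rw [h.2 σ τ (fun h => hσ (by rw [h, hr])) fun h => hτ (by rw [h, hr])]

theorem HasSimpleAut.of_reindex {L' : Type} [Fintype L'] {e : L' ≃ L} {G : GenusOneGraph L}
    (h : HasSimpleAut (G.reindex e)) : HasSimpleAut G :=
  ⟨fun σ => h.1 (reindexIso e G G σ), fun _ _ hσ hτ => (reindexIso e G G).injective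
    (h.2 _ _ (fun h => hσ ((reindexIso e G G).injective h))
      fun h => hτ ((reindexIso e G G).injective h))⟩

/-- All automorphisms of the graft come from the smaller graph and are trivial at the new vertex. -/
theorem HasSimpleAut.graft {K : Type} [Fintype K] [DecidableEq L] {B : Finset L}
    {hB : 2 ≤ B.card} {G : GenusOneGraph ({l // l ∉ B} ⊕ Option K)} (h : HasSimpleAut G) :
    HasSimpleAut (graft B hB G) := by
  have hr : graftIso (Iso.refl G) = Iso.refl (G.graft B hB) := by
    refine Iso.ext_apply ?_ ?_
    · rintro (_ | v) <;> rfl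
    · rintro (_ | v) <;> rfl
  refine ⟨fun σ v => ?_, fun σ τ hσ hτ => ?_⟩
  · obtain ⟨σ, rfl⟩ := graftIso_surjective σ
    rcases v with _ | v
    · refine ⟨rfl, Or.inl ?_⟩
      rintro (f | o) hf
      · cases hf
      · rfl
    · obtain ⟨h1, h2⟩ := h.1 σ v
      refine ⟨congrArg some h1, ?_⟩
      rcases h2 with h2 | ⟨x, y, hxy, hx, hy, h3, h4, h5⟩
      · left
        rintro (f | o) hf
        · exact congrArg Sum.inl (h2 f (Option.some_injective _ hf))
        · cases hf
      · right
        refine ⟨Sum.inl x, Sum.inl y, Sum.inl_injective.ne hxy, congrArg some hx,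
          congrArg some hy, congrArg Sum.inl h3, congrArg Sum.inl h4, ?_⟩
        rintro (f | o) hf hfx hfy
        · exact congrArg Sum.inl (h5 f (Option.some_injective _ hf) (fun h => hfx (h ▸ rfl))
            fun h => hfy (h ▸ rfl))
        · cases hf
  · obtain ⟨σ, rfl⟩ := graftIso_surjective σ
    obtain ⟨τ, rfl⟩ := graftIso_surjective τ
    rw [h.2 σ τ (fun h => hσ (by rw [h, hr])) fun h => hτ (by rw [h, hr])]

theorem IsSingle.hasSimpleAut {G : GenusOneGraph L} (h : IsSingle G) : HasSimpleAut G := by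
  have hf : ∀ (σ : Iso G G) f, σ.flag f = f := fun σ f => by
    obtain ⟨l, rfl⟩ := h.leg_bijective.2 f
    exact σ.flag_leg l
  obtain ⟨v, -, hv⟩ := h
  refine ⟨fun σ w => ⟨(hv _).trans (hv _).symm, Or.inl fun f _ => hf σ f⟩, fun σ _ hσ _ => ?_⟩
  exact absurd (Iso.ext_apply (fun w => (hv _).trans (hv _).symm) (hf σ)) hσ

theorem hasSimpleAut_cycle (k : ℕ) [NeZero k] (f : L → ZMod k) (hf : Function.Surjective f) :
    HasSimpleAut (cycle k f hf) := by
  refine ⟨fun σ v => ⟨cycle_aut_vert σ v, ?_⟩, fun σ τ hσ hτ => ?_⟩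
  · by_cases hσ : σ = Iso.refl _
    · subst hσ
      exact Or.inl fun _ _ => rfl
    · obtain ⟨h, rfl⟩ := cycle_aut_eq_flip σ hσ
      refine Or.inr ⟨Sum.inl (v, true), Sum.inl (v, false), fun h1 => ?_, rfl, rfl, rfl, rfl, ?_⟩
      · cases congrArg Prod.snd (Sum.inl_injective h1)
      · rintro (⟨i, b⟩ | l) hi h1 h2
        · obtain rfl : i = v := hi
          cases b
          · exact absurd rfl h2
          · exact absurd rfl h1
        · rfl
  · obtain ⟨h, rfl⟩ := cycle_aut_eq_flip σ hσ
    obtain ⟨h, rfl⟩ := cycle_aut_eq_flip τ hτ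
    rfl

theorem IsCycle.hasSimpleAut {G : GenusOneGraph L} (h : IsCycle G) : HasSimpleAut G := by
  obtain ⟨v⟩ := G.nonempty
  obtain ⟨e, -, he⟩ := G.exists_vtx_inv_ne (h.1 v)
  obtain ⟨f, hf, p, -⟩ := h.exists_iso ⟨e, he⟩
  exact p.hasSimpleAut (hasSimpleAut_cycle _ f hf)

/-- Ends are pruned one at a time, each step lowering the number of vertices, until a single vertex
or a cycle is left. -/
theorem hasSimpleAut_of_card_le (N : ℕ) : ∀ (L : Type) [Fintype L] (G : GenusOneGraph L),
    Fintype.card G.V ≤ N → HasSimpleAut G := by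
  classical
  induction N with
  | zero =>
    intro L _ G hG
    have := Fintype.card_pos_iff.2 G.nonempty
    omega
  | succ N ih =>
    intro L _ G hG
    -- An empty set `K` gives the labels the form needed for `IsEnd` while allowing every leg to lie
    -- on an end.
    refine HasSimpleAut.of_reindex (e := Equiv.sumEmpty L (Fin 0)) ?_
    have hG' : Fintype.card (G.reindex (Equiv.sumEmpty L (Fin 0))).V ≤ N + 1 := hG
    generalize G.reindex (Equiv.sumEmpty L (Fin 0)) = H at hG'
    by_cases h : ∀ B, ¬ IsEnd H B
    · exact (isEmpty_isEnd_iff.1 h).elim IsSingle.hasSimpleAut IsCycle.hasSimpleAut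
    · push Not at h
      obtain ⟨B, hB⟩ := h
      obtain ⟨H', ⟨p⟩⟩ := exists_graft_of_isEnd (hB := hB.two_le_card) hB
      have h1 : Fintype.card H.V = Fintype.card H'.V + 1 :=
        (Fintype.card_congr p.vert).symm.trans Fintype.card_option
      exact p.hasSimpleAut (ih _ H' (by omega)).graft

theorem hasSimpleAut (G : GenusOneGraph L) : HasSimpleAut G :=
  hasSimpleAut_of_card_le _ _ G le_rfl

end Aut

end GenusOneGraph

/-! ### Classes of idempotents -/

section Classes

variable {C : Type u} [Category.{v} C] [Preadditive C] [HasBinaryBiproducts C]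
  [MonoidalCategory C] [SymmetricCategory C]

theorem cls_congr {X Y : C} (e : X ≅ Y) : cls X = cls Y := by
  rw [cls, cls, congr_toSkeleton_of_iso e]

theorem cls_biprod (X Y : C) : cls (X ⊞ Y) = cls X + cls Y := by
  rw [cls, cls, cls, ← TensorProduct.tmul_add, ← map_add]
  congr 1
  refine (Ideal.Quotient.mk_eq_mk_iff_sub_mem _ _).2 (Ideal.subset_span ⟨X, Y, ?_⟩)
  abel

theorem cls_tensor (X Y : C) : cls (X ⊗ Y) = cls X * cls Y := by
  rw [cls, cls, cls, Algebra.TensorProduct.tmul_mul_tmul, one_mul, ← map_mul, ← map_mul,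
    Skeleton.toSkeleton_tensorObj]

theorem cls_unit : cls (𝟙_ C) = 1 := by
  rw [cls, ← Skeleton.one_eq, map_one, map_one, Algebra.TensorProduct.one_def]

theorem cls_eq_zero {X : C} (h : IsZero X) : cls X = 0 := by
  -- A zero object is isomorphic to its own double.
  have h1 : cls X = cls X + cls X := by
    rw [← cls_biprod]
    refine cls_congr ⟨0, 0, h.eq_of_src _ _, ?_⟩
    refine biprod.hom_ext _ _ (h.eq_of_tgt _ _) (h.eq_of_tgt _ _)
  exact left_eq_add.1 h1

variable [HasFiniteColimits C]

/-- The class of the image of an idempotent. -/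
def idemClass {X : C} (e : X ⟶ X) : K0Rat C := cls (cokernel (𝟙 X - e))

/-- Killing `1 - e` is the same as projecting to the image of `e`, so any splitting of `e` computes
the class. -/
theorem idemClass_eq_cls {X P : C} {e : X ⟶ X} {p : X ⟶ P} {i : P ⟶ X} (hip : i ≫ p = 𝟙 P)
    (hpi : p ≫ i = e) : idemClass e = cls P := by
  have h : (𝟙 X - e) ≫ p = 0 := by
    rw [← hpi, Preadditive.sub_comp, Category.assoc, hip, Category.comp_id, Category.id_comp,
      sub_self]
  refine cls_congr ⟨cokernel.desc _ p h, i ≫ cokernel.π _, ?_, ?_⟩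
  · rw [← cancel_epi (cokernel.π (𝟙 X - e)), cokernel.π_desc_assoc, reassoc_of% hpi,
      Category.comp_id]
    have := cokernel.condition (𝟙 X - e)
    rw [Preadditive.sub_comp, Category.id_comp, sub_eq_zero] at this
    exact this.symm
  · rw [Category.assoc, cokernel.π_desc, hip]

/-- Cokernels are enough to split idempotents: `e` factors through the cokernel of `1 - e`. -/
theorem exists_split {X : C} {e : X ⟶ X} (he : e ≫ e = e) :
    ∃ (P : C) (p : X ⟶ P) (i : P ⟶ X), i ≫ p = 𝟙 P ∧ p ≫ i = e := by
  have h : (𝟙 X - e) ≫ e = 0 := by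
    rw [Preadditive.sub_comp, he, Category.id_comp, sub_self]
  have h1 := cokernel.condition (𝟙 X - e)
  rw [Preadditive.sub_comp, Category.id_comp, sub_eq_zero] at h1
  refine ⟨cokernel (𝟙 X - e), cokernel.π _, cokernel.desc _ e h, ?_, cokernel.π_desc _ _ _⟩
  rw [← cancel_epi (cokernel.π (𝟙 X - e)), cokernel.π_desc_assoc, Category.comp_id]
  exact h1.symm

theorem idemClass_id (X : C) : idemClass (𝟙 X) = cls X :=
  idemClass_eq_cls (Category.id_comp (𝟙 X)) (Category.id_comp (𝟙 X))

theorem idemClass_zero (X : C) : idemClass (0 : X ⟶ X) = 0 := by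
  obtain ⟨P, p, i, h1, h2⟩ := exists_split (e := (0 : X ⟶ X)) comp_zero
  rw [idemClass_eq_cls h1 h2]
  refine cls_eq_zero ((IsZero.iff_id_eq_zero P).2 ?_)
  have h3 : (i ≫ p) ≫ (i ≫ p) = i ≫ (p ≫ i) ≫ p := by simp only [Category.assoc]
  rwa [h2, h1, zero_comp, comp_zero, Category.comp_id] at h3

theorem idemClass_add {X : C} {e f : X ⟶ X} (he : e ≫ e = e) (hf : f ≫ f = f)
    (hef : e ≫ f = 0) (hfe : f ≫ e = 0) : idemClass (e + f) = idemClass e + idemClass f := by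
  obtain ⟨P, p, i, h1, h2⟩ := exists_split he
  obtain ⟨Q, q, j, h3, h4⟩ := exists_split hf
  have h5 : i ≫ q = 0 := by
    have h : (i ≫ p) ≫ i ≫ q ≫ (j ≫ q) = i ≫ ((p ≫ i) ≫ (q ≫ j)) ≫ q := by
      simp only [Category.assoc]
    rwa [h2, h4, hef, h1, h3, zero_comp, comp_zero, Category.comp_id, Category.id_comp] at h
  have h6 : j ≫ p = 0 := by
    have h : (j ≫ q) ≫ j ≫ p ≫ (i ≫ p) = j ≫ ((q ≫ j) ≫ (p ≫ i)) ≫ p := by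
      simp only [Category.assoc]
    rwa [h2, h4, hfe, h1, h3, zero_comp, comp_zero, Category.comp_id, Category.id_comp] at h
  rw [idemClass_eq_cls h1 h2, idemClass_eq_cls h3 h4, ← cls_biprod]
  refine idemClass_eq_cls (p := biprod.lift p q) (i := biprod.desc i j) ?_ ?_
  · ext <;> simp [h1, h3, h5, h6]
  · rw [biprod.lift_desc, h2, h4]

theorem idemClass_sum {X : C} {ι : Type*} (s : Finset ι) (e : ι → (X ⟶ X))
    (he : ∀ q, e q ≫ e q = e q) (hne : ∀ q q', q ≠ q' → e q ≫ e q' = 0) :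
    idemClass (∑ q ∈ s, e q) = ∑ q ∈ s, idemClass (e q) := by
  classical
  induction s using Finset.induction_on with
  | empty => simp [idemClass_zero]
  | insert a s ha ih =>
    rw [Finset.sum_insert ha, Finset.sum_insert ha, ← ih]
    refine idemClass_add (he a) ?_ ?_ ?_
    · rw [Preadditive.sum_comp]
      refine Finset.sum_congr rfl fun q hq => ?_
      rw [Preadditive.comp_sum, Finset.sum_eq_single q, he]
      · exact fun q' _ h => hne q q' h.symm
      · exact fun h => absurd hq h
    · rw [Preadditive.comp_sum]
      exact Finset.sum_eq_zero fun q hq => hne a q fun h => ha (h ▸ hq)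
    · rw [Preadditive.sum_comp]
      exact Finset.sum_eq_zero fun q hq => hne q a fun h => ha (h ▸ hq)

theorem idemClass_tensor {X Y : C} {e : X ⟶ X} {f : Y ⟶ Y} (he : e ≫ e = e) (hf : f ≫ f = f) :
    idemClass (e ⊗ₘ f) = idemClass e * idemClass f := by
  obtain ⟨P, p, i, h1, h2⟩ := exists_split he
  obtain ⟨Q, q, j, h3, h4⟩ := exists_split hf
  rw [idemClass_eq_cls h1 h2, idemClass_eq_cls h3 h4, ← cls_tensor]
  refine idemClass_eq_cls (p := p ⊗ₘ q) (i := i ⊗ₘ j) ?_ ?_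
  · rw [tensorHom_comp_tensorHom, h1, h3, id_tensorHom_id]
  · rw [tensorHom_comp_tensorHom, h2, h4]

theorem idemClass_conj {X Y : C} (r : X ≅ Y) {e : X ⟶ X} (he : e ≫ e = e) :
    idemClass (r.inv ≫ e ≫ r.hom) = idemClass e := by
  obtain ⟨P, p, i, h1, h2⟩ := exists_split he
  rw [idemClass_eq_cls h1 h2]
  refine idemClass_eq_cls (p := r.inv ≫ p) (i := i ≫ r.hom) ?_ ?_
  · simp [h1]
  · simp only [Category.assoc, ← h2]

/-! ### Traces of involutions -/

variable [Linear ℚ C]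

/-- The trace of an involution. -/
def involTrace {X : C} (s : X ⟶ X) : K0Rat C :=
  idemClass ((1 / 2 : ℚ) • (𝟙 X + s)) - idemClass ((1 / 2 : ℚ) • (𝟙 X - s))

section Invol

variable {X : C} {s : X ⟶ X}

theorem invol_pos (hs : s ≫ s = 𝟙 X) : ((1 / 2 : ℚ) • (𝟙 X + s)) ≫ ((1 / 2 : ℚ) • (𝟙 X + s)) =
    (1 / 2 : ℚ) • (𝟙 X + s) := by
  simp only [Linear.smul_comp, Linear.comp_smul, Preadditive.add_comp, Preadditive.comp_add,
    Category.id_comp, Category.comp_id, hs]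
  module

theorem invol_neg (hs : s ≫ s = 𝟙 X) : ((1 / 2 : ℚ) • (𝟙 X - s)) ≫ ((1 / 2 : ℚ) • (𝟙 X - s)) =
    (1 / 2 : ℚ) • (𝟙 X - s) := by
  simp only [Linear.smul_comp, Linear.comp_smul, Preadditive.sub_comp, Preadditive.comp_sub,
    Category.id_comp, Category.comp_id, hs]
  module

theorem invol_pos_neg (hs : s ≫ s = 𝟙 X) :
    ((1 / 2 : ℚ) • (𝟙 X + s)) ≫ ((1 / 2 : ℚ) • (𝟙 X - s)) = 0 := by
  simp only [Linear.smul_comp, Linear.comp_smul, Preadditive.add_comp, Preadditive.comp_sub,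
    Category.id_comp, Category.comp_id, hs]
  module

theorem invol_neg_pos (hs : s ≫ s = 𝟙 X) :
    ((1 / 2 : ℚ) • (𝟙 X - s)) ≫ ((1 / 2 : ℚ) • (𝟙 X + s)) = 0 := by
  simp only [Linear.smul_comp, Linear.comp_smul, Preadditive.sub_comp, Preadditive.comp_add,
    Category.id_comp, Category.comp_id, hs]
  module

theorem cls_eq_add_of_invol (hs : s ≫ s = 𝟙 X) :
    cls X = idemClass ((1 / 2 : ℚ) • (𝟙 X + s)) + idemClass ((1 / 2 : ℚ) • (𝟙 X - s)) := by
  rw [← idemClass_add (invol_pos hs) (invol_neg hs) (invol_pos_neg hs) (invol_neg_pos hs),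
    ← idemClass_id]
  congr 1
  module

theorem idemClass_invol (hs : s ≫ s = 𝟙 X) :
    idemClass ((1 / 2 : ℚ) • (𝟙 X + s)) = (1 / 2 : ℚ) • (cls X + involTrace s) := by
  rw [involTrace, cls_eq_add_of_invol hs]
  module

theorem involTrace_id (X : C) : involTrace (𝟙 X) = cls X := by
  have h1 : (1 / 2 : ℚ) • (𝟙 X + 𝟙 X) = 𝟙 X := by module
  rw [involTrace, h1, sub_self, smul_zero, idemClass_id, idemClass_zero, sub_zero]

theorem involTrace_conj {Y : C} (r : X ≅ Y) (hs : s ≫ s = 𝟙 X) :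
    involTrace (r.inv ≫ s ≫ r.hom) = involTrace s := by
  rw [involTrace, involTrace, ← idemClass_conj r (invol_pos hs), ← idemClass_conj r (invol_neg hs)]
  simp

variable [MonoidalPreadditive C]

/-- Signs multiply: with `e, e'` and `f, f'` the projections to the eigenvalues `1` and `-1`,
biadditivity gives `e ⊗ f + e' ⊗ f'` as the positive projection of `s ⊗ t` and `e ⊗ f' + e' ⊗ f` as
the negative one. -/
theorem involTrace_tensor {Y : C} {t : Y ⟶ Y} (hs : s ≫ s = 𝟙 X) (ht : t ≫ t = 𝟙 Y) :
    involTrace (s ⊗ₘ t) = involTrace s * involTrace t := by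
  obtain ⟨e, he⟩ : ∃ e, e = (1 / 2 : ℚ) • (𝟙 X + s) := ⟨_, rfl⟩
  obtain ⟨e', he'⟩ : ∃ e, e = (1 / 2 : ℚ) • (𝟙 X - s) := ⟨_, rfl⟩
  obtain ⟨f, hf⟩ : ∃ e, e = (1 / 2 : ℚ) • (𝟙 Y + t) := ⟨_, rfl⟩
  obtain ⟨f', hf'⟩ : ∃ e, e = (1 / 2 : ℚ) • (𝟙 Y - t) := ⟨_, rfl⟩
  have e1 : e ≫ e = e := by rw [he, invol_pos hs]
  have e2 : e' ≫ e' = e' := by rw [he', invol_neg hs]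
  have e3 : e ≫ e' = 0 := by rw [he, he', invol_pos_neg hs]
  have e4 : e' ≫ e = 0 := by rw [he, he', invol_neg_pos hs]
  have f1 : f ≫ f = f := by rw [hf, invol_pos ht]
  have f2 : f' ≫ f' = f' := by rw [hf', invol_neg ht]
  have f3 : f ≫ f' = 0 := by rw [hf, hf', invol_pos_neg ht]
  have f4 : f' ≫ f = 0 := by rw [hf, hf', invol_neg_pos ht]
  have hX : 𝟙 X = e + e' := by rw [he, he']; module
  have hs' : s = e - e' := by rw [he, he']; module
  have hY : 𝟙 Y = f + f' := by rw [hf, hf']; module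
  have ht' : t = f - f' := by rw [hf, hf']; module
  have hneg : ∀ {A B A' B' : C} (g : A ⟶ B) (h : A' ⟶ B'), g ⊗ₘ (-h) = -(g ⊗ₘ h) := by
    intro A B A' B' g h
    rw [eq_neg_iff_add_eq_zero, ← MonoidalPreadditive.tensor_add, neg_add_cancel,
      MonoidalPreadditive.tensor_zero]
  have hneg' : ∀ {A B A' B' : C} (g : A ⟶ B) (h : A' ⟶ B'), (-g) ⊗ₘ h = -(g ⊗ₘ h) := by
    intro A B A' B' g h
    rw [eq_neg_iff_add_eq_zero, ← MonoidalPreadditive.add_tensor, neg_add_cancel,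
      MonoidalPreadditive.zero_tensor]
  have h1 : 𝟙 (X ⊗ Y) = (e ⊗ₘ f) + (e ⊗ₘ f') + ((e' ⊗ₘ f) + (e' ⊗ₘ f')) := by
    rw [← id_tensorHom_id, hX, hY, MonoidalPreadditive.add_tensor,
      MonoidalPreadditive.tensor_add, MonoidalPreadditive.tensor_add]
  have h2 : s ⊗ₘ t = (e ⊗ₘ f) - (e ⊗ₘ f') - ((e' ⊗ₘ f) - (e' ⊗ₘ f')) := by
    rw [hs', ht', sub_eq_add_neg, sub_eq_add_neg, MonoidalPreadditive.add_tensor,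
      MonoidalPreadditive.tensor_add, MonoidalPreadditive.tensor_add]
    simp only [hneg, hneg']
    abel
  have h3 : (1 / 2 : ℚ) • (𝟙 (X ⊗ Y) + (s ⊗ₘ t)) = (e ⊗ₘ f) + (e' ⊗ₘ f') := by
    rw [h1, h2]; module
  have h4 : (1 / 2 : ℚ) • (𝟙 (X ⊗ Y) - (s ⊗ₘ t)) = (e ⊗ₘ f') + (e' ⊗ₘ f) := by
    rw [h1, h2]; module
  have hz : ∀ {A : C} (g : X ⟶ A), g ⊗ₘ (0 : Y ⟶ Y) = 0 := fun g =>
    MonoidalPreadditive.tensor_zero g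
  rw [involTrace, h3, h4, involTrace, involTrace, ← he, ← he', ← hf, ← hf', idemClass_add,
    idemClass_add, idemClass_tensor e1 f1, idemClass_tensor e2 f2, idemClass_tensor e1 f2,
    idemClass_tensor e2 f1]
  · ring
  all_goals simp only [tensorHom_comp_tensorHom, e1, e2, e3, e4, f1, f2, f3, f4, hz]

end Invol

/-! ### Tensor products of lists -/

/-- The tensor product of a list of endomorphisms. -/
def tensorListMap {ι : Type} {X : ι → C} (f : ∀ i, X i ⟶ X i) :
    (l : List ι) → (tensorList X l ⟶ tensorList X l)
  | [] => 𝟙 (𝟙_ C)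
  | a :: l => f a ⊗ₘ tensorListMap f l

theorem tensorListMap_invol {ι : Type} {X : ι → C} {f : ∀ i, X i ⟶ X i}
    (hf : ∀ i, f i ≫ f i = 𝟙 (X i)) (l : List ι) :
    tensorListMap f l ≫ tensorListMap f l = 𝟙 (tensorList X l) := by
  induction l with
  | nil => exact Category.id_comp (𝟙 (𝟙_ C))
  | cons a l ih =>
    refine (tensorHom_comp_tensorHom _ _ _ _).trans ?_
    rw [hf, ih, id_tensorHom_id]
    rfl

theorem involTrace_tensorListMap [MonoidalPreadditive C] {ι : Type} {X : ι → C}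
    {f : ∀ i, X i ⟶ X i} (hf : ∀ i, f i ≫ f i = 𝟙 (X i)) (l : List ι) :
    involTrace (tensorListMap f l) = (l.map fun i => involTrace (f i)).prod := by
  induction l with
  | nil => exact (involTrace_id (𝟙_ C)).trans cls_unit
  | cons a l ih =>
    rw [List.map_cons, List.prod_cons, ← ih]
    exact involTrace_tensor (hf a) (tensorListMap_invol hf l)

/-- The reordering used in `graphFunctor` is an arbitrary choice. A list without repetitions admits
only one, so it may be replaced by the one that leaves every factor in place. -/
theorem reorder_hom_eq {ι : Type} {X : ι → C} (f : ∀ i, X i ⟶ X i) {l : List ι}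
    (h : l.Nodup) (r : Reorder (fun i : ι => i) l l) :
    r.hom (X := X) (Y := X) f = tensorListMap f l := by
  have hex : ∀ l : List ι, ∃ r : Reorder (fun i : ι => i) l l,
      r.hom (X := X) (Y := X) f = tensorListMap f l := by
    intro l
    induction l with
    | nil => exact ⟨.nil, rfl⟩
    | cons a l ih =>
      obtain ⟨r, hr⟩ := ih
      refine ⟨.cons a r (.here l), ?_⟩
      change (f a ⊗ₘ r.hom f) ≫ 𝟙 (X a ⊗ tensorList X l) = _
      rw [hr, Category.comp_id]
      rfl
  obtain ⟨r', hr'⟩ := hex l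
  rw [Reorder.subsingleton r r' h, hr']

/-! ### Colimits over finite groupoids -/

section Colimit

variable {J : Type} [SmallCategory J] [FinCategory J] (F : J ⥤ C)

/-- The average of the automorphisms of an object. -/
def average (x : J) : F.obj x ⟶ F.obj x :=
  ((Fintype.card (x ⟶ x) : ℚ)⁻¹) • ∑ σ : x ⟶ x, F.map σ

variable {F}

theorem smul_sum_const {X Y : C} {ι : Type*} [Fintype ι] [Nonempty ι] (f : X ⟶ Y) :
    ((Fintype.card ι : ℚ)⁻¹) • ∑ _ : ι, f = f := by
  have h : (Fintype.card ι : ℚ) ≠ 0 := by exact_mod_cast Fintype.card_ne_zero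
  rw [Finset.sum_const, Finset.card_univ, ← Nat.cast_smul_eq_nsmul ℚ, smul_smul,
    inv_mul_cancel₀ h, one_smul]

theorem average_comp {x : J} {Z : C} {f : F.obj x ⟶ Z} (h : ∀ σ : x ⟶ x, F.map σ ≫ f = f) :
    average F x ≫ f = f := by
  have : Nonempty (x ⟶ x) := ⟨𝟙 x⟩
  rw [average, Linear.smul_comp, Preadditive.sum_comp, Finset.sum_congr rfl fun σ _ => h σ,
    smul_sum_const]

theorem map_comp_average [IsGroupoid J] {x : J} (σ : x ⟶ x) :
    F.map σ ≫ average F x = average F x := by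
  rw [average, Linear.comp_smul, Preadditive.comp_sum]
  congr 1
  refine Fintype.sum_bijective (fun τ => σ ≫ τ) ⟨fun τ τ' h => ?_, fun τ => ⟨inv σ ≫ τ, ?_⟩⟩ _ _
    fun τ => (F.map_comp _ _).symm
  · exact (cancel_epi σ).1 h
  · exact IsIso.hom_inv_id_assoc σ τ

theorem average_idem [IsGroupoid J] (x : J) : average F x ≫ average F x = average F x :=
  average_comp map_comp_average

/-- The colimit over a finite groupoid is the sum of the coinvariants of the automorphism groups
over the connected components. -/
theorem cls_colimit [IsGroupoid J] {Q : Type*} [Fintype Q] {π : J → Q}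
    (hπ : ∀ x y, π x = π y ↔ Nonempty (x ⟶ y)) {r : Q → J} (hr : ∀ q, π (r q) = q) :
    cls (colimit F) = ∑ q, idemClass (average F (r q)) := by
  classical
  -- The projections of the colimit onto the parts belonging to the connected components; they are
  -- orthogonal idempotents with sum one.
  let E : Q → (colimit F ⟶ colimit F) := fun q => colimit.desc F
    { pt := colimit F
      ι :=
        { app := fun x => if π x = q then colimit.ι F x else 0
          naturality := fun x y f => by
            rw [(hπ x y).2 ⟨f⟩]
            split_ifs
            · exact (colimit.w F f).trans (Category.comp_id _).symm
            · simp } }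
  have hE : ∀ q x, colimit.ι F x ≫ E q = if π x = q then colimit.ι F x else 0 := fun q x =>
    colimit.ι_desc _ _
  have h1 : ∀ q, E q ≫ E q = E q := fun q => colimit.hom_ext fun x => by
    rw [reassoc_of% hE]
    split_ifs with h
    · rfl
    · rw [hE, if_neg h, zero_comp]
  have h2 : ∀ q q', q ≠ q' → E q ≫ E q' = 0 := fun q q' hq => colimit.hom_ext fun x => by
    rw [reassoc_of% hE, comp_zero]
    split_ifs with h
    · rw [hE, if_neg fun h' => hq (h.symm.trans h')]
    · rw [zero_comp]
  have h3 : ∑ q, E q = 𝟙 (colimit F) := colimit.hom_ext fun x => by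
    rw [Preadditive.comp_sum, Finset.sum_congr rfl fun q _ => hE q x, Finset.sum_ite_eq,
      if_pos (Finset.mem_univ _), Category.comp_id]
  rw [← idemClass_id, ← h3, idemClass_sum _ _ h1 h2]
  refine Finset.sum_congr rfl fun q _ => ?_
  obtain ⟨P, p, i, hip, hpi⟩ := exists_split (average_idem (F := F) (r q))
  have hp : ∀ σ : r q ⟶ r q, F.map σ ≫ p = p := fun σ => by
    have h4 : F.map σ ≫ (p ≫ i) ≫ p = (p ≫ i) ≫ p := by
      rw [hpi, ← Category.assoc, map_comp_average]
    simpa [hip] using h4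
  have γ : ∀ x, π x = q → (x ⟶ r q) := fun x hx =>
    ((hπ x (r q)).1 (hx.trans (hr q).symm)).some
  -- After composing with `p`, which absorbs automorphisms of `r q`, the choice of the morphism to
  -- the representative is immaterial.
  have hγ : ∀ {x y : J} (f : x ⟶ y) (g : y ⟶ r q) (h : x ⟶ r q),
      F.map f ≫ F.map g ≫ p = F.map h ≫ p := by
    intro x y f g h
    have h5 := hp (inv h ≫ f ≫ g)
    rw [F.map_comp, F.map_comp, F.map_inv, Category.assoc, IsIso.inv_comp_eq, Category.assoc] at h5
    exact h5
  -- Other components are sent to zero, and `q` is transported to its representative. Thus `P`, the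
  -- image of the average, also splits `E q`.
  let M : colimit F ⟶ P := colimit.desc F
    { pt := P
      ι :=
        { app := fun x => if h : π x = q then F.map (γ x h) ≫ p else 0
          naturality := fun x y f => by
            have hxy := (hπ x y).2 ⟨f⟩
            by_cases h : π y = q
            · rw [dif_pos h, dif_pos (hxy.trans h)]
              exact (hγ f _ _).trans (Category.comp_id _).symm
            · rw [dif_neg h, dif_neg fun h' => h (hxy.symm.trans h')]
              simp } }
  have hM : ∀ x (h : π x = q), colimit.ι F x ≫ M = F.map (γ x h) ≫ p := fun x h =>
    (colimit.ι_desc _ _).trans (dif_pos h)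
  have hM' : ∀ x (_ : π x ≠ q), colimit.ι F x ≫ M = 0 := fun x h =>
    (colimit.ι_desc _ _).trans (dif_neg h)
  rw [idemClass_eq_cls hip hpi]
  refine idemClass_eq_cls (p := M) (i := i ≫ colimit.ι F (r q)) ?_ ?_
  · rw [Category.assoc, hM _ (hr q), hp, hip]
  · refine colimit.hom_ext fun x => ?_
    rw [hE]
    split_ifs with h
    · rw [reassoc_of% (hM x h), reassoc_of% hpi, average_comp fun σ => colimit.w F σ, colimit.w]
    · rw [reassoc_of% (hM' x h), zero_comp]

end Colimit

end Classes

/-! ### The class of the free modular operad in genus one -/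

section Free

open GenusOneGraph

variable {C : Type u} [Category.{v} C]

namespace GenusOneGraph

variable {n : ℕ}

theorem ofHom_comp {G H K : StableGraph 1 n} (p : G ⟶ H) (q : H ⟶ K) :
    ofHom (p ≫ q) = (ofHom p).trans (ofHom q) :=
  Iso.ext_apply (fun _ => rfl) fun _ => rfl

theorem ofHom_id (G : StableGraph 1 n) : ofHom (𝟙 G) = Iso.refl (ofStable G) :=
  Iso.ext_apply (fun _ => rfl) fun _ => rfl

end GenusOneGraph

instance isGroupoid_stableGraph {n : ℕ} : IsGroupoid (StableGraph 1 n) where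
  all_isIso {G H} p := by
    have h : ofHom ((homEquivIso H G).symm (ofHom p).symm) = (ofHom p).symm :=
      (homEquivIso H G).apply_symm_apply _
    refine ⟨(homEquivIso H G).symm (ofHom p).symm, ofHom_injective ?_, ofHom_injective ?_⟩
    · rw [ofHom_comp, h, ofHom_id]
      exact Iso.ext_apply (fun _ => (ofHom p).vert.symm_apply_apply _)
        fun _ => (ofHom p).flag.symm_apply_apply _
    · rw [ofHom_comp, h, ofHom_id]
      exact Iso.ext_apply (fun _ => (ofHom p).vert.apply_symm_apply _)
        fun _ => (ofHom p).flag.apply_symm_apply _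

theorem StableSModule.map_rfl (V : StableSModule C) {g m : ℕ} (h : g = g)
    (e : Equiv.Perm (Fin m)) : V.map h e = (V g m).ρ e := by
  have h' : (finCongr (rfl : m = m)).symm.trans e = e := by ext; rfl
  simp only [StableSModule.map, eqToHom_refl, Category.id_comp]
  rw [h']

theorem ρ_comp_self {m : ℕ} (W : Action C (Equiv.Perm (Fin m))) {σ : Equiv.Perm (Fin m)}
    (h : σ * σ = 1) : W.ρ σ ≫ W.ρ σ = 𝟙 W.V :=
  ((W.ρ.map_mul σ σ).symm.trans (congrArg W.ρ h)).trans (Action.ρ_one W)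

/-- The action of a permutation, as an isomorphism. -/
def ρIso {m : ℕ} (W : Action C (Equiv.Perm (Fin m))) (σ : Equiv.Perm (Fin m)) : W.V ≅ W.V where
  hom := W.ρ σ
  inv := W.ρ σ⁻¹
  hom_inv_id := ((W.ρ.map_mul σ⁻¹ σ).symm.trans (congrArg W.ρ (inv_mul_cancel σ))).trans
    (Action.ρ_one W)
  inv_hom_id := ((W.ρ.map_mul σ σ⁻¹).symm.trans (congrArg W.ρ (mul_inv_cancel σ))).trans
    (Action.ρ_one W)

variable [MonoidalCategory C] [SymmetricCategory C]

variable [Preadditive C] [HasBinaryBiproducts C] [HasFiniteColimits C] [Linear ℚ C]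

/-- If all vertices are fixed, the flag bijections become genuine permutations and the symmetry of
the tensor product does not intervene. -/
theorem graphFunctor_map_eq (V : StableSModule C) {g n : ℕ} {G : StableGraph g n} (p : G ⟶ G)
    (hp : ∀ v, StableGraph.Hom.vert p v = v) :
    ∃ f : ∀ v, Equiv.Perm (Fin (G.val v)),
      (∀ v i, (⟨StableGraph.Hom.vert p v, StableGraph.Hom.flag p v i⟩ : G.Flag) = ⟨v, f v i⟩) ∧
      (graphFunctor V g n).map p =
        tensorListMap (X := fun v => (V (G.genus v) (G.val v)).V)
          (fun v => (V (G.genus v) (G.val v)).ρ (f v)) (List.finRange G.numVert) := by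
  obtain ⟨vert, flag, h1, h2, h3⟩ := p
  obtain rfl : vert = Equiv.refl _ := Equiv.ext hp
  refine ⟨flag, fun v i => rfl, ?_⟩
  have hf : (fun v => (V (G.genus v) (G.val v)).ρ (flag v)) = fun v => V.map (h1 v) (flag v) :=
    funext fun v => (V.map_rfl _ _).symm
  rw [hf]
  exact reorder_hom_eq (X := fun v => (V (G.genus v) (G.val v)).V)
    (fun v => V.map (h1 v) (flag v)) (List.nodup_finRange _) _

theorem involTrace_isConj {m : ℕ} (W : Action C (Equiv.Perm (Fin m))) {σ τ : Equiv.Perm (Fin m)}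
    (h : IsConj σ τ) (hσ : σ * σ = 1) : involTrace (W.ρ σ) = involTrace (W.ρ τ) := by
  obtain ⟨c, hc⟩ := isConj_iff.1 h
  have h1 : W.ρ τ = (ρIso W c).inv ≫ W.ρ σ ≫ (ρIso W c).hom := by
    rw [← hc]
    exact (W.ρ.map_mul (c * σ) c⁻¹).trans
      (congrArg (fun x : W.V ⟶ W.V => W.ρ c⁻¹ ≫ x) (W.ρ.map_mul c σ))
  rw [h1, involTrace_conj _ (ρ_comp_self W hσ)]

open Classical in
/-- The trace of a transposition. -/
def swapTrace {m : ℕ} (W : Action C (Equiv.Perm (Fin m))) : K0Rat C :=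
  if h : ∃ τ : Equiv.Perm (Fin m), τ.IsSwap then involTrace (W.ρ h.choose) else 0

theorem _root_.Equiv.Perm.IsSwap.mul_self {α : Type*} [DecidableEq α] {σ : Equiv.Perm α}
    (h : σ.IsSwap) : σ * σ = 1 := by
  obtain ⟨x, y, -, rfl⟩ := h
  exact Equiv.swap_mul_self x y

theorem involTrace_swap {m : ℕ} (W : Action C (Equiv.Perm (Fin m))) {σ : Equiv.Perm (Fin m)}
    (h : σ.IsSwap) : involTrace (W.ρ σ) = swapTrace W := by
  have hex : ∃ τ : Equiv.Perm (Fin m), τ.IsSwap := ⟨σ, h⟩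
  rw [swapTrace, dif_pos hex]
  refine involTrace_isConj W ?_ h.mul_self
  obtain ⟨x, y, hxy, h1⟩ := h
  obtain ⟨x', y', hxy', h2⟩ := hex.choose_spec
  rw [h1, h2]
  exact Equiv.Perm.isConj_swap hxy hxy'

/-- With at most one nontrivial automorphism `p`, the average is the identity or half of `1 + F.map
p`, and in the latter case `idemClass_invol` expresses the class by traces. -/
theorem idemClass_average {J : Type} [SmallCategory J] [FinCategory J] {F : J ⥤ C} {x : J}
    (h : ∀ p q : x ⟶ x, p ≠ 𝟙 x → q ≠ 𝟙 x → p = q)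
    (hF : ∀ p : x ⟶ x, F.map p ≫ F.map p = 𝟙 (F.obj x)) :
    idemClass (average F x) =
      ((Fintype.card (x ⟶ x) : ℚ)⁻¹) • ∑ p : x ⟶ x, involTrace (F.map p) := by
  classical
  rw [average]
  by_cases hp : ∃ p : x ⟶ x, p ≠ 𝟙 x
  · obtain ⟨p, hp⟩ := hp
    have hu : (Finset.univ : Finset (x ⟶ x)) = {𝟙 x, p} := by
      ext q
      simp only [Finset.mem_univ, Finset.mem_insert, Finset.mem_singleton, true_iff]
      exact or_iff_not_imp_left.2 fun hq => h q p hq hp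
    have hc : (Fintype.card (x ⟶ x) : ℚ)⁻¹ = 1 / 2 := by
      rw [← Finset.card_univ, hu, Finset.card_pair hp.symm]
      norm_num
    rw [hc, hu, Finset.sum_pair hp.symm, Finset.sum_pair hp.symm, F.map_id, involTrace_id,
      idemClass_invol (hF p)]
  · push Not at hp
    have : Unique (x ⟶ x) := ⟨⟨𝟙 x⟩, hp⟩
    have hc : (Fintype.card (x ⟶ x) : ℚ)⁻¹ = 1 := by
      rw [Fintype.card_eq_one_iff.2 ⟨𝟙 x, hp⟩]
      norm_num
    rw [hc, Fintype.sum_eq_single (𝟙 x) fun p hp' => absurd (hp p) hp',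
      Fintype.sum_eq_single (𝟙 x) fun p hp' => absurd (hp p) hp', F.map_id, involTrace_id, one_smul, one_smul, idemClass_id]

variable [MonoidalPreadditive C] (V : StableSModule C) {n : ℕ}

/-- By `hasSimpleAut` the automorphism acts factor by factor, by the identity or a transposition at
each vertex, so its trace is multiplicative over the vertices. -/
theorem involTrace_graphFunctor {G : StableGraph 1 n} (p : G ⟶ G) :
    (graphFunctor V 1 n).map p ≫ (graphFunctor V 1 n).map p = 𝟙 _ ∧
    involTrace ((graphFunctor V 1 n).map p) =
      ∏ v, localWeight (fun g m => cls (V g m).V) (fun g m => swapTrace (V g m))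
        (ofStable G) (ofHom p) v := by
  have hS := hasSimpleAut (ofStable G)
  obtain ⟨f, hf, hmap⟩ := graphFunctor_map_eq V p fun v => (hS.1 (ofHom p) v).1
  have hf' : ∀ v i, (ofHom p).flag (⟨v, i⟩ : G.Flag) = (⟨v, f v i⟩ : G.Flag) := hf
  have hinj : ∀ (v : Fin G.numVert) (i j : Fin (G.val v)),
      (⟨v, i⟩ : G.Flag) = ⟨v, j⟩ → i = j := fun v i j h => eq_of_heq (Sigma.mk.inj h).2
  have hiff : ∀ v, (∀ x : G.Flag, x.1 = v → (ofHom p).flag x = x) ↔ f v = 1 := fun v => by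
    refine ⟨fun h => Equiv.ext fun i => hinj v _ _ ((hf' v i).symm.trans (h ⟨v, i⟩ rfl)), ?_⟩
    rintro h ⟨w, i⟩ rfl
    rw [hf', h]
    rfl
  have hsw : ∀ v, f v = 1 ∨ (f v).IsSwap := fun v => by
    rcases (hS.1 (ofHom p) v).2 with h | ⟨⟨v₁, x⟩, ⟨v₂, y⟩, hxy, hx, hy, h1, h2, h3⟩
    · exact Or.inl ((hiff v).1 h)
    · obtain rfl : v₁ = v := hx
      obtain rfl : v₂ = v₁ := hy
      rw [hf'] at h1 h2
      right
      refine ⟨x, y, fun h => hxy (by rw [h]), Equiv.ext fun i => ?_⟩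
      by_cases hix : i = x
      · rw [hix, Equiv.swap_apply_left]
        exact hinj _ _ _ h1
      · by_cases hiy : i = y
        · rw [hiy, Equiv.swap_apply_right]
          exact hinj _ _ _ h2
        · rw [Equiv.swap_apply_of_ne_of_ne hix hiy]
          exact hinj _ _ _ ((hf' _ i).symm.trans (h3 ⟨v₂, i⟩ rfl
            (fun h => hix (hinj _ _ _ h)) fun h => hiy (hinj _ _ _ h)))
  have hsq : ∀ v, f v * f v = 1 := fun v => by
    rcases hsw v with h | h
    · rw [h, one_mul]
    · exact h.mul_self
  rw [hmap]
  refine ⟨tensorListMap_invol (fun v => ρ_comp_self _ (hsq v)) _, ?_⟩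
  refine (involTrace_tensorListMap (X := fun v => (V (G.genus v) (G.val v)).V)
    (fun v => ρ_comp_self _ (hsq v)) _).trans ?_
  refine (Fin.prod_univ_def fun v => involTrace ((V (G.genus v) (G.val v)).ρ (f v))).symm.trans (Finset.prod_congr rfl fun v _ => ?_)
  have hval : (ofStable G).valence v = G.val v := valence_ofStable G v
  by_cases h : f v = 1
  · refine Eq.trans ?_ (if_pos ((hiff v).2 h)).symm
    rw [h]
    exact ((congrArg _ (Action.ρ_one _)).trans (involTrace_id _)).trans
      (congrArg (fun m => cls (V (G.genus v) m).V) hval.symm)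
  · refine Eq.trans ?_ (if_neg fun h' => h ((hiff v).1 h')).symm
    exact (involTrace_swap _ ((hsw v).resolve_left h)).trans
      (congrArg (fun m => swapTrace (V (G.genus v) m)) hval.symm)

theorem idemClass_average_graphFunctor (G : StableGraph 1 n) :
    idemClass (average (graphFunctor V 1 n) G) =
      weight (fun g m => cls (V g m).V) (fun g m => swapTrace (V g m)) (ofStable G) := by
  rw [idemClass_average (fun p q hp hq => ?_) fun p => (involTrace_graphFunctor V p).1, weight,
    autWeight, ← Nat.card_eq_fintype_card, Nat.card_congr (homEquivIso G G)]
  · congr 1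
    exact Fintype.sum_equiv (homEquivIso G G) _ _ fun p => (involTrace_graphFunctor V p).2
  · refine ofHom_injective ((hasSimpleAut (ofStable G)).2 _ _ ?_ ?_) <;>
    · rw [← ofHom_id]
      exact ofHom_injective.ne ‹_›

/-- The connected components of the groupoid are the isomorphism classes of graphs, and the
coinvariants at each one have as class its weight. -/
theorem cls_free : cls (free V 1 n).V =
    totalWeight (fun g m => cls (V g m).V) (fun g m => swapTrace (V g m)) n := by
  have hr := Function.surjInv_eq (ofStable_surjective (n := n))
  have h := cls_colimit (F := graphFunctor V 1 n)
    (π := fun G => (⟦ofStable G⟧ : Classes (Fin n)))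
    (fun G H => Quotient.eq.trans (homEquivIso G H).nonempty_congr.symm) hr
  refine h.trans (Finset.sum_congr rfl fun q _ => ?_)
  rw [idemClass_average_graphFunctor]
  exact congrArg (classWeight _ _) (hr q)

end Free

section

open GenusOneGraph

variable {R : Type*} [CommRing R] [Algebra ℚ R] (a t : ℕ → ℕ → R)

/-- Without legs, `genus_eq` makes twice the genera plus the flags equal to `2 #V`, while stability
requires at least `3 #V`. This agrees with the omission of `n = 0` from the generating function in
genus one. -/
theorem totalWeight_zero : totalWeight a t 0 = 0 := by
  have : IsEmpty (GenusOneGraph.Classes (Fin 0)) := ⟨fun q => Quotient.inductionOn q fun G => by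
    classical
    have h1 := G.genus_eq
    have h2 : 3 * Fintype.card G.V ≤ 2 * ∑ v, G.genus v + ∑ v, G.valence v := by
      rw [Finset.mul_sum, ← Finset.sum_add_distrib]
      calc 3 * Fintype.card G.V = ∑ _ : G.V, 3 := by simp [mul_comm]
        _ ≤ _ := Finset.sum_le_sum fun v _ => G.stable v
    have h3 : ∑ v, G.valence v = Fintype.card G.F := by
      simp only [GenusOneGraph.valence, Nat.card_eq_fintype_card]
      rw [← Fintype.card_sigma, Fintype.card_congr (Equiv.sigmaFiberEquiv G.vtx)]
    have h4 : 0 < Fintype.card G.V := Fintype.card_pos_iff.2 G.nonempty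
    simp only [Fintype.card_fin] at h1
    omega⟩
  exact Finset.sum_eq_zero fun q _ => isEmptyElim q

end

/-! ### Traces and coefficients of the characteristic -/

section Trace

variable {C : Type u} [Category.{v} C] [Preadditive C] [HasBinaryBiproducts C]
  [MonoidalCategory C] [SymmetricCategory C] [HasFiniteColimits C] [Linear ℚ C]

theorem cls_cokernel_smul {X Y : C} (f : X ⟶ Y) {c : ℚ} (hc : c ≠ 0) :
    cls (cokernel (c • f)) = cls (cokernel f) := by
  have h1 : (c • f) ≫ cokernel.π f = 0 := by
    rw [Linear.smul_comp, cokernel.condition, smul_zero]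
  have h2 : f ≫ cokernel.π (c • f) = 0 := by
    have h := cokernel.condition (c • f)
    rw [Linear.smul_comp] at h
    have h' := congrArg (fun g => c⁻¹ • g) h
    simpa [smul_smul, inv_mul_cancel₀ hc] using h'
  refine cls_congr ⟨cokernel.desc _ _ h1, cokernel.desc _ _ h2, ?_, ?_⟩
  · rw [← cancel_epi (cokernel.π (c • f)), cokernel.π_desc_assoc, cokernel.π_desc,
      Category.comp_id]
  · rw [← cancel_epi (cokernel.π f), cokernel.π_desc_assoc, cokernel.π_desc, Category.comp_id]

variable {n : ℕ} (W : Action C (Equiv.Perm (Fin n))) (σ : Equiv.Perm (Fin n))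

/-- Here `Φ₁(s) = s - 1` is a nonzero multiple of `1 - (1 + s) / 2`, and such a scalar does not
affect the cokernel. -/
theorem cls_cyclotomicPart_one {s : W.V ⟶ W.V} (hs : W.ρ σ = s) :
    cls (cyclotomicPart W σ 1) = idemClass ((1 / 2 : ℚ) • (𝟙 W.V + s)) := by
  have h : (Polynomial.aeval (R := ℚ) (A := End W.V) (W.ρ σ) (Polynomial.cyclotomic 1 ℚ) :
      W.V ⟶ W.V) = (-2 : ℚ) • (𝟙 W.V - (1 / 2 : ℚ) • (𝟙 W.V + s)) := by
    rw [Polynomial.cyclotomic_one, map_sub, Polynomial.aeval_X, map_one, hs]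
    change s - 𝟙 W.V = _
    module
  rw [idemClass, ← cls_cokernel_smul _ (show (-2 : ℚ) ≠ 0 by norm_num), ← h, cyclotomicPart]

theorem cls_cyclotomicPart_two {s : W.V ⟶ W.V} (hs : W.ρ σ = s) :
    cls (cyclotomicPart W σ 2) = idemClass ((1 / 2 : ℚ) • (𝟙 W.V - s)) := by
  have h : (Polynomial.aeval (R := ℚ) (A := End W.V) (W.ρ σ) (Polynomial.cyclotomic 2 ℚ) :
      W.V ⟶ W.V) = (2 : ℚ) • (𝟙 W.V - (1 / 2 : ℚ) • (𝟙 W.V - s)) := by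
    rw [Polynomial.cyclotomic_two, map_add, Polynomial.aeval_X, map_one, hs]
    change s + 𝟙 W.V = _
    module
  rw [idemClass, ← cls_cokernel_smul _ (show (2 : ℚ) ≠ 0 by norm_num), ← h, cyclotomicPart]

theorem trace_one : trace W 1 = cls W.V := by
  have h1 : (1 / 2 : ℚ) • (𝟙 W.V + 𝟙 W.V) = 𝟙 W.V := by module
  rw [trace, orderOf_one, Nat.divisors_one, Finset.sum_singleton, cls_cyclotomicPart_one W 1 (Action.ρ_one W), h1,
    idemClass_id]
  simp

theorem trace_swap {σ : Equiv.Perm (Fin n)} (h : σ.IsSwap) : trace W σ = swapTrace W := by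
  -- For an element of order two only `d = 1, 2` occur, with coefficients `μ(d) / φ(d)` equal to `1`
  -- and `-1`.
  rw [trace, h.orderOf, Nat.prime_two.divisors, Finset.sum_pair (by norm_num),
    cls_cyclotomicPart_one W σ rfl, cls_cyclotomicPart_two W σ rfl, ← involTrace_swap W h, involTrace,
    ArithmeticFunction.moebius_apply_prime Nat.prime_two]
  simp [sub_eq_add_neg]

variable (C) in
theorem powerSum_eq : powerSum C σ =
    MvPowerSeries.monomial (Multiset.toFinsupp (σ.partition.parts.map Nat.toPNat')) 1 := by
  rw [powerSum]
  induction σ.partition.parts using Multiset.induction_on with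
  | empty => simp
  | cons k s ih =>
    rw [Multiset.map_cons, Multiset.prod_cons, ih, Multiset.map_cons, ← Multiset.singleton_add,
      map_add, Multiset.toFinsupp_singleton, MvPowerSeries.X, MvPowerSeries.monomial_mul_monomial,
      one_mul]

variable (C) in
theorem coeff_powerSum (s : Multiset ℕ+) : MvPowerSeries.coeff (Multiset.toFinsupp s)
    (powerSum C σ) = if σ.partition.parts = s.map PNat.val then 1 else 0 := by
  classical
  rw [powerSum_eq, MvPowerSeries.coeff_monomial]
  refine if_congr ?_ rfl rfl
  rw [Multiset.toFinsupp.injective.eq_iff]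
  constructor
  · rintro rfl
    rw [Multiset.map_map]
    refine (Multiset.map_id _).symm.trans (Multiset.map_congr rfl fun k hk => ?_)
    exact (PNat.toPNat'_coe (σ.partition.parts_pos hk)).symm
  · intro h
    rw [h, Multiset.map_map]
    exact ((Multiset.map_congr rfl fun k _ => PNat.coe_toPNat' k).trans (Multiset.map_id _)).symm

theorem coeff_ch (m : ℕ+ →₀ ℕ) : MvPowerSeries.coeff m (ch W) =
    ((n ! : ℚ)⁻¹) • ∑ σ, trace W σ * MvPowerSeries.coeff m (powerSum C σ) := by
  have h : ∀ (c : ℚ) (f : SymFun C), MvPowerSeries.coeff m (c • f) =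
    c • MvPowerSeries.coeff m f := fun c f => rfl
  rw [ch, h, map_sum]
  simp only [MvPowerSeries.coeff_C_mul]

/-- The parts of `σ.partition` are the cycle lengths together with a `1` for each fixed point. -/
theorem parts_partition_eq_iff {c : Multiset ℕ} (hc : ∀ k ∈ c, 2 ≤ k) {k : ℕ}
    (hk : c.sum + k = n) :
    σ.partition.parts = c + Multiset.replicate k 1 ↔ σ.cycleType = c := by
  constructor
  · intro h
    rw [← Equiv.Perm.filter_parts_partition_eq_cycleType, h, Multiset.filter_add,
      Multiset.filter_eq_self.2 hc, Multiset.filter_eq_nil.2 fun a h => ?_, add_zero]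
    rw [Multiset.eq_of_mem_replicate h]
    decide
  · rintro rfl
    rw [Equiv.Perm.parts_partition, ← Equiv.Perm.sum_cycleType, Fintype.card_fin]
    congr 2
    omega

theorem toFinsupp_replicate {α : Type*} [DecidableEq α] (x : α) (k : ℕ) :
    Multiset.toFinsupp (Multiset.replicate k x) = Finsupp.single x k := by
  rw [← Multiset.nsmul_singleton, map_nsmul, Multiset.toFinsupp_singleton, Finsupp.smul_single,
    nsmul_one, Nat.cast_id]

theorem coeff_single_ch : MvPowerSeries.coeff (Finsupp.single 1 n) (ch W) =
    ((n ! : ℚ)⁻¹) • cls W.V := by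
  classical
  have h : ∀ σ : Equiv.Perm (Fin n),
      trace W σ * MvPowerSeries.coeff (Finsupp.single 1 n) (powerSum C σ) =
        if σ = 1 then cls W.V else 0 := fun σ => by
    have h1 : σ.partition.parts = Multiset.replicate n 1 ↔ σ = 1 := by
      rw [← Equiv.Perm.cycleType_eq_zero, ← parts_partition_eq_iff σ (by simp) (k := n) (by simp),
        zero_add]
    rw [← toFinsupp_replicate, coeff_powerSum, Multiset.map_replicate, PNat.val_ofNat,
      if_congr h1 rfl rfl]
    split_ifs with h2
    · rw [h2, trace_one]
      exact mul_one (M := K0Rat C) _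
    · exact mul_zero (M₀ := K0Rat C) _
  rw [coeff_ch, Finset.sum_congr rfl fun σ _ => h σ, Finset.sum_ite_eq',
    if_pos (Finset.mem_univ _)]

/-- The permutations with `p_σ = p_1 ^ n p_2` are the transpositions. They all have the same trace,
and their number divided by `(n + 2)!` is `1 / (2 n!)`. -/
theorem coeff_single_add_single_ch {n : ℕ} (W : Action C (Equiv.Perm (Fin (n + 2)))) :
    MvPowerSeries.coeff (Finsupp.single 1 n + Finsupp.single 2 1) (ch W) =
      ((1 / 2 : ℚ) * (n ! : ℚ)⁻¹) • swapTrace W := by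
  classical
  have h : ∀ σ : Equiv.Perm (Fin (n + 2)),
      trace W σ * MvPowerSeries.coeff (Finsupp.single 1 n + Finsupp.single 2 1) (powerSum C σ) =
      if σ.cycleType = {2} then swapTrace W else 0 := fun σ => by
    have h1 : σ.partition.parts = Multiset.replicate n 1 + {2} ↔ σ.cycleType = {2} := by
      rw [← parts_partition_eq_iff σ (by simp) (k := n) (by simp [add_comm]),
        add_comm (Multiset.replicate n 1)]
    rw [← toFinsupp_replicate, ← toFinsupp_replicate, ← map_add, coeff_powerSum, Multiset.map_add,
      Multiset.map_replicate, Multiset.map_replicate, PNat.val_ofNat, PNat.val_ofNat,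
      Multiset.replicate_one, if_congr h1 rfl rfl]
    split_ifs with h2
    · rw [trace_swap W (Equiv.Perm.isSwap_iff_cycleType.2 h2)]
      exact mul_one (M := K0Rat C) _
    · exact mul_zero (M₀ := K0Rat C) _
  rw [coeff_ch, Finset.sum_congr rfl fun σ _ => h σ, ← Finset.sum_filter, Finset.sum_const,
    Equiv.Perm.card_of_cycleType_singleton le_rfl (by simp), Fintype.card_fin,
    ← Nat.cast_smul_eq_nsmul ℚ, smul_smul]
  congr 1
  have h1 : ((n ! : ℕ) : ℚ) ≠ 0 := by exact_mod_cast n.factorial_ne_zero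
  have h2 : (((n + 2).choose 2 : ℕ) : ℚ) * 2 * (n ! : ℚ) = ((n + 2)! : ℕ) := by
    have := Nat.choose_mul_factorial_mul_factorial (show 2 ≤ n + 2 by omega)
    simpa using congrArg (Nat.cast (R := ℚ)) this
  have h3 : (((n + 2)! : ℕ) : ℚ) ≠ 0 := by exact_mod_cast (n + 2).factorial_ne_zero
  rw [show (2 - 1)! = 1 from rfl, one_mul]
  field_simp
  linarith

theorem symDegree_single (i : ℕ+) (e : ℕ) : symDegree (Finsupp.single i e) = i * e :=
  Finsupp.sum_single_index (mul_zero _)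

theorem symDegree_add (m m' : ℕ+ →₀ ℕ) : symDegree (m + m') = symDegree m + symDegree m' :=
  Finsupp.sum_add_index' (fun _ => mul_zero _) fun _ _ _ => mul_add _ _ _

theorem coeff_rk_genFun (V : StableSModule C) (g n : ℕ) :
    PowerSeries.coeff n (rk (genFun V g)) =
      if 2 < 2 * g + n then ((n ! : ℚ)⁻¹) • cls (V g n).V else 0 := by
  rw [rk, PowerSeries.coeff_mk]
  change (if 2 < 2 * g + symDegree (Finsupp.single 1 n) then MvPowerSeries.coeff
    (Finsupp.single 1 n) (ch (V g (symDegree (Finsupp.single 1 n)))) else 0) = _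
  have h : symDegree (Finsupp.single 1 n) = n := by rw [symDegree_single, PNat.one_coe, one_mul]
  rw [h, coeff_single_ch]

theorem coeff_rk_pderiv_genFun (V : StableSModule C) (n : ℕ) :
    PowerSeries.coeff n (rk (MvPowerSeries.pderiv (K0Rat C) 2 (genFun V 0))) =
      if 1 ≤ n then ((1 / 2 : ℚ) * (n ! : ℚ)⁻¹) • swapTrace (V 0 (n + 2)) else 0 := by
  -- The factor produced by `∂/∂p_2` is the exponent of `p_2`, which is one.
  rw [rk, PowerSeries.coeff_mk, MvPowerSeries.coeff_pderiv,
    Finsupp.single_eq_of_ne (by decide), Nat.cast_zero, zero_add, mul_one]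
  have h : symDegree (Finsupp.single 1 n + Finsupp.single 2 1) = n + 2 := by
    rw [symDegree_add, symDegree_single, symDegree_single, PNat.one_coe, one_mul]
    rfl
  change (if 2 < 2 * 0 + symDegree (Finsupp.single 1 n + Finsupp.single 2 1) then
    MvPowerSeries.coeff (Finsupp.single 1 n + Finsupp.single 2 1)
      (ch (V 0 (symDegree (Finsupp.single 1 n + Finsupp.single 2 1)))) else 0) = _
  rw [h, coeff_single_add_single_ch]
  -- In genus zero, stability in degree `n + 2` means `1 ≤ n`.
  exact if_congr (by omega) rfl rfl

end Trace

/-! ### The generating functions -/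

theorem eq_egf {R : Type*} [CommRing R] [Algebra ℚ R] {f : PowerSeries R} {c : ℕ → R}
    (h : ∀ n, PowerSeries.coeff n f = (n ! : ℚ)⁻¹ • c n) : f = egf c :=
  PowerSeries.ext fun n => (h n).trans (coeff_egf c n).symm

theorem derivative_eq_egf {R : Type*} [CommRing R] [Algebra ℚ R] {f : PowerSeries R} {c d : ℕ → R}
    (h : ∀ n, PowerSeries.coeff n f = (n ! : ℚ)⁻¹ • c n) (hd : ∀ n, c (n + 1) = d n) :
    PowerSeries.derivative R f = egf d := by
  rw [eq_egf h, derivative_egf, funext hd]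

open GenusOneGraph in
theorem hasSubst_and_subst_eq {R : Type*} [CommRing R] [Algebra ℚ R] {a t : ℕ → ℕ → R}
    {f₀ f₁ f d : PowerSeries R} (h₀ : PowerSeries.derivative R f₀ = egf (endWeight a))
    (h₁ : f₁ = egf fun n => if 1 ≤ n then a 1 n else 0) (h : f = egf (totalWeight a t))
    (hd : d = (1 / 2 : ℚ) • egf fun m => if 1 ≤ m then t 0 (m + 2) else 0) :
    PowerSeries.HasSubst (PowerSeries.X - PowerSeries.derivative R f₀) ∧
    PowerSeries.subst (PowerSeries.X - PowerSeries.derivative R f₀) f =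
      f₁ - (1 / 2 : ℚ) • PowerSeries.logOf (1 - PowerSeries.derivative R
        (PowerSeries.derivative R f₀)) + d * (d + 1) := by
  rw [h₀, h₁, h, hd]
  refine ⟨PowerSeries.HasSubst.of_constantCoeff_zero' ?_, subst_totalWeight _ _⟩
  rw [map_sub, PowerSeries.constantCoeff_X, constantCoeff_egf, endWeight, if_neg (by norm_num),
    sub_zero]

section GenFun

open GenusOneGraph

variable {C : Type u} [Category.{v} C] [Preadditive C] [HasBinaryBiproducts C]
  [MonoidalCategory C] [SymmetricCategory C] [HasFiniteColimits C] [Linear ℚ C]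
  (V : StableSModule C)

theorem derivative_rk_genFun_zero :
    PowerSeries.derivative (K0Rat C) (rk (genFun V 0)) =
      egf (endWeight fun g m => cls (V g m).V) :=
  derivative_eq_egf (c := fun n => if 2 < n then cls (V 0 n).V else 0)
    (fun n => (coeff_rk_genFun V 0 n).trans <| by
      rw [mul_zero, zero_add]
      split_ifs
      · rfl
      · exact (smul_zero _).symm)
    fun n => by
      rw [endWeight]
      exact if_congr (by omega) rfl rfl

theorem rk_genFun_one :
    rk (genFun V 1) = egf fun n => if 1 ≤ n then cls (V 1 n).V else 0 :=
  eq_egf fun n => (coeff_rk_genFun V 1 n).trans <| by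
    by_cases h : 1 ≤ n
    · rw [if_pos h, if_pos (by omega)]
    · rw [if_neg h, if_neg (by omega), smul_zero]

theorem rk_genFun_free_one [MonoidalPreadditive C] : rk (genFun (free V) 1) =
    egf (totalWeight (fun g m => cls (V g m).V) fun g m => swapTrace (V g m)) :=
  eq_egf fun n => (coeff_rk_genFun (free V) 1 n).trans <| by
    rw [cls_free]
    rcases n with _ | n
    · rw [if_neg (by norm_num), totalWeight_zero, smul_zero]
    · rw [if_pos (by omega)]

theorem rk_pderiv_genFun_zero :
    rk (MvPowerSeries.pderiv (K0Rat C) 2 (genFun V 0)) =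
      (1 / 2 : ℚ) • egf fun m => if 1 ≤ m then swapTrace (V 0 (m + 2)) else 0 :=
  PowerSeries.ext fun n => (coeff_rk_pderiv_genFun V n).trans <| by
    refine Eq.trans ?_ (congrArg (fun x : K0Rat C => (1 / 2 : ℚ) • x)
      (coeff_egf (fun m => if 1 ≤ m then swapTrace (V 0 (m + 2)) else 0) n)).symm
    split_ifs
    · exact mul_smul _ _ _
    · rw [smul_zero, smul_zero]

end GenFun

end ModularOperad

end

theorem mainTheorem2 {C : Type u} [Category.{v} C] [Preadditive C] [Linear ℚ C]
    [HasBinaryBiproducts C] [HasFiniteColimits C] [MonoidalCategory C] [SymmetricCategory C]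
    [MonoidalPreadditive C] (V : ModularOperad.StableSModule C)
    (a b : ℕ → PowerSeries (ModularOperad.K0Rat C)) (a₀dot : PowerSeries (ModularOperad.K0Rat C))
    (ha : ∀ g, a g = ModularOperad.rk (ModularOperad.genFun V g))
    (hb : ∀ g, b g = ModularOperad.rk (ModularOperad.genFun (ModularOperad.free V) g))
    (ha₀dot : a₀dot = ModularOperad.rk
      (MvPowerSeries.pderiv (ModularOperad.K0Rat C) 2 (ModularOperad.genFun V 0))) :
    PowerSeries.HasSubst (PowerSeries.X - PowerSeries.derivative (ModularOperad.K0Rat C) (a 0)) ∧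
    PowerSeries.subst (PowerSeries.X - PowerSeries.derivative (ModularOperad.K0Rat C) (a 0)) (b 1) =
      a 1 - (1 / 2 : ℚ) • PowerSeries.logOf (1 - PowerSeries.derivative (ModularOperad.K0Rat C)
        (PowerSeries.derivative (ModularOperad.K0Rat C) (a 0))) + a₀dot * (a₀dot + 1) := by
  rw [ha, ha, hb, ha₀dot]
  exact ModularOperad.hasSubst_and_subst_eq (ModularOperad.derivative_rk_genFun_zero V)
    (ModularOperad.rk_genFun_one V) (ModularOperad.rk_genFun_free_one V)
    (ModularOperad.rk_pderiv_genFun_zero V)
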